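/- **Setting.** Let $\mathcal P=\langle \Sigma\mid\mathcal R\rangle$ be a semigroup presentation: $\mathcal R$ is a set of relations $u=v$ between nonempty words over the (arbitrary) alphabet $\Sigma$, with the convention that if $u=v$ belongs to $\mathcal R$ then $v=u$ does not (in particular no $u=u$ belongs to $\mathcal R$). Let $\mathcal G=\{G_s\mid s\in\Sigma\}$ be a collection of groups and $w\in\Sigma^+$ a nonempty word. **Diagrams.** A *braided diagram over $(\mathcal P,\mathcal G)$* consists of a frame, a finite nonempty collection of wires, each labelled by a pair $(s,g)$ with $s\in\Sigma$, $g\in G_s$, and a finite (possibly empty) collection of transistors. The top endpoint of each wire is attached to the top side of the frame or to the bottom side of a transistor; its bottom endpoint is attached to the bottom side of the frame or to the top side of a transistor; the endpoints attached to a given side are pairwise distinct and ordered from left to right. For each transistor $T$, if $\mathrm{top}^-(T)$ and $\mathrm{bot}^-(T)$ are the words over $\Sigma$ read from left to right on the wires attached to its top and bottom sides, then $\mathrm{top}^-(T)=\mathrm{bot}^-(T)$ or $\mathrm{bot}^-(T)=\mathrm{top}^-(T)$ belongs to $\mathcal R$. Writing $T_1\prec T_2$ if some wire has its bottom endpoint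 on the top side of $T_1$ and its top endpoint on the bottom side of $T_2$, the transitive closure of $\prec$ is a strict partial order. Diagrams are considered up to isomorphisms preserving labels, attachments and left-to-right orders. Let $\mathrm{top}^-(\Delta)$ and $\mathrm{bot}^-(\Delta)$ be the words over $\Sigma$ read along the top and bottom sides of the frame; a *$(w,\ast)$-diagram* is a diagram $\Delta$ with $\mathrm{top}^-(\Delta)=w$. If $\mathrm{bot}^-(\Delta_1)=\mathrm{top}^-(\Delta_2)$, the *concatenation* $\Delta_1\circ\Delta_2$ is obtained by placing $\Delta_2$ below $\Delta_1$, removing the bottom side of the frame of $\Delta_1$ and the top side of the frame of $\Delta_2$, and gluing, from left to right, the wires attached there; gluing a wire labelled $(s,g)$ above to one labelled $(s,h)$ below yields a wire labelled $(s,gh)$. A *dipole* in $\Delta$ is a pair of transistors $T_1\prec T_2$ such that the wires on the top side of $T_1$ are exactly the wires on the bottom side of $T_2$, in the same order, all have trivial second coordinate, and $\mathrm{top}^-(T_2)=\mathrm{bot}^-(T_1)$. *Reducing* it means removing $T_1$, $T_2$ and the wires between them, and gluing, from left to right, the wires attached to the top side of $T_2$ to the wires attached to the bottom side of $T_1$,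 multiplying labels as above (upper times lower). A diagram is *reduced* if it has no dipole; reducing dipoles as long as possible gives the *reduction* of a diagram. Let $\Delta_1\cdot\Delta_2$ be the reduction of $\Delta_1\circ\Delta_2$. A *permutation diagram* has no transistor and all its wires have trivial second coordinate. A *transistor diagram* is a planar diagram with exactly one transistor and all second coordinates trivial; a *linear diagram* is a planar diagram without transistors and with exactly one wire having nontrivial second coordinate. *Unitary diagrams* are the transistor diagrams and the linear diagrams. For $w=s_1\cdots s_m$, let $\epsilon(w)$ be the planar diagram without transistors whose wires are labelled $(s_1,1),\dots,(s_m,1)$ from left to right. **The graph.** Let $X_b(\mathcal P,\mathcal G)$ be the simple graph whose vertices are the classes $[\Delta]=\{\Delta\cdot P\mid P \text{ permutation diagram}\}$, where $\Delta$ is a braided diagram over $(\mathcal P,\mathcal G)$, and in which two distinct classes $[\Delta_1],[\Delta_2]$ are adjacent if there are $\Delta_1'\in[\Delta_1]$, $\Delta_2'\in[\Delta_2]$ and a unitary diagram $U$ such that $\Delta_2'=\Delta_1'\cdot U$ or $\Delta_1'=\Delta_2'\cdot U$. Let $X_b(\mathcal P,\mathcal G,w)$ be the connected component of $X_b(\mathcal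 P,\mathcal G)$ containing $[\epsilon(w)]$. **Graph-theoretic notions.** Let $d$ be the graph distance. A connected graph is *weakly modular* if (triangle condition) whenever $v,v'$ are adjacent vertices with $d(u,v)=d(u,v')=k$, there is a common neighbour of $v,v'$ at distance $k-1$ from $u$; and (quadrangle condition) whenever $d(u,z)=k$ and $v\neq v'$ are neighbours of $z$ at distance $k-1$ from $u$, there is a common neighbour of $v,v'$ at distance $k-2$ from $u$. A graph is *quasi-median* if it is connected, weakly modular, and contains neither $K_4^-$ (the complete graph $K_4$ minus one edge) nor the complete bipartite graph $K_{3,2}$ as an induced subgraph. A connected graph is *median* if for all vertices $x,y,z$ there is a unique vertex $m$ with $d(a,m)+d(m,b)=d(a,b)$ for every pair $\{a,b\}$ among $x,y$; $y,z$; $x,z$. **Theorem.** 1. The vertices of $X_b(\mathcal P,\mathcal G,w)$ are exactly the classes $[\Delta]$ of braided $(w,\ast)$-diagrams $\Delta$ over $(\mathcal P,\mathcal G)$. 2. $X_b(\mathcal P,\mathcal G,w)$ is a quasi-median graph. 3. If all the groups $G_s$ are trivial, then $X_b(\mathcal P,\mathcal G,w)$ is a median graph. -/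

import Mathlib

universe u v

/-! ### Quasi-median and median graphs -/

namespace SimpleGraph

variable {V : Type u}

/-- Triangle condition: two adjacent vertices `a`, `b` at the same distance `k` from `o` have a
common neighbour at distance `k - 1` from `o`. -/
def TriangleCondition (X : SimpleGraph V) : Prop :=
  ∀ o a b : V, X.Adj a b → X.dist o a = X.dist o b →
    ∃ x : V, X.Adj a x ∧ X.Adj b x ∧ X.dist o x + 1 = X.dist o a

/-- Quadrangle condition: two distinct neighbours `a`, `b` of `z`, both at distance `k - 1` from
`o` where `k` is the distance from `o` to `z`, have a common neighbour at distance `k - 2`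
from `o`. -/
def QuadrangleCondition (X : SimpleGraph V) : Prop :=
  ∀ o z a b : V, X.Adj z a → X.Adj z b → a ≠ b →
    X.dist o a + 1 = X.dist o z → X.dist o b + 1 = X.dist o z →
    ∃ x : V, X.Adj a x ∧ X.Adj b x ∧ X.dist o x + 2 = X.dist o z

/-- A connected graph satisfying the triangle and quadrangle conditions. -/
def IsWeaklyModular (X : SimpleGraph V) : Prop :=
  X.Connected ∧ X.TriangleCondition ∧ X.QuadrangleCondition

/-- The graph `K₄⁻`: the complete graph on four vertices minus one edge. -/
def K4Minus : SimpleGraph (Fin 4) := (⊤ : SimpleGraph (Fin 4)).deleteEdges {s(0, 1)}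

/-- A weakly modular graph without induced `K₄⁻` and without induced `K_{3,2}`. -/
def IsQuasiMedian (X : SimpleGraph V) : Prop :=
  X.IsWeaklyModular ∧ ¬ K4Minus.IsIndContained X ∧
    ¬ (completeBipartiteGraph (Fin 3) (Fin 2)).IsIndContained X

/-- `m` lies on some geodesic from `x` to `y`. -/
def OnGeodesic (X : SimpleGraph V) (x y m : V) : Prop :=
  X.dist x m + X.dist m y = X.dist x y

/-- A connected graph in which any three vertices have a unique median. -/
def IsMedian (X : SimpleGraph V) : Prop :=
  X.Connected ∧ ∀ x y z : V, ∃! m : V,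
    X.OnGeodesic x y m ∧ X.OnGeodesic y z m ∧ X.OnGeodesic x z m

end SimpleGraph

/-! ### Semigroup presentations and braided diagrams -/

/-- A semigroup presentation `⟨A | R⟩`: a set of relations `l = r` between nonempty words over the
alphabet `A`, with the convention that `r = l` is not a relation if `l = r` is one (in particular
there is no relation `l = l`). -/
structure SemigroupPresentation (A : Type u) where
  rel : List A → List A → Prop
  ne_nil_left : ∀ l r, rel l r → l ≠ []
  ne_nil_right : ∀ l r, rel l r → r ≠ []
  asymm : ∀ l r, rel l r → ¬ rel r l

/-- The presentation `P(G)` over the alphabet `Σ(G) = {(s, g) | g ∈ G s}`, whose relations are all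
the pairs of words that project to a relation of `P`. -/
def SemigroupPresentation.extend {A : Type u} (P : SemigroupPresentation A) (G : A → Type v) :
    SemigroupPresentation (Sigma G) where
  rel l r := P.rel (l.map Sigma.fst) (r.map Sigma.fst)
  ne_nil_left l r h := by
    have := P.ne_nil_left _ _ h
    simpa using this
  ne_nil_right l r h := by
    have := P.ne_nil_right _ _ h
    simpa using this
  asymm l r h := P.asymm _ _ h

/-- A braided diagram over a semigroup presentation, as combinatorial data.

A point where wires are attached is a *contact*: `none` stands for the frame and `some T` for the
transistor `T`.
* `wiresBelow c` lists, from left to right, the wires whose *top* endpoint is attached to `c`: they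
  are attached to the top side of the frame if `c = none`, and to the bottom side of `T` if
  `c = some T`.
* `wiresAbove c` lists, from left to right, the wires whose *bottom* endpoint is attached to `c`:
  they are attached to the bottom side of the frame if `c = none`, and to the top side of `T` if
  `c = some T`. -/
structure BraidedDiagram {A : Type u} (Q : SemigroupPresentation A) where
  Wire : Type
  Transistor : Type
  finite_wire : Finite Wire
  nonempty_wire : Nonempty Wire
  finite_transistor : Finite Transistor
  label : Wire → A
  wiresBelow : Option Transistor → List Wire
  wiresAbove : Option Transistor → List Wire
  /-- the top endpoint of each wire is attached at exactly one place -/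
  top_attached : ∀ x : Wire, ∃! p : Option Transistor × ℕ, (wiresBelow p.1)[p.2]? = some x
  /-- the bottom endpoint of each wire is attached at exactly one place -/
  bottom_attached : ∀ x : Wire, ∃! p : Option Transistor × ℕ, (wiresAbove p.1)[p.2]? = some x
  /-- the top label and the bottom label of a transistor form a relation, in some order -/
  transistor_rel : ∀ T : Transistor,
    Q.rel ((wiresAbove (some T)).map label) ((wiresBelow (some T)).map label) ∨
    Q.rel ((wiresBelow (some T)).map label) ((wiresAbove (some T)).map label)
  /-- Write `T₁ ≺ T₂` if the bottom of some wire is attached to the top side of `T₁` and its top to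
  the bottom side of `T₂`. The transitive closure of `≺` is a strict partial order. -/
  acyclic : ∀ T : Transistor, ¬ Relation.TransGen
    (fun T₁ T₂ : Transistor => ∃ x, x ∈ wiresAbove (some T₁) ∧ x ∈ wiresBelow (some T₂)) T T

/-- Equivalence of braided diagrams: an isomorphism of all the data. -/
def BraidedDiagram.Equivalent {A : Type u} {Q : SemigroupPresentation A}
    (D E : BraidedDiagram Q) : Prop :=
  ∃ (j : D.Wire ≃ E.Wire) (t : D.Transistor ≃ E.Transistor),
    (∀ x, E.label (j x) = D.label x) ∧
    (∀ c, E.wiresBelow (c.map t) = (D.wiresBelow c).map j) ∧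
    (∀ c, E.wiresAbove (c.map t) = (D.wiresAbove c).map j)

/-! ### Braided diagrams over `(P, G)` -/

section Picture

variable {A : Type u} (P : SemigroupPresentation A) (G : A → Type v)

/-- Braided diagrams over `(P, G)`. -/
abbrev PictureDiagram := BraidedDiagram (P.extend G)

namespace PictureDiagram

variable {P G}

/-- The word over `A` read on a list of wires, forgetting the second coordinates of the labels. -/
def word (D : PictureDiagram P G) (l : List D.Wire) : List A :=
  l.map fun x => (D.label x).1

/-- The top label over `A` of a diagram (read along the top side of its frame). -/
def topWord (D : PictureDiagram P G) : List A := D.word (D.wiresBelow none)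

/-- The bottom label over `A` of a diagram (read along the bottom side of its frame). -/
def botWord (D : PictureDiagram P G) : List A := D.word (D.wiresAbove none)

variable [∀ s, Group (G s)]

/-- `c = (s, g * h)` is the label of the wire obtained by gluing the bottom of a wire labelled
`a = (s, g)` to the top of a wire labelled `b = (s, h)`. -/
def LabelMul (a b c : Sigma G) : Prop :=
  ∃ (s : A) (g h : G s), a = ⟨s, g⟩ ∧ b = ⟨s, h⟩ ∧ c = ⟨s, g * h⟩

/-- The wire `x` is labelled by a letter with trivial second coordinate. -/
def TrivialLabel (D : PictureDiagram P G) (x : D.Wire) : Prop := (D.label x).2 = 1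

/-- `D` is (a representative of) the concatenation `D₁ ∘ D₂`, defined when the bottom word of `D₁`
is the top word of `D₂`: the transistors are those of `D₁` and `D₂`; the bottom endpoints of the
wires on the bottom side of the frame of `D₁` are glued, from left to right, to the top endpoints
of the wires on the top side of the frame of `D₂`; second coordinates are multiplied along glued
wires. The maps `j₁`, `j₂` send wires to the wires of `D` that contain them; since each endpoint of
a wire of `D` is attached exactly once, they are injective, jointly surjective and identify only
the wires which are glued. -/
def IsConcat (D₁ D₂ D : PictureDiagram P G) : Prop :=
  D₁.botWord = D₂.topWord ∧
  ∃ (j₁ : D₁.Wire → D.Wire) (j₂ : D₂.Wire → D.Wire)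
    (t : D₁.Transistor ⊕ D₂.Transistor ≃ D.Transistor),
    (∀ T, D.wiresBelow (some (t (Sum.inl T))) = (D₁.wiresBelow (some T)).map j₁) ∧
    (∀ T, D.wiresAbove (some (t (Sum.inl T))) = (D₁.wiresAbove (some T)).map j₁) ∧
    (∀ T, D.wiresBelow (some (t (Sum.inr T))) = (D₂.wiresBelow (some T)).map j₂) ∧
    (∀ T, D.wiresAbove (some (t (Sum.inr T))) = (D₂.wiresAbove (some T)).map j₂) ∧
    D.wiresBelow none = (D₁.wiresBelow none).map j₁ ∧
    D.wiresAbove none = (D₂.wiresAbove none).map j₂ ∧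
    (D₁.wiresAbove none).map j₁ = (D₂.wiresBelow none).map j₂ ∧
    (∀ x, x ∉ D₁.wiresAbove none → D.label (j₁ x) = D₁.label x) ∧
    (∀ x, x ∉ D₂.wiresBelow none → D.label (j₂ x) = D₂.label x) ∧
    (∀ p ∈ (D₁.wiresAbove none).zip (D₂.wiresBelow none),
      LabelMul (D₁.label p.1) (D₂.label p.2) (D.label (j₁ p.1)))

/-- The transistors `T₁`, `T₂` form a dipole (with `T₁` below `T₂`): the wires on the top side of
`T₁` are exactly the wires on the bottom side of `T₂`, in the same order, and have trivial second
coordinates; and the top word of `T₂` is the bottom word of `T₁`. -/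
def IsDipole (D : PictureDiagram P G) (T₁ T₂ : D.Transistor) : Prop :=
  D.wiresAbove (some T₁) = D.wiresBelow (some T₂) ∧
  D.word (D.wiresAbove (some T₂)) = D.word (D.wiresBelow (some T₁)) ∧
  ∀ x ∈ D.wiresAbove (some T₁), D.TrivialLabel x

/-- `E` is obtained from `D` by reducing one dipole `T₁`, `T₂`: the two transistors and the wires
between them are removed, the bottom endpoints of the wires on the top side of `T₂` are glued, from
left to right, to the top endpoints of the wires on the bottom side of `T₁`, and second coordinates
are multiplied along glued wires. The value of `j` on a removed wire is irrelevant; on the other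
wires `j x` is the wire of `E` that contains `x`, and since each endpoint of a wire of `E` is
attached exactly once, `j` is surjective and identifies only the wires which are glued. -/
def DipoleReduction (D E : PictureDiagram P G) : Prop :=
  ∃ T₁ T₂ : D.Transistor, D.IsDipole T₁ T₂ ∧
  ∃ (j : D.Wire → E.Wire) (t : E.Transistor ≃ {T : D.Transistor // T ≠ T₁ ∧ T ≠ T₂}),
    (∀ T, E.wiresBelow (some T) = (D.wiresBelow (some (t T).1)).map j) ∧
    (∀ T, E.wiresAbove (some T) = (D.wiresAbove (some (t T).1)).map j) ∧
    E.wiresBelow none = (D.wiresBelow none).map j ∧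
    E.wiresAbove none = (D.wiresAbove none).map j ∧
    (D.wiresAbove (some T₂)).map j = (D.wiresBelow (some T₁)).map j ∧
    (∀ x, x ∉ D.wiresAbove (some T₁) → x ∉ D.wiresAbove (some T₂) →
      x ∉ D.wiresBelow (some T₁) → E.label (j x) = D.label x) ∧
    (∀ p ∈ (D.wiresAbove (some T₂)).zip (D.wiresBelow (some T₁)),
      LabelMul (D.label p.1) (D.label p.2) (E.label (j p.1)))

/-- A diagram without dipoles. -/
def IsReduced (D : PictureDiagram P G) : Prop := ∀ T₁ T₂ : D.Transistor, ¬ D.IsDipole T₁ T₂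

/-- `R` is (a representative of) the reduction of `D`: it is reduced and obtained from `D` by
reducing dipoles, where diagrams are considered up to equivalence. -/
def IsReductionOf (R D : PictureDiagram P G) : Prop :=
  R.IsReduced ∧
  Relation.ReflTransGen
    (fun E F : PictureDiagram P G => DipoleReduction E F ∨ BraidedDiagram.Equivalent E F) D R

/-- `D = D₁ · D₂`, the reduction of the concatenation `D₁ ∘ D₂`. -/
def IsProduct (D₁ D₂ D : PictureDiagram P G) : Prop :=
  ∃ C : PictureDiagram P G, IsConcat D₁ D₂ C ∧ D.IsReductionOf C

/-- A permutation diagram: no transistors, and trivial second coordinates. -/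
def IsPermutation (D : PictureDiagram P G) : Prop :=
  IsEmpty D.Transistor ∧ ∀ x, D.TrivialLabel x

/-- A transistor diagram: a planar diagram with a single transistor and trivial second coordinates.
Planarity means that, apart from the wires attached to the transistor, some wires `a` on its left
and some wires `b` on its right join the top and the bottom of the frame in the same order. -/
def IsTransistorDiagram (D : PictureDiagram P G) : Prop :=
  (∀ x, D.TrivialLabel x) ∧
  ∃ T : D.Transistor, (∀ S, S = T) ∧
  ∃ a b : List D.Wire,
    D.wiresBelow none = a ++ D.wiresAbove (some T) ++ b ∧
    D.wiresAbove none = a ++ D.wiresBelow (some T) ++ b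

/-- A linear diagram: a planar diagram without transistors (so that its wires have the same
left-to-right order on the top and on the bottom of the frame), with exactly one wire whose label
has a nontrivial second coordinate. -/
def IsLinear (D : PictureDiagram P G) : Prop :=
  IsEmpty D.Transistor ∧ D.wiresBelow none = D.wiresAbove none ∧ ∃! x, ¬ D.TrivialLabel x

/-- Unitary diagrams: transistor diagrams and linear diagrams. -/
def IsUnitary (D : PictureDiagram P G) : Prop := D.IsTransistorDiagram ∨ D.IsLinear

/-- The class `[D] = {D · Q | Q permutation diagram}`, as a set of (representatives of) reduced
diagrams. -/
def diagramClass (D : PictureDiagram P G) : Set (PictureDiagram P G) :=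
  {R | ∃ Q : PictureDiagram P G, Q.IsPermutation ∧ IsProduct D Q R}

end PictureDiagram

/-- The diagram `ε(z)`, for a nonempty word `z` over `Σ(G)`: no transistors, and wires joining the
top and the bottom of the frame in the same order, labelled by the letters of `z`. -/
def epsilonDiagram (z : List (Sigma G)) (hz : z ≠ []) : PictureDiagram P G where
  Wire := Fin z.length
  Transistor := Empty
  finite_wire := inferInstance
  nonempty_wire := ⟨⟨0, List.length_pos_of_ne_nil hz⟩⟩
  finite_transistor := inferInstance
  label := z.get
  wiresBelow _ := List.finRange z.length
  wiresAbove _ := List.finRange z.length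
  top_attached x := by
    refine ⟨(none, x), by simp, ?_⟩
    rintro ⟨_ | T, i⟩ h
    · simp [List.getElem?_eq_some_iff] at h
      obtain ⟨h, rfl⟩ := h
      rfl
    · exact T.elim
  bottom_attached x := by
    refine ⟨(none, x), by simp, ?_⟩
    rintro ⟨_ | T, i⟩ h
    · simp [List.getElem?_eq_some_iff] at h
      obtain ⟨h, rfl⟩ := h
      rfl
    · exact T.elim
  transistor_rel T := T.elim
  acyclic T := T.elim

variable [∀ s, Group (G s)]

/-- The vertices of `X_b(P, G)`: the classes `[D]`, for `D` a braided diagram over `(P, G)`. -/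
def PictureVertex : Type (max u v 1) :=
  {C : Set (PictureDiagram P G) // ∃ D : PictureDiagram P G, C = D.diagramClass}

variable {P G} in
/-- The vertex `[D]`. -/
def PictureVertex.mk (D : PictureDiagram P G) : PictureVertex P G := ⟨D.diagramClass, D, rfl⟩

/-- The graph `X_b(P, G)`: distinct classes are adjacent if a representative of one is obtained from
a representative of the other by right multiplication by a unitary diagram. -/
def bigPictureGraph : SimpleGraph (PictureVertex P G) :=
  SimpleGraph.fromRel fun C₁ C₂ => ∃ D₁ ∈ C₁.1, ∃ D₂ ∈ C₂.1, ∃ U : PictureDiagram P G,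
    U.IsUnitary ∧ PictureDiagram.IsProduct D₁ U D₂

/-- The connected component of `X_b(P, G)` containing the trivial diagram `ε(w)`, whose wires are
labelled by the letters of `w` and trivial second coordinates. -/
def baseComponent (w : List A) (hw : w ≠ []) : (bigPictureGraph P G).ConnectedComponent :=
  (bigPictureGraph P G).connectedComponentMk
    (PictureVertex.mk (epsilonDiagram P G (w.map fun s => ⟨s, 1⟩) (by simpa using hw)))

/-- The graph `X_b(P, G, w)`. -/
def pictureGraph (w : List A) (hw : w ≠ []) :
    SimpleGraph (baseComponent P G w hw).supp :=
  (bigPictureGraph P G).induce (baseComponent P G w hw).supp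

end Picture

/-! Every wire of a reduced diagram has an intrinsic name. The `i`-th wire on the top of the frame
is `gen i`; a wire leaving the bottom side of a transistor records the names and labels on the top
side of that transistor, its bottom word and a position. A transistor thus becomes a pair `(l, r)`
that makes sense without the diagram containing it, and so does a nontrivial label on a named wire.
Up to a permutation of its bottom side, a reduced diagram with top word `w` is the finite set of
these events. The sets that occur are the configurations of an event structure, `wireEvents`: an
event requires those which create the wires it uses, and two events conflict if they use one wire in
different ways.

Multiplying by a unitary diagram adds or removes a transistor with nothing attached below it, or
changes the label of a wire ending on the bottom of the frame. In terms of configurations, it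
changes the value at one key, a key being either a transistor or the name of a wire carrying labels.
Conversely every change at one key is such a product (`Represents.adj_iff`).

The rest is Hamming geometry. The distance of two configurations is the number of keys at which they
differ, so the triangle condition is a replacement of one value, the quadrangle condition is a
majority vote among three configurations, and both forbidden subgraphs are excluded by comparing
coordinates (`IsHammingModel`). If the groups are trivial, each key takes at most two values, and
the majority is the unique median.

The link between diagrams and configurations is evaluation: values are pushed from the top of the
frame to the bottom, and a transistor inverse to the one that produced its inputs restores the
earlier values (`act`). Dipole reductions preserve evaluation (`Evaluates.of_dipoleReduction`). In a
reduced diagram nothing cancels (`IsReduced.not_cancels`), so names are distinct and the values on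
the bottom determine the diagram up to isomorphism (`IsNaming.equivalent`). Uniqueness of reductions
is thereby obtained without a confluence argument. -/

namespace SimpleGraph

/-! ### Hamming models of quasi-median and median graphs -/

/-- The coordinates at which two functions differ. -/
def disagreement {K Y : Type*} (f g : K → Y) : Set K := {k | f k ≠ g k}

theorem disagreement_comm {K Y : Type*} (f g : K → Y) :
    disagreement f g = disagreement g f := by
  ext k
  exact ne_comm

theorem disagreement_triangle {K Y : Type*} (f g h : K → Y) :
    disagreement f h ⊆ disagreement f g ∪ disagreement g h := by
  intro k hk
  by_contra hn
  simp only [disagreement, Set.mem_union, Set.mem_ofPred_eq, not_or, not_not] at hn hk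
  exact hk (hn.1.trans hn.2)

/-- A graph whose vertices are functions `K → Y`, two of them adjacent when they differ at exactly
one coordinate, with closure properties that make it quasi-median. -/
structure IsHammingModel {V K Y : Type*} (X : SimpleGraph V) (φ : V → K → Y) : Prop where
  injective : Function.Injective φ
  finite : ∀ a b, (disagreement (φ a) (φ b)).Finite
  adj_iff : ∀ a b, X.Adj a b ↔ ∃ k, φ a k ≠ φ b k ∧ ∀ k', k' ≠ k → φ a k' = φ b k'
  /-- some coordinate can be changed towards the target -/
  step : ∀ a b, a ≠ b → ∃ k, φ a k ≠ φ b k ∧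
    ((∃ c, φ c k = φ b k ∧ ∀ k', k' ≠ k → φ c k' = φ a k') ∨
      ∃ c, φ c k = φ a k ∧ ∀ k', k' ≠ k → φ c k' = φ b k')
  /-- a coordinate which can be changed can be changed to any value that it takes -/
  swap : ∀ a b o k, φ a k ≠ φ b k → (∀ k', k' ≠ k → φ a k' = φ b k') →
    ∃ c, φ c k = φ o k ∧ ∀ k', k' ≠ k → φ c k' = φ a k'
  majority : ∀ a b o, (∀ k, φ a k = φ b k ∨ φ a k = φ o k ∨ φ b k = φ o k) →
    ∃ c, ∀ k, (φ a k = φ b k → φ c k = φ a k) ∧ (φ a k = φ o k → φ c k = φ a k) ∧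
      (φ b k = φ o k → φ c k = φ b k)

namespace IsHammingModel

variable {V K Y : Type*} {X : SimpleGraph V} {φ : V → K → Y}

theorem ncard_eq_zero (h : IsHammingModel X φ) {a b : V} :
    (disagreement (φ a) (φ b)).ncard = 0 ↔ a = b := by
  rw [Set.ncard_eq_zero (h.finite a b)]
  constructor
  · intro he
    apply h.injective
    funext k
    by_contra hk
    have : k ∈ disagreement (φ a) (φ b) := hk
    simp [he] at this
  · rintro rfl
    simp [disagreement]

theorem ncard_of_adj (h : IsHammingModel X φ) {a b : V} (hab : X.Adj a b) :
    (disagreement (φ a) (φ b)).ncard = 1 := by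
  obtain ⟨k, hk, hk'⟩ := (h.adj_iff a b).1 hab
  rw [Set.ncard_eq_one]
  refine ⟨k, Set.ext fun k' => ⟨fun hn => ?_, ?_⟩⟩
  · by_contra hne
    exact hn (hk' k' hne)
  · rintro rfl
    exact hk

theorem ncard_le_length (h : IsHammingModel X φ) {a b : V} (p : X.Walk a b) :
    (disagreement (φ a) (φ b)).ncard ≤ p.length := by
  induction p with
  | nil => simp [h.ncard_eq_zero.2 rfl]
  | @cons a c b hac p ih =>
    have h1 := Set.ncard_le_ncard (disagreement_triangle (φ a) (φ c) (φ b))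
      ((h.finite a c).union (h.finite c b))
    have h2 := Set.ncard_union_le (disagreement (φ a) (φ c)) (disagreement (φ c) (φ b))
    have h3 := h.ncard_of_adj hac
    simp only [Walk.length_cons]
    omega

/-- Changing one coordinate of `a` to that of `o` decreases the number of disagreements by one. -/
theorem ncard_update (h : IsHammingModel X φ) {o a c : V} {k : K} (hk : φ a k ≠ φ o k)
    (hc : φ c k = φ o k) (hk' : ∀ k', k' ≠ k → φ c k' = φ a k') :
    (disagreement (φ o) (φ c)).ncard + 1 = (disagreement (φ o) (φ a)).ncard := by
  have : disagreement (φ o) (φ c) = disagreement (φ o) (φ a) \ {k} := by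
    ext k'
    simp only [disagreement, Set.mem_ofPred_eq, Set.mem_sdiff, Set.mem_singleton_iff]
    by_cases hkk : k' = k
    · subst hkk
      simp [hc]
    · simp [hk' k' hkk, hkk]
  rw [this]
  exact Set.ncard_sdiff_singleton_add_one (show k ∈ disagreement (φ o) (φ a) from Ne.symm hk)
    (h.finite o a)

/-- Each use of `step` removes one disagreement, but it chooses the end at which the move is
possible; the walk therefore grows from both ends. -/
theorem exists_walk (h : IsHammingModel X φ) (n : ℕ) : ∀ a b : V,
    (disagreement (φ a) (φ b)).ncard = n → ∃ p : X.Walk a b, p.length = n := by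
  induction n with
  | zero =>
    intro a b hab
    obtain rfl := h.ncard_eq_zero.1 hab
    exact ⟨Walk.nil, rfl⟩
  | succ n ih =>
    intro a b hab
    have hne : a ≠ b := by
      rintro rfl
      rw [h.ncard_eq_zero.2 rfl] at hab
      omega
    obtain ⟨k, hk, ⟨c, hc, hc'⟩ | ⟨c, hc, hc'⟩⟩ := h.step a b hne
    · have h1 := h.ncard_update hk hc hc'
      rw [disagreement_comm, disagreement_comm (φ b)] at h1
      obtain ⟨p, hp⟩ := ih c b (by omega)
      exact ⟨Walk.cons ((h.adj_iff a c).2 ⟨k, by rwa [hc], fun k' h' => (hc' k' h').symm⟩) p,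
        by simp [hp]⟩
    · have h1 := h.ncard_update hk.symm hc hc'
      obtain ⟨p, hp⟩ := ih a c (by omega)
      have hcb : X.Adj c b := (h.adj_iff c b).2 ⟨k, by rwa [hc], hc'⟩
      exact ⟨p.concat hcb, by simp [hp]⟩

theorem connected [Nonempty V] (h : IsHammingModel X φ) : X.Connected :=
  ⟨fun a b => ⟨(h.exists_walk _ a b rfl).choose⟩⟩

theorem dist_eq [Nonempty V] (h : IsHammingModel X φ) (a b : V) :
    X.dist a b = (disagreement (φ a) (φ b)).ncard := by
  apply le_antisymm
  · obtain ⟨p, hp⟩ := h.exists_walk _ a b rfl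
    exact hp ▸ dist_le p
  · obtain ⟨p, hp⟩ := h.connected.exists_walk_length_eq_dist a b
    exact hp ▸ h.ncard_le_length p

/-- If `b` still disagreed with `o` at `k`, every disagreement of `a` with `o` would also be one of
`b`. -/
theorem eq_of_dist_lt [Nonempty V] (h : IsHammingModel X φ) {o a b : V} {k : K}
    (hk' : ∀ k', k' ≠ k → φ a k' = φ b k') (hd : X.dist o b < X.dist o a) :
    φ b k = φ o k := by
  by_contra hk
  rw [h.dist_eq, h.dist_eq] at hd
  refine absurd (Set.ncard_le_ncard (fun k' hk1 => ?_) (h.finite o b)) (not_le.2 hd)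
  by_cases hkk : k' = k
  · subst hkk
    exact Ne.symm hk
  · have : φ o k' ≠ φ a k' := hk1
    rwa [hk' k' hkk] at this

/-- At the coordinate `k` where `a` and `b` differ, neither agrees with `o`, since otherwise one of
them would be closer. Giving this coordinate the value of `o` yields the common neighbour. -/
theorem triangleCondition [Nonempty V] (h : IsHammingModel X φ) : X.TriangleCondition := by
  intro o a b hab hd
  obtain ⟨k, hk, hk'⟩ := (h.adj_iff a b).1 hab
  have hao : φ a k ≠ φ o k := by
    intro he
    have := h.ncard_update (o := o) (a := b) (c := a) (he ▸ hk.symm) he hk'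
    rw [h.dist_eq, h.dist_eq] at hd
    omega
  have hbo : φ b k ≠ φ o k := by
    intro he
    have := h.ncard_update (o := o) (a := a) (c := b) (he ▸ hk) he fun k' h' => (hk' k' h').symm
    rw [h.dist_eq, h.dist_eq] at hd
    omega
  obtain ⟨c, hc, hc'⟩ := h.swap a b o k hk hk'
  refine ⟨c, (h.adj_iff a c).2 ⟨k, by rwa [hc], fun k' hn => (hc' k' hn).symm⟩,
    (h.adj_iff b c).2 ⟨k, by rwa [hc], fun k' hn => ((hc' k' hn).trans (hk' k' hn)).symm⟩, ?_⟩
  rw [h.dist_eq, h.dist_eq]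
  exact h.ncard_update hao hc hc'

/-- The neighbours `a` and `b` take the value of `o` at two different coordinates and agree
elsewhere. So the majority of `a`, `b`, `o` exists; it takes the value of `o` at both coordinates.
-/
theorem quadrangleCondition [Nonempty V] (h : IsHammingModel X φ) : X.QuadrangleCondition := by
  intro o z a b hza hzb hab ha hb
  obtain ⟨k, hk, hk'⟩ := (h.adj_iff z a).1 hza
  obtain ⟨l, hl, hl'⟩ := (h.adj_iff z b).1 hzb
  have hao : φ a k = φ o k := h.eq_of_dist_lt hk' (by omega)
  have hbo : φ b l = φ o l := h.eq_of_dist_lt hl' (by omega)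
  have hkl : k ≠ l := by
    rintro rfl
    refine hab (h.injective (funext fun k' => ?_))
    by_cases hkk : k' = k
    · subst hkk
      rw [hao, hbo]
    · rw [← hk' k' hkk, hl' k' hkk]
  obtain ⟨c, hc⟩ := h.majority a b o fun k' => by
    by_cases hkk : k' = k
    · subst hkk
      exact Or.inr (Or.inl hao)
    · by_cases hll : k' = l
      · subst hll
        exact Or.inr (Or.inr hbo)
      · exact Or.inl ((hk' k' hkk).symm.trans (hl' k' hll))
  have hck : φ c k = φ o k := ((hc k).2.1 hao).trans hao
  have hcl : φ c l = φ o l := ((hc l).2.2 hbo).trans hbo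
  have hca : ∀ k', k' ≠ l → φ c k' = φ a k' := by
    intro k' hn
    by_cases hkk : k' = k
    · subst hkk
      rw [hck, hao]
    · exact (hc k').1 ((hk' k' hkk).symm.trans (hl' k' hn))
  have hcb : ∀ k', k' ≠ k → φ c k' = φ b k' := by
    intro k' hn
    by_cases hkk : k' = l
    · subst hkk
      rw [hcl, hbo]
    · rw [hca k' hkk, ← hk' k' hn, hl' k' hkk]
  have hal : φ a l ≠ φ o l := by rwa [← hk' l hkl.symm, ← hbo]
  have hbk : φ b k ≠ φ o k := by rwa [← hl' k hkl, ← hao]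
  refine ⟨c, (h.adj_iff a c).2 ⟨l, by rwa [hcl], fun k' hn => (hca k' hn).symm⟩,
    (h.adj_iff b c).2 ⟨k, by rwa [hck], fun k' hn => (hcb k' hn).symm⟩, ?_⟩
  have := h.ncard_update hal hcl hca
  rw [h.dist_eq] at ha ⊢
  omega

/-- A common neighbour of two adjacent vertices differs from them at the same coordinate. -/
theorem eq_of_adj_adj (h : IsHammingModel X φ) {a b c : V} {k : K} (hk : φ a k ≠ φ b k)
    (hk' : ∀ k', k' ≠ k → φ a k' = φ b k') (hca : X.Adj c a) (hcb : X.Adj c b) :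
    ∀ k', k' ≠ k → φ c k' = φ a k' := by
  obtain ⟨l, hl, hl'⟩ := (h.adj_iff c a).1 hca
  obtain ⟨m, hm, hm'⟩ := (h.adj_iff c b).1 hcb
  by_cases hlk : l = k
  · subst hlk
    exact hl'
  · have hml : l = m := by
      by_contra hne
      exact hl ((hm' l hne).trans (hk' l hlk).symm)
    subst hml
    exact absurd ((hl' k (Ne.symm hlk)).symm.trans (hm' k (Ne.symm hlk))) hk

/-- Common neighbours of the two ends of an edge vary only at the coordinate of that edge, so two of
them are equal or adjacent. -/
theorem not_K4Minus (h : IsHammingModel X φ) : ¬ K4Minus.IsIndContained X := by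
  rintro ⟨f⟩
  have hadj : ∀ i j : Fin 4, K4Minus.Adj i j ↔ X.Adj (f i) (f j) := fun i j =>
    (f.map_rel_iff (a := i) (b := j)).symm
  have key : ∀ i j : Fin 4, i ≠ j → s(i, j) ≠ s(0, 1) → X.Adj (f i) (f j) := by
    intro i j hij hs
    rw [← hadj]
    simp [K4Minus, hij] at hs ⊢
    tauto
  have h23 := key 2 3 (by decide) (by decide)
  obtain ⟨k, hk, hk'⟩ := (h.adj_iff _ _).1 h23
  have h0 := h.eq_of_adj_adj hk hk' (key 0 2 (by decide) (by decide))
    (key 0 3 (by decide) (by decide))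
  have h1 := h.eq_of_adj_adj hk hk' (key 1 2 (by decide) (by decide))
    (key 1 3 (by decide) (by decide))
  have h01 : X.Adj (f 0) (f 1) := by
    refine (h.adj_iff _ _).2 ⟨k, fun he => ?_, fun k' hn => (h0 k' hn).trans (h1 k' hn).symm⟩
    have : f 0 = f 1 := h.injective (funext fun k' => by
      by_cases hkk : k' = k
      · rw [hkk, he]
      · exact (h0 k' hkk).trans (h1 k' hkk).symm)
    exact absurd (f.injective this) (by decide)
  rw [← hadj] at h01
  simp [K4Minus] at h01

/-- Two distinct nonadjacent vertices with a common neighbour differ at exactly two coordinates. A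
common neighbour is determined by which of the two has been changed, so there is no third one. -/
theorem not_K32 (h : IsHammingModel X φ) :
    ¬ (completeBipartiteGraph (Fin 3) (Fin 2)).IsIndContained X := by
  rintro ⟨f⟩
  have hadj : ∀ i j, (completeBipartiteGraph (Fin 3) (Fin 2)).Adj i j ↔ X.Adj (f i) (f j) :=
    fun i j => (f.map_rel_iff (a := i) (b := j)).symm
  set p := φ (f (Sum.inr 0)) with hp
  set q := φ (f (Sum.inr 1)) with hq
  have hpq : ¬ X.Adj (f (Sum.inr 0)) (f (Sum.inr 1)) := by
    rw [← hadj]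
    simp
  have hne : f (Sum.inr 0) ≠ f (Sum.inr 1) := fun he => by simpa using f.injective he
  have hcol : ∀ i : Fin 3, ∃ k, p k ≠ q k ∧ φ (f (Sum.inl i)) k = q k ∧
      ∀ k', k' ≠ k → φ (f (Sum.inl i)) k' = p k' := by
    intro i
    obtain ⟨k, hk, hk'⟩ := (h.adj_iff _ _).1 ((hadj (Sum.inl i) (Sum.inr 0)).1 (by simp))
    obtain ⟨l, hl, hl'⟩ := (h.adj_iff _ _).1 ((hadj (Sum.inl i) (Sum.inr 1)).1 (by simp))
    have hkl : k ≠ l := by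
      rintro rfl
      by_cases he : p k = q k
      · refine hne (h.injective (funext fun k' => ?_))
        by_cases hkk : k' = k
        · rw [hkk]
          exact he
        · rw [← hk' k' hkk, hl' k' hkk]
      · exact hpq ((h.adj_iff _ _).2 ⟨k, he, fun k' hn => (hk' k' hn).symm.trans (hl' k' hn)⟩)
    have hkq : φ (f (Sum.inl i)) k = q k := hl' k hkl
    exact ⟨k, fun he => hk (hkq.trans he.symm), hkq, hk'⟩
  choose k hk hkq hkp using hcol
  have hinj : Function.Injective k := by
    intro i j hij
    have : f (Sum.inl i) = f (Sum.inl j) := h.injective (funext fun k' => by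
      by_cases hkk : k' = k i
      · rw [hkk, hkq]
        rw [hij, hkq]
      · rw [hkp i k' hkk, hkp j k' (hij ▸ hkk)])
    simpa using f.injective this
  obtain ⟨l, hl, hl'⟩ := (h.adj_iff _ _).1 ((hadj (Sum.inl 0) (Sum.inr 1)).1 (by simp))
  have hbound : ∀ k', p k' ≠ q k' → k' = k 0 ∨ k' = l := by
    intro k' hn
    by_contra hcon
    push Not at hcon
    exact hn ((hkp 0 k' hcon.1).symm.trans (hl' k' hcon.2))
  have h1 := hbound _ (hk 1)
  have h2 := hbound _ (hk 2)
  have e1 : k 1 ≠ k 0 := fun he => absurd (hinj he) (by decide)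
  have e2 : k 2 ≠ k 0 := fun he => absurd (hinj he) (by decide)
  have e3 : k 1 ≠ k 2 := fun he => absurd (hinj he) (by decide)
  exact e3 ((h1.resolve_left e1).trans (h2.resolve_left e2).symm)

theorem isQuasiMedian [Nonempty V] (h : IsHammingModel X φ) : X.IsQuasiMedian :=
  ⟨⟨h.connected, h.triangleCondition, h.quadrangleCondition⟩, h.not_K4Minus, h.not_K32⟩

/-- Equality in the triangle inequality means that the disagreements of `a` with `m` and of `m` with
`b` are disjoint, that is, `m` takes a third value nowhere. -/
theorem onGeodesic_iff [Nonempty V] (h : IsHammingModel X φ) {a b m : V} :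
    X.OnGeodesic a b m ↔ ∀ k, φ m k = φ a k ∨ φ m k = φ b k := by
  rw [OnGeodesic, h.dist_eq, h.dist_eq, h.dist_eq,
    ← Set.ncard_union_add_ncard_inter _ _ (h.finite a m) (h.finite m b)]
  have hsub := disagreement_triangle (φ a) (φ m) (φ b)
  have hfin := (h.finite a m).union (h.finite m b)
  constructor
  · intro he k
    have h0 : (disagreement (φ a) (φ m) ∩ disagreement (φ m) (φ b)).ncard = 0 := by
      have := Set.ncard_le_ncard hsub hfin
      omega
    rw [Set.ncard_eq_zero ((h.finite a m).inter_of_left _)] at h0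
    by_contra hcon
    push Not at hcon
    have : k ∈ disagreement (φ a) (φ m) ∩ disagreement (φ m) (φ b) :=
      ⟨Ne.symm hcon.1, hcon.2⟩
    simp [h0] at this
  · intro hm
    have h0 : disagreement (φ a) (φ m) ∩ disagreement (φ m) (φ b) = ∅ := by
      ext k
      simp only [disagreement, Set.mem_inter_iff, Set.mem_ofPred_eq, Set.mem_empty_iff_false,
        iff_false, not_and, not_not]
      intro h1
      exact (hm k).resolve_left (Ne.symm h1)
    have h1 : disagreement (φ a) (φ m) ∪ disagreement (φ m) (φ b) ⊆
        disagreement (φ a) (φ b) := by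
      rintro k (hk | hk) he <;> rcases hm k with h' | h'
      · exact hk h'.symm
      · exact hk (he.trans h'.symm)
      · exact hk (h'.trans he)
      · exact hk h'
    rw [h0, Set.ncard_empty, h1.antisymm hsub, add_zero]

/-- By `onGeodesic_iff` a median must take the majority value at each coordinate, which exists by
`htwo`. -/
theorem isMedian [Nonempty V] (h : IsHammingModel X φ)
    (htwo : ∀ a b c k, φ a k = φ b k ∨ φ a k = φ c k ∨ φ b k = φ c k) : X.IsMedian := by
  refine ⟨h.connected, fun a b c => ?_⟩
  obtain ⟨m, hm⟩ := h.majority a b c (htwo a b c)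
  simp only [h.onGeodesic_iff]
  refine ⟨m, ⟨fun k => ?_, fun k => ?_, fun k => ?_⟩, fun n hn => ?_⟩
  all_goals try have hk := hm k; have := htwo a b c k; grind
  refine h.injective (funext fun k => ?_)
  have hk := hm k
  have := htwo a b c k
  have h1 := hn.1 k
  have h2 := hn.2.1 k
  have h3 := hn.2.2 k
  grind

end IsHammingModel

end SimpleGraph

/-! ### Names of wires and the action of transistors on values -/

section Names

variable (A : Type u) (G : A → Type v)

/-- Canonical names of the wires of a reduced diagram. The wires attached to the top side of the
frame are numbered; a wire attached to the bottom side of a transistor is named by the names and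
labels of the wires attached to the top side of the transistor, the word on its bottom side and a
position. -/
inductive WireName : Type (max u v)
  | gen (i : ℕ)
  | out (l : List (WireName × Sigma G)) (r : List A) (j : ℕ)

/-- The name of a wire, together with the label accumulated along the wire. -/
abbrev WireValue := WireName A G × Sigma G

variable {A G}

namespace WireValue

/-- The word over `A` of a list of values. -/
def word (l : List (WireValue A G)) : List A := l.map fun v => v.2.1

@[simp] theorem length_word (l : List (WireValue A G)) : (word l).length = l.length :=
  List.length_map _

theorem sizeOf_lt_of_mem {x : WireName A G} {g : Sigma G} {l : List (WireValue A G)}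
    (h : (x, g) ∈ l) : sizeOf x < sizeOf l := by
  have := List.sizeOf_lt_of_mem h
  simp at this
  omega

end WireValue

variable [∀ s, Group (G s)]

namespace WireValue

/-- The values on the bottom side of a transistor with values `l` on its top side and word `r` on
its bottom side. -/
def outs (l : List (WireValue A G)) (r : List A) : List (WireValue A G) :=
  r.mapIdx fun j s => (WireName.out l r j, ⟨s, 1⟩)

@[simp] theorem length_outs (l : List (WireValue A G)) (r : List A) :
    (outs l r).length = r.length := List.length_mapIdx

@[simp] theorem word_outs (l : List (WireValue A G)) (r : List A) : word (outs l r) = r := by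
  apply List.ext_getElem? 
  intro i
  simp [word, outs, List.getElem?_mapIdx, Function.comp_def]

theorem getElem?_outs (l : List (WireValue A G)) (r : List A) (i : ℕ) :
    (outs l r)[i]? = r[i]?.map fun s => (WireName.out l r i, ⟨s, 1⟩) := by
  simp [outs, List.getElem?_mapIdx]

theorem mem_outs {l : List (WireValue A G)} {r : List A} {v : WireValue A G} :
    v ∈ outs l r ↔ ∃ i s, r[i]? = some s ∧ v = (WireName.out l r i, ⟨s, 1⟩) := by
  rw [List.mem_iff_getElem?]
  simp only [getElem?_outs, Option.map_eq_some_iff]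
  constructor
  · rintro ⟨i, s, hs, rfl⟩
    exact ⟨i, s, hs, rfl⟩
  · rintro ⟨i, s, hs, rfl⟩
    exact ⟨i, s, hs, rfl⟩

/-- The name of a single output already contains `l`; the condition on `r` provides an output. -/
theorem outs_injective {l m : List (WireValue A G)} {r r' : List A} (hr : r ≠ [])
    (h : outs l r = outs m r') : l = m ∧ r = r' := by
  have hw : r = r' := by rw [← word_outs l r, h, word_outs]
  subst hw
  obtain ⟨s, r, rfl⟩ := List.exists_cons_of_ne_nil hr
  have h0 : (outs l (s :: r))[0]? = (outs m (s :: r))[0]? := by rw [h]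
  simp only [getElem?_outs] at h0
  simpa using h0

/-- A transistor with values `l` on its top side and word `r` on its bottom side cancels with the
transistor above it. -/
def Cancels (l : List (WireValue A G)) (r : List A) : Prop :=
  ∃ m, l = outs m (word l) ∧ word m = r

open Classical in
/-- The values on the bottom side of a transistor, in terms of the values on its top side and the
word on its bottom side, after cancellation. -/
noncomputable def act (l : List (WireValue A G)) (r : List A) : List (WireValue A G) :=
  if h : Cancels l r then h.choose else outs l r

theorem act_of_not_cancels {l : List (WireValue A G)} {r : List A} (h : ¬ Cancels l r) :
    act l r = outs l r := dif_neg h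

theorem act_outs {m : List (WireValue A G)} {r : List A} (hr : r ≠ []) :
    act (outs m r) (word m) = m := by
  have h : Cancels (outs m r) (word m) := ⟨m, by simp⟩
  rw [act, dif_pos h]
  exact (outs_injective hr h.choose_spec.1).1.symm

@[simp] theorem word_act (l : List (WireValue A G)) (r : List A) : word (act l r) = r := by
  by_cases h : Cancels l r
  · rw [act, dif_pos h]
    exact h.choose_spec.2
  · rw [act_of_not_cancels h, word_outs]

end WireValue

open WireValue

/-- No transistor in the history of the wire cancels with the transistor above it. -/
inductive WireName.Normal : WireName A G → Prop
  | gen (i : ℕ) : Normal (.gen i)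
  | out (l : List (WireValue A G)) (r : List A) (j : ℕ) (h : ¬ Cancels l r)
    (hl : ∀ v ∈ l, Normal v.1) : Normal (.out l r j)

namespace WireValue

/-- In the cancelling case the new values belong to the history of the old ones, which is normal all
the way up. -/
theorem normal_act {l : List (WireValue A G)} {r : List A} (h0 : l ≠ [])
    (hl : ∀ v ∈ l, v.1.Normal) : ∀ v ∈ act l r, v.1.Normal := by
  by_cases h : Cancels l r
  · obtain ⟨m, hm, rfl⟩ := h
    have hr : word l ≠ [] := by simpa [word] using h0
    rw [hm, act_outs hr]
    intro v hv
    obtain ⟨s, r, hsr⟩ := List.exists_cons_of_ne_nil hr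
    have h1 : (WireName.out m (word l) 0).Normal := by
      refine hl (WireName.out m (word l) 0, ⟨s, 1⟩) ?_
      rw [hm, mem_outs]
      exact ⟨0, s, by simp [hsr], by simp⟩
    cases h1 with
    | out _ _ _ _ hm => exact hm v hv
  · rw [act_of_not_cancels h]
    intro v hv
    obtain ⟨i, s, -, rfl⟩ := mem_outs.1 hv
    exact .out _ _ _ h hl

/-- This identity makes evaluation blind to dipoles. If `l` cancels, it is `outs m (word l)` and the
first action goes back to `m`. Normality of the names in `l` says that the transistor from `m` to
`word l` does not cancel in turn, so the second action rebuilds `l`. -/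
theorem act_act {l : List (WireValue A G)} {r : List A} (h0 : l ≠ []) (hr : r ≠ [])
    (hl : ∀ v ∈ l, v.1.Normal) : act (act l r) (word l) = l := by
  by_cases h : Cancels l r
  · obtain ⟨m, hm, rfl⟩ := h
    have hw : word l ≠ [] := by simpa [word] using h0
    obtain ⟨s, r, hsr⟩ := List.exists_cons_of_ne_nil hw
    have h1 : (WireName.out m (word l) 0).Normal := by
      refine hl (WireName.out m (word l) 0, ⟨s, 1⟩) ?_
      rw [hm, mem_outs]
      exact ⟨0, s, by simp [hsr], by simp⟩
    have h2 : act l (word m) = m := by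
      rw [hm, act_outs hw]
    rw [h2]
    cases h1 with
    | out _ _ _ hc _ => rw [act_of_not_cancels hc, ← hm]
  · rw [act_of_not_cancels h, act_outs hr]

end WireValue

/-- The letter of `A` carried by a wire, for wires starting from the word `w`. -/
def WireName.sort (w : List A) : WireName A G → Option A
  | .gen i => w[i]?
  | .out _ r j => r[j]?

end Names

/-! ### Event structures and the Hamming geometry of their configurations -/

/-- Events with a causal dependency and a conflict relation. Events with the same key are mutually
exclusive alternatives. -/
structure EventStructure (E K : Type*) where
  key : E → K
  valid : E → Prop
  /-- `dep d e`: the event `e` requires the event `d` -/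
  dep : E → E → Prop
  conflict : E → E → Prop
  rank : E → ℕ
  rank_lt : ∀ d e, dep d e → rank d < rank e
  conflict_symm : ∀ d e, conflict d e → conflict e d
  conflict_of_key : ∀ d e, key d = key e → d ≠ e → conflict d e
  dep_of_key : ∀ d e e', key e = key e' → dep d e → dep d e'
  conflict_swap : ∀ e e' f, valid e → key e = key e' → conflict f e' →
    conflict f e ∨ f = e ∨ dep e f

namespace EventStructure

variable {E K : Type*} (S : EventStructure E K)

/-- A finite set of events closed under dependency and without conflict. -/
structure Configuration where
  carrier : Set E
  finite : carrier.Finite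
  valid : ∀ e ∈ carrier, S.valid e
  closed : ∀ e ∈ carrier, ∀ d, S.dep d e → d ∈ carrier
  consistent : ∀ e ∈ carrier, ∀ f ∈ carrier, ¬ S.conflict e f

namespace Configuration

variable {S}

theorem ext {C C' : S.Configuration} (h : C.carrier = C'.carrier) : C = C' := by
  cases C
  cases C'
  congr

/-- The events of a configuration with a given key. -/
def val (C : S.Configuration) (k : K) : Set E := {e | e ∈ C.carrier ∧ S.key e = k}

theorem val_eq_iff {C C' : S.Configuration} {k : K} :
    C.val k = C'.val k ↔ ∀ e, S.key e = k → (e ∈ C.carrier ↔ e ∈ C'.carrier) := by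
  constructor
  · intro h e he
    have : e ∈ C.val k ↔ e ∈ C'.val k := by rw [h]
    simpa [val, he] using this
  · intro h
    ext e
    simp only [val, Set.mem_ofPred_eq]
    exact and_congr_left (h e)

theorem eq_of_key (C : S.Configuration) {e f : E} (he : e ∈ C.carrier) (hf : f ∈ C.carrier)
    (h : S.key e = S.key f) : e = f := by
  by_contra hne
  exact C.consistent e he f hf (S.conflict_of_key e f h hne)

theorem val_eq_of_mem {C C' : S.Configuration} {e : E} (he : e ∈ C.carrier)
    (he' : e ∈ C'.carrier) : C.val (S.key e) = C'.val (S.key e) := by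
  rw [val_eq_iff]
  intro f hf
  constructor
  · intro h
    rwa [C.eq_of_key h he hf]
  · intro h
    rwa [C'.eq_of_key h he' hf]

theorem val_injective : Function.Injective (val : S.Configuration → K → Set E) := by
  intro C C' h
  refine ext (Set.ext fun e => ?_)
  exact val_eq_iff.1 (congrFun h (S.key e)) e rfl

/-- Replacing the events with key `k` by those of another configuration. -/
theorem exists_replace (C O : S.Configuration) (k : K)
    (hk : ∀ e ∈ C.carrier, S.key e = k → ∀ f ∈ C.carrier, ¬ S.dep e f)
    (hO : ∀ e' ∈ O.carrier, S.key e' = k →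
      (∀ d, S.dep d e' → d ∈ C.carrier ∧ S.key d ≠ k) ∧
        ∀ f ∈ C.carrier, S.key f ≠ k → ¬ S.conflict f e') :
    ∃ D : S.Configuration, D.val k = O.val k ∧ ∀ k', k' ≠ k → D.val k' = C.val k' := by
  refine ⟨⟨{e | e ∈ C.carrier ∧ S.key e ≠ k} ∪ O.val k, ?_, ?_, ?_, ?_⟩, ?_, ?_⟩
  · exact (C.finite.subset fun e he => he.1).union (O.finite.subset fun e he => he.1)
  · rintro e (⟨he, -⟩ | ⟨he, -⟩)
    · exact C.valid e he
    · exact O.valid e he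
  · rintro e (⟨he, hek⟩ | ⟨he, hek⟩) d hd
    · have hdC := C.closed e he d hd
      exact Or.inl ⟨hdC, fun hdk => hk d hdC hdk e he hd⟩
    · exact Or.inl ((hO e he hek).1 d hd)
  · rintro e (⟨he, hek⟩ | ⟨he, hek⟩) f (⟨hf, hfk⟩ | ⟨hf, hfk⟩)
    · exact C.consistent e he f hf
    · exact (hO f hf hfk).2 e he hek
    · exact fun h => (hO e he hek).2 f hf hfk (S.conflict_symm _ _ h)
    · exact O.consistent e he f hf
  · rw [val_eq_iff]
    rintro e rfl
    simp [val]
  · intro k' hk'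
    rw [val_eq_iff]
    rintro e rfl
    simp [val, hk']

/-- Take an event `e` of `a` outside `b` of maximal rank. An event of `a` requiring `e` would have
larger rank, hence lie in `b`, and closedness would put `e` in `b`. So `e` can be removed or
exchanged for the event of `b` with the same key: `dep_of_key` supplies its requirements and
`conflict_swap` excludes conflicts. -/
theorem exists_step_of_not_subset {a b : S.Configuration} (h : ¬ a.carrier ⊆ b.carrier) :
    ∃ k, a.val k ≠ b.val k ∧ ∃ c : S.Configuration, c.val k = b.val k ∧
      ∀ k', k' ≠ k → c.val k' = a.val k' := by
  obtain ⟨e, ⟨hea, heb⟩, hmax⟩ := Set.exists_max_image (a.carrier \ b.carrier) S.rank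
    (a.finite.subset Set.sdiff_subset) (Set.not_subset.1 h)
  have hlast : ∀ f ∈ a.carrier, ¬ S.dep e f := by
    intro f hf hef
    have := hmax f ⟨hf, fun hfb => heb (b.closed f hfb e hef)⟩
    have := S.rank_lt _ _ hef
    omega
  refine ⟨S.key e, fun he => heb ((val_eq_iff.1 he e rfl).1 hea),
    exists_replace a b (S.key e) ?_ ?_⟩
  · intro e' he' hk f hf
    rw [a.eq_of_key he' hea hk]
    exact hlast f hf
  · intro e' he' hk
    refine ⟨fun d hd => ?_, fun f hf hfk hc => ?_⟩
    · have hde := S.dep_of_key d e' e hk hd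
      have hda := a.closed e hea d hde
      refine ⟨hda, fun hk' => ?_⟩
      rw [a.eq_of_key hda hea hk'] at hde
      exact lt_irrefl _ (S.rank_lt _ _ hde)
    · rcases S.conflict_swap e e' f (a.valid e hea) hk.symm hc with h1 | rfl | h1
      · exact a.consistent f hf e hea h1
      · exact hfk rfl
      · exact hlast f hf h1

/-- Some event `e` with key `k` lies in `a` or in `b`, and none lies in both, so no common event
requires `e`. Away from `k` the two configurations coincide. Hence whatever `o` has at `k` finds its
requirements there, as `e` does, and meets no conflict. -/
theorem exists_swap {a b : S.Configuration} (o : S.Configuration) {k : K}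
    (hab : a.val k ≠ b.val k) (hab' : ∀ k', k' ≠ k → a.val k' = b.val k') :
    ∃ c : S.Configuration, c.val k = o.val k ∧ ∀ k', k' ≠ k → c.val k' = a.val k' := by
  have hiff : ∀ e, S.key e ≠ k → (e ∈ a.carrier ↔ e ∈ b.carrier) := fun e he =>
    val_eq_iff.1 (hab' _ he) e rfl
  have hnot : ∀ e, e ∈ a.carrier → e ∈ b.carrier → S.key e ≠ k := by
    rintro e hea heb rfl
    exact hab (val_eq_of_mem hea heb)
  have hdep : ∀ e, S.key e = k → (e ∈ a.carrier ∨ e ∈ b.carrier) →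
      ∀ f, f ∈ a.carrier → f ∈ b.carrier → ¬ S.dep e f := fun e hk he f hfa hfb hd =>
    hnot e (a.closed f hfa e hd) (b.closed f hfb e hd) hk
  have hne : ∃ e, S.key e = k ∧ (e ∈ a.carrier ∨ e ∈ b.carrier) := by
    by_contra hcon
    push Not at hcon
    exact hab (val_eq_iff.2 fun e he => by simp [(hcon e he).1, (hcon e he).2])
  obtain ⟨e, hek, he⟩ := hne
  refine exists_replace a o k (fun e' he' hk f hf hd => ?_) (fun e' he' hk => ?_)
  · by_cases hfk : S.key f = k
    · rw [a.eq_of_key he' hf (hk.trans hfk.symm)] at hd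
      exact lt_irrefl _ (S.rank_lt _ _ hd)
    · exact hdep e' hk (Or.inl he') f hf ((hiff f hfk).1 hf) hd
  · have hself : ∀ c : S.Configuration, e ∈ c.carrier → ∀ d, S.dep d e →
        d ∈ c.carrier ∧ S.key d ≠ k := by
      intro c hec d hd
      have hdc := c.closed e hec d hd
      refine ⟨hdc, fun hdk => ?_⟩
      rw [c.eq_of_key hdc hec (hdk.trans hek.symm)] at hd
      exact lt_irrefl _ (S.rank_lt _ _ hd)
    refine ⟨fun d hd => ?_, fun f hf hfk hc => ?_⟩
    · have hde := S.dep_of_key d e' e (hk.trans hek.symm) hd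
      rcases he with he | he
      · exact hself a he d hde
      · obtain ⟨h1, h2⟩ := hself b he d hde
        exact ⟨(hiff d h2).2 h1, h2⟩
    · have hfb := (hiff f hfk).1 hf
      rcases S.conflict_swap e e' f (he.elim (a.valid e) (b.valid e)) (hek.trans hk.symm) hc
        with h1 | rfl | h1
      · rcases he with he | he
        · exact a.consistent f hf e he h1
        · exact b.consistent f hfb e he h1
      · exact hfk hek
      · exact hdep e hek he f hf hfb h1

/-- Keep the events present in at least two of the three configurations. Any two such events lie
together in one of the three, so they do not conflict. -/
theorem exists_majority (a b o : S.Configuration) :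
    ∃ c : S.Configuration, ∀ k, (a.val k = b.val k → c.val k = a.val k) ∧
      (a.val k = o.val k → c.val k = a.val k) ∧ (b.val k = o.val k → c.val k = b.val k) := by
  refine ⟨⟨{e | (e ∈ a.carrier ∧ e ∈ b.carrier) ∨ (e ∈ a.carrier ∧ e ∈ o.carrier) ∨
    (e ∈ b.carrier ∧ e ∈ o.carrier)}, ?_, ?_, ?_, ?_⟩, ?_⟩
  · refine (a.finite.union b.finite).subset ?_
    rintro e (⟨h, -⟩ | ⟨h, -⟩ | ⟨h, -⟩)
    exacts [Or.inl h, Or.inl h, Or.inr h]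
  · rintro e (⟨h, -⟩ | ⟨h, -⟩ | ⟨h, -⟩)
    exacts [a.valid e h, a.valid e h, b.valid e h]
  · rintro e (⟨h, h'⟩ | ⟨h, h'⟩ | ⟨h, h'⟩) d hd
    · exact Or.inl ⟨a.closed e h d hd, b.closed e h' d hd⟩
    · exact Or.inr (Or.inl ⟨a.closed e h d hd, o.closed e h' d hd⟩)
    · exact Or.inr (Or.inr ⟨b.closed e h d hd, o.closed e h' d hd⟩)
  · have ha := a.consistent
    have hb := b.consistent
    have ho := o.consistent
    rintro e he f hf
    simp only [Set.mem_ofPred_eq] at he hf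
    grind
  · intro k
    refine ⟨fun h1 => ?_, fun h1 => ?_, fun h1 => ?_⟩
    all_goals
      rw [val_eq_iff] at h1 ⊢
      intro e he
      have := h1 e he
      simp only [Set.mem_ofPred_eq]
      tauto

end Configuration

open EventStructure.Configuration

/-- A graph whose vertices are the configurations, two of them adjacent when they differ at exactly
one key. -/
theorem isHammingModel {V : Type*} {X : SimpleGraph V} (c : V → S.Configuration)
    (hc : Function.Bijective c)
    (hadj : ∀ a b, X.Adj a b ↔ ∃ k, (c a).val k ≠ (c b).val k ∧
      ∀ k', k' ≠ k → (c a).val k' = (c b).val k') :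
    X.IsHammingModel fun a => (c a).val where
  injective := val_injective.comp hc.1
  finite a b := by
    refine (((c a).finite.union (c b).finite).image S.key).subset fun k hk => ?_
    by_contra hn
    refine hk (val_eq_iff.2 fun e he => ?_)
    have h1 : e ∉ (c a).carrier ∪ (c b).carrier := fun h => hn ⟨e, h, he⟩
    simp only [Set.mem_union, not_or] at h1
    simp [h1.1, h1.2]
  adj_iff := hadj
  step a b hab := by
    by_cases h : (c a).carrier ⊆ (c b).carrier
    · have h' : ¬ (c b).carrier ⊆ (c a).carrier := fun h' =>
        hab (hc.1 (Configuration.ext (h.antisymm h')))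
      obtain ⟨k, hk, d, hd⟩ := exists_step_of_not_subset h'
      obtain ⟨d, rfl⟩ := hc.2 d
      exact ⟨k, hk.symm, Or.inr ⟨d, hd⟩⟩
    · obtain ⟨k, hk, d, hd⟩ := exists_step_of_not_subset h
      obtain ⟨d, rfl⟩ := hc.2 d
      exact ⟨k, hk, Or.inl ⟨d, hd⟩⟩
  swap a b o k hk hk' := by
    obtain ⟨d, hd⟩ := exists_swap (c o) hk hk'
    obtain ⟨d, rfl⟩ := hc.2 d
    exact ⟨d, hd⟩
  majority a b o _ := by
    obtain ⟨d, hd⟩ := exists_majority (c a) (c b) (c o)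
    obtain ⟨d, rfl⟩ := hc.2 d
    exact ⟨d, hd⟩

/-- If distinct valid events have distinct keys, then a key takes at most two values. -/
theorem Configuration.val_two_values (hkey : ∀ e f, S.valid e → S.valid f → S.key e = S.key f →
    e = f) (a b o : S.Configuration) (k : K) :
    a.val k = b.val k ∨ a.val k = o.val k ∨ b.val k = o.val k := by
  by_cases h : ∃ e, S.valid e ∧ S.key e = k
  · obtain ⟨e, he, rfl⟩ := h
    have hval : ∀ c d : S.Configuration, (e ∈ c.carrier ↔ e ∈ d.carrier) →
        c.val (S.key e) = d.val (S.key e) := by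
      intro c d hcd
      rw [val_eq_iff]
      intro f hf
      constructor
      · intro hfc
        have hfe := hkey f e (c.valid f hfc) he hf
        rw [hfe] at hfc ⊢
        exact hcd.1 hfc
      · intro hfc
        have hfe := hkey f e (d.valid f hfc) he hf
        rw [hfe] at hfc ⊢
        exact hcd.2 hfc
    have h1 := hval a b
    have h2 := hval a o
    have h3 := hval b o
    tauto
  · push Not at h
    refine Or.inl (val_eq_iff.2 fun e he => ?_)
    constructor
    · exact fun hea => absurd he (h e (a.valid e hea))
    · exact fun hea => absurd he (h e (b.valid e hea))

end EventStructure

/-! ### The event structure of transistors and labels -/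

/-- The events of the history of a diagram: a transistor, or a nontrivial label on a wire. -/
inductive WireEvent (A : Type u) (G : A → Type v) : Type (max u v)
  | transistor (l : List (WireValue A G)) (r : List A)
  | label (v : WireValue A G)

namespace WireEvent

variable {A : Type u} {G : A → Type v}

/-- Transistors are their own key, and the key of a label is the name of the wire. -/
def key : WireEvent A G → (List (WireValue A G) × List A) ⊕ WireName A G
  | transistor l r => Sum.inl (l, r)
  | label v => Sum.inr v.1

/-- `dep d e`: the event `e` requires the event `d`. -/
def dep [∀ s, Group (G s)] : WireEvent A G → WireEvent A G → Prop
  | transistor l r, transistor l' _ => ∃ v ∈ l', ∃ j, v.1 = .out l r j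
  | label v, transistor l' _ => v ∈ l' ∧ v.2.2 ≠ 1
  | transistor l r, label v => ∃ j, v.1 = .out l r j
  | label _, label _ => False

/-- Two events are in conflict if they use the same wire in different ways. -/
def conflict : WireEvent A G → WireEvent A G → Prop
  | transistor l r, transistor l' r' => (l, r) ≠ (l', r') ∧ ∃ u ∈ l, ∃ u' ∈ l', u.1 = u'.1
  | label v, transistor l _ => ∃ u ∈ l, u.1 = v.1 ∧ u ≠ v
  | transistor l _, label v => ∃ u ∈ l, u.1 = v.1 ∧ u ≠ v
  | label u, label v => u.1 = v.1 ∧ u ≠ v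

/-- The height of an event in the dependency order. -/
noncomputable def rank : WireEvent A G → ℕ
  | transistor l _ => 2 * sizeOf l
  | label v => 2 * sizeOf v.1 + 1

end WireEvent

section Configurations

open WireEvent WireValue

variable {A : Type u} (P : SemigroupPresentation A) (G : A → Type v) [∀ s, Group (G s)]

/-- The event structure of the transistors and labels of reduced diagrams with top word `w`. -/
noncomputable def wireEvents (w : List A) :
    EventStructure (WireEvent A G) ((List (WireValue A G) × List A) ⊕ WireName A G) where
  key := WireEvent.key
  valid e := match e with
    | transistor l r => (P.rel (word l) r ∨ P.rel r (word l)) ∧ (l.map Prod.fst).Nodup ∧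
        ¬ Cancels l r ∧ ∀ v ∈ l, v.1.sort w = some v.2.1
    | label v => v.1.sort w = some v.2.1 ∧ v.2.2 ≠ 1
  dep := WireEvent.dep
  conflict := WireEvent.conflict
  rank := WireEvent.rank
  -- The factor 2 leaves an odd rank for each label, between the transistor that creates the wire
  -- and any transistor that uses it.
  rank_lt := by
    have key : ∀ (l l' : List (WireValue A G)) (r : List A) (x : WireName A G) (j : ℕ),
        x = .out l r j → sizeOf l < sizeOf x := by
      rintro l - r - j rfl
      simp
      omega
    rintro (⟨l, r⟩ | v) (⟨l', r'⟩ | v') h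
    · obtain ⟨v, hv, j, hj⟩ := h
      have h1 := sizeOf_lt_of_mem hv
      have h2 := key l l r v.1 j hj
      simp only [rank]
      omega
    · obtain ⟨j, hj⟩ := h
      have h2 := key l l r v'.1 j hj
      simp only [rank]
      omega
    · have h1 := sizeOf_lt_of_mem h.1
      simp only [rank]
      omega
    · exact h.elim
  conflict_symm := by
    rintro (⟨l, r⟩ | v) (⟨l', r'⟩ | v') h
    · obtain ⟨h, u, hu, u', hu', he⟩ := h
      exact ⟨h.symm, u', hu', u, hu, he.symm⟩
    · exact h
    · exact h
    · exact ⟨h.1.symm, h.2.symm⟩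
  conflict_of_key := by
    rintro (⟨l, r⟩ | v) (⟨l', r'⟩ | v') h hne
    · simp only [WireEvent.key, Sum.inl.injEq, Prod.mk.injEq] at h
      simp [h.1, h.2] at hne
    · simp [WireEvent.key] at h
    · simp [WireEvent.key] at h
    · exact ⟨Sum.inr_injective h, fun he => hne (by rw [he])⟩
  dep_of_key := by
    rintro d (⟨l, r⟩ | v) (⟨l', r'⟩ | v') h hd
    · simp only [WireEvent.key, Sum.inl.injEq, Prod.mk.injEq] at h
      rwa [← h.1, ← h.2]
    · simp [WireEvent.key] at h
    · simp [WireEvent.key] at h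
    · have : v.1 = v'.1 := Sum.inr_injective h
      cases d with
      | transistor l r =>
        obtain ⟨j, hj⟩ := hd
        exact ⟨j, this ▸ hj⟩
      | label u => exact hd
  -- The only interesting case replaces a label `v'` by another label `v` of the same wire. A
  -- transistor in conflict with `v'` uses this wire either with the label `v`, and then requires
  -- `v`, or with a different one, and then conflicts with `v`.
  conflict_swap := by
    rintro (⟨l, r⟩ | v) (⟨l', r'⟩ | v') f hv h hf
    · simp only [WireEvent.key, Sum.inl.injEq, Prod.mk.injEq] at h
      rw [h.1, h.2]
      exact Or.inl hf
    · simp [WireEvent.key] at h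
    · simp [WireEvent.key] at h
    · have hvv : v.1 = v'.1 := Sum.inr_injective h
      cases f with
      | transistor l r =>
        obtain ⟨u, hu, huv, -⟩ := hf
        by_cases he : u = v
        · exact Or.inr (Or.inr ⟨he ▸ hu, hv.2⟩)
        · exact Or.inl ⟨u, hu, huv.trans hvv.symm, he⟩
      | label u =>
        by_cases he : u = v
        · exact Or.inr (Or.inl (by rw [he]))
        · exact Or.inl ⟨hf.1.trans hvv.symm, he⟩

variable {P G} {w : List A}

/-! ### Live and free wires of a configuration -/

namespace WireConfig

open EventStructure

/-- The wire named `v.1` exists in the configuration and has label `v.2`. -/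
def Live (C : (wireEvents P G w).Configuration) (v : WireValue A G) : Prop :=
  v.1.sort w = some v.2.1 ∧ (∀ l r j, v.1 = .out l r j → transistor l r ∈ C.carrier) ∧
    (label v ∈ C.carrier ∨ (v.2.2 = 1 ∧ ∀ g, label (v.1, g) ∉ C.carrier))

/-- The wire named `v.1` exists in the configuration, has label `v.2`, and is not attached to the
top side of a transistor. -/
def Free (C : (wireEvents P G w).Configuration) (v : WireValue A G) : Prop :=
  Live C v ∧ ∀ l r, transistor l r ∈ C.carrier → ∀ u ∈ l, u.1 ≠ v.1

variable {C C' : (wireEvents P G w).Configuration}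

theorem live_of_label {v : WireValue A G} (h : label v ∈ C.carrier) : Live C v :=
  ⟨(C.valid _ h).1, fun l r j hj => C.closed _ h (transistor l r) ⟨j, hj⟩, Or.inl h⟩

theorem label_mem_iff {v : WireValue A G} : label v ∈ C.carrier ↔ Live C v ∧ v.2.2 ≠ 1 :=
  ⟨fun h => ⟨live_of_label h, (C.valid _ h).2⟩, fun h => h.1.2.2.resolve_right fun h' => h.2 h'.1⟩

/-- A trivial label is not an event. In that case a label event on the same wire is excluded because
it would conflict with the transistor. -/
theorem live_of_transistor {l : List (WireValue A G)} {r : List A}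
    (h : transistor l r ∈ C.carrier) {v : WireValue A G} (hv : v ∈ l) : Live C v := by
  refine ⟨(C.valid _ h).2.2.2 v hv, fun l' r' j hj => C.closed _ h (transistor l' r')
    ⟨v, hv, j, hj⟩, ?_⟩
  by_cases h1 : v.2.2 = 1
  · refine Or.inr ⟨h1, fun g hg => ?_⟩
    refine C.consistent _ h _ hg ⟨v, hv, rfl, fun he => ?_⟩
    exact (C.valid _ hg).2 (he ▸ h1)
  · exact Or.inl (C.closed _ h (label v) ⟨hv, h1⟩)

theorem live_unique {u v : WireValue A G} (hu : Live C u) (hv : Live C v) (h : u.1 = v.1) :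
    u = v := by
  obtain ⟨x, ⟨s, g⟩⟩ := u
  obtain ⟨y, ⟨t, k⟩⟩ := v
  obtain rfl : x = y := h
  have hst : s = t := Option.some_injective _ (hu.1.symm.trans hv.1)
  subst hst
  rcases hu.2.2 with h1 | ⟨h1, h1'⟩ <;> rcases hv.2.2 with h2 | ⟨h2, h2'⟩
  · by_contra hne
    exact C.consistent _ h1 _ h2 ⟨rfl, hne⟩
  · exact absurd h1 (h2' _)
  · exact absurd h2 (h1' _)
  · simp only at h1 h2
    rw [h1, h2]

theorem exists_live {x : WireName A G} {s : A} (hs : x.sort w = some s)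
    (hx : ∀ l r j, x = .out l r j → transistor l r ∈ C.carrier) : ∃ g, Live C (x, g) := by
  by_cases h : ∃ g, label (x, g) ∈ C.carrier
  · obtain ⟨g, hg⟩ := h
    exact ⟨g, live_of_label hg⟩
  · push Not at h
    exact ⟨⟨s, 1⟩, hs, hx, Or.inr ⟨rfl, h⟩⟩

theorem ne_nil_of_transistor {l : List (WireValue A G)} {r : List A}
    (h : transistor l r ∈ C.carrier) : l ≠ [] ∧ r ≠ [] := by
  have hl : word l ≠ [] ∧ r ≠ [] := by
    rcases (C.valid _ h).1 with h1 | h1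
    · exact ⟨P.ne_nil_left _ _ h1, P.ne_nil_right _ _ h1⟩
    · exact ⟨P.ne_nil_right _ _ h1, P.ne_nil_left _ _ h1⟩
  exact ⟨by rintro rfl; exact hl.1 rfl, hl.2⟩

theorem exists_live_out {l : List (WireValue A G)} {r : List A}
    (h : transistor l r ∈ C.carrier) : ∃ g, Live C (.out l r 0, g) := by
  obtain ⟨s, r', rfl⟩ := List.exists_cons_of_ne_nil (ne_nil_of_transistor h).2
  refine exists_live (s := s) (by simp [WireName.sort]) fun l' r'' j hj => ?_
  cases hj
  exact h

/-- A live wire which is not free enters a transistor of `C`, whose outputs are live. If an output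
is live in `C'`, then so is the transistor's input wire, because `C'` contains the transistor.
Descending in this way one ends at free wires. -/
theorem subset_of_free (h : ∀ v, Free C v → Live C' v) : C.carrier ⊆ C'.carrier := by
  -- Names grow from top to bottom and `N` bounds all ranks in `C`, so `N - sizeOf v.1` strictly
  -- decreases when passing to an output of a transistor using `v`.
  obtain ⟨N, hN⟩ := (C.finite.image WireEvent.rank).bddAbove
  have hlive : ∀ n, ∀ v, Live C v → N - sizeOf v.1 ≤ n → Live C' v := by
    intro n
    induction n using Nat.strong_induction_on with
    | _ n ih =>
      intro v hv hn
      by_cases hf : Free C v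
      · exact h v hf
      · have : ∃ l r, transistor l r ∈ C.carrier ∧ ∃ u ∈ l, u.1 = v.1 := by
          by_contra hcon
          push Not at hcon
          exact hf ⟨hv, hcon⟩
        obtain ⟨l, r, hlr, u, hu, huv⟩ := this
        obtain rfl := live_unique (live_of_transistor hlr hu) hv huv
        obtain ⟨g, hg⟩ := exists_live_out hlr
        have h1 : sizeOf u.1 < sizeOf l := sizeOf_lt_of_mem hu
        have h2 : sizeOf l < sizeOf (WireName.out l r 0) := by
          simp
          omega
        have h3 : 2 * sizeOf l ≤ N := hN ⟨_, hlr, rfl⟩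
        have := ih (N - sizeOf (WireName.out l r 0)) (by omega) _ hg le_rfl
        exact live_of_transistor (this.2.1 l r 0 rfl) hu
  rintro (⟨l, r⟩ | v) he
  · obtain ⟨g, hg⟩ := exists_live_out he
    exact (hlive _ _ hg le_rfl).2.1 l r 0 rfl
  · have h1 := label_mem_iff.1 he
    exact label_mem_iff.2 ⟨hlive _ _ h1.1 le_rfl, h1.2⟩

/-- The free wires form the bottom boundary of the configuration, and their names contain everything
above them. -/
theorem eq_of_free (h : ∀ v, Free C v ↔ Free C' v) : C = C' :=
  Configuration.ext ((subset_of_free fun v hv => ((h v).1 hv).1).antisymm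
    (subset_of_free fun v hv => ((h v).2 hv).1))

/-! ### Adding a transistor -/

theorem free_insert {l : List (WireValue A G)} {r : List A} (hn : transistor l r ∉ C.carrier)
    (hC : C'.carrier = insert (transistor l r) C.carrier) :
    (∀ v ∈ l, Free C v) ∧ (∀ v ∈ outs l r, ¬ Live C v) ∧
      ∀ v, Free C' v ↔ (Free C v ∧ v ∉ l) ∨ v ∈ outs l r := by
  have hmem : transistor l r ∈ C'.carrier := by simp [hC]
  have hlab : ∀ v, label v ∈ C'.carrier ↔ label v ∈ C.carrier := by simp [hC]
  have htr : ∀ l' r', transistor l' r' ∈ C'.carrier ↔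
      (l' = l ∧ r' = r) ∨ transistor l' r' ∈ C.carrier := by simp [hC]
  -- A transistor is not fed by its own output: the name of an output is larger than the list `l` it
  -- contains.
  have hirr : ∀ v ∈ l, ∀ j, v.1 ≠ .out l r j := by
    intro v hv j hj
    have h1 : sizeOf v.1 < sizeOf l := sizeOf_lt_of_mem hv
    rw [hj] at h1
    simp at h1
    omega
  have hlive : ∀ v, Live C v → Live C' v := fun v hv =>
    ⟨hv.1, fun l' r' j hj => (htr l' r').2 (Or.inr (hv.2.1 l' r' j hj)), by
      simpa only [hlab] using hv.2.2⟩
  have hlive' : ∀ v, Live C' v → (∀ j, v.1 ≠ .out l r j) → Live C v := by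
    refine fun v hv hne => ⟨hv.1, fun l' r' j hj => ?_, by simpa only [hlab] using hv.2.2⟩
    refine ((htr l' r').1 (hv.2.1 l' r' j hj)).resolve_left ?_
    rintro ⟨rfl, rfl⟩
    exact hne j hj
  have hfree : ∀ v ∈ l, Free C v := by
    refine fun v hv => ⟨hlive' v (live_of_transistor hmem hv) (hirr v hv),
      fun l' r' h' u hu huv => ?_⟩
    refine C'.consistent _ ((htr l' r').2 (Or.inr h')) _ hmem ⟨?_, u, hu, v, hv, huv⟩
    intro he
    simp only [Prod.mk.injEq] at he
    rw [he.1, he.2] at h'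
    exact hn h'
  have hout : ∀ v ∈ outs l r, ¬ Live C v := by
    intro v hv h
    obtain ⟨i, s, -, rfl⟩ := mem_outs.1 hv
    exact hn (h.2.1 l r i rfl)
  refine ⟨hfree, hout, fun v => ⟨fun hv => ?_, ?_⟩⟩
  · by_cases hj : ∃ j, v.1 = .out l r j
    · right
      obtain ⟨j, hj⟩ := hj
      obtain ⟨x, ⟨s, g⟩⟩ := v
      obtain rfl : x = _ := hj
      have hs := hv.1.1
      simp only [WireName.sort] at hs
      rcases hv.1.2.2 with h1 | h1
      · exact absurd (((C.closed _ ((hlab _).1 h1)) (transistor l r)) ⟨j, rfl⟩) hn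
      · obtain rfl : g = 1 := h1.1
        exact mem_outs.2 ⟨j, s, hs, rfl⟩
    · left
      push Not at hj
      refine ⟨⟨hlive' v hv.1 hj, fun l' r' h' => hv.2 l' r' ((htr l' r').2 (Or.inr h'))⟩,
        fun hvl => hv.2 l r hmem v hvl rfl⟩
  · rintro (⟨hv, hvl⟩ | hv)
    · refine ⟨hlive v hv.1, fun l' r' h' u hu huv => ?_⟩
      rcases (htr l' r').1 h' with ⟨rfl, rfl⟩ | h'
      · exact hvl (live_unique (hfree u hu).1 hv.1 huv ▸ hu)
      · exact hv.2 l' r' h' u hu huv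
    · obtain ⟨i, s, hs, rfl⟩ := mem_outs.1 hv
      refine ⟨⟨hs, fun l' r' j hj => ?_, Or.inr ⟨rfl, fun g hg => ?_⟩⟩,
        fun l' r' h' u hu huv => ?_⟩
      · cases hj
        exact hmem
      · exact hn (C.closed _ ((hlab _).1 hg) (transistor l r) ⟨i, rfl⟩)
      · rcases (htr l' r').1 h' with ⟨rfl, rfl⟩ | h'
        · exact hirr u hu i huv
        · exact hn (C.closed _ h' (transistor l r) ⟨u, hu, i, huv⟩)

/-- Freeness of the inputs rules out all conflicts: no transistor of `C` uses these wires, and a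
label event on one of them must agree with its live value. -/
theorem exists_insert {l : List (WireValue A G)} {r : List A}
    (hrel : P.rel (word l) r ∨ P.rel r (word l)) (hnd : l.Nodup) (hc : ¬ Cancels l r)
    (hl : ∀ v ∈ l, Free C v) :
    transistor l r ∉ C.carrier ∧ ∃ C' : (wireEvents P G w).Configuration,
      C'.carrier = insert (transistor l r) C.carrier := by
  have hl0 : l ≠ [] := by
    rintro rfl
    rcases hrel with h1 | h1
    · exact P.ne_nil_left _ _ h1 rfl
    · exact P.ne_nil_right _ _ h1 rfl
  have hcon : ∀ f ∈ C.carrier, ¬ WireEvent.conflict f (transistor l r) := by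
    rintro (⟨l', r'⟩ | v) hf h
    · obtain ⟨-, u', hu', u, hu, huu⟩ := h
      exact (hl u hu).2 l' r' hf u' hu' huu
    · obtain ⟨u, hu, huv, hne⟩ := h
      exact hne (live_unique (hl u hu).1 (live_of_label hf) huv)
  refine ⟨fun hmem => ?_, ⟨insert (transistor l r) C.carrier, C.finite.insert _, ?_, ?_, ?_⟩, rfl⟩
  · obtain ⟨v, l', rfl⟩ := List.exists_cons_of_ne_nil hl0
    exact (hl v (by simp)).2 _ _ hmem v (by simp) rfl
  · rintro e (rfl | he)
    · refine ⟨hrel, ?_, hc, fun v hv => (hl v hv).1.1⟩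
      exact hnd.map_on fun u hu v hv huv => live_unique (hl u hu).1 (hl v hv).1 huv
    · exact C.valid e he
  · rintro e (rfl | he) d hd
    · right
      cases d with
      | transistor l' r' =>
        obtain ⟨v, hv, j, hj⟩ := hd
        exact (hl v hv).1.2.1 l' r' j hj
      | label v => exact label_mem_iff.2 ⟨(hl v hd.1).1, hd.2⟩
    · exact Or.inr (C.closed e he d hd)
  · rintro e (rfl | he) f (rfl | hf)
    · exact fun h => h.1 rfl
    · exact fun h => hcon f hf ((wireEvents P G w).conflict_symm _ _ h)
    · exact hcon e he
    · exact C.consistent e he f hf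

/-- Nothing in `C` requires the transistor: a further transistor using an output contradicts
freeness, and a label event on an output contradicts its trivial label. -/
theorem exists_erase {l : List (WireValue A G)} {r : List A} (hr : r ≠ [])
    (hl : ∀ v ∈ outs l r, Free C v) :
    ∃ C' : (wireEvents P G w).Configuration, transistor l r ∉ C'.carrier ∧
      C.carrier = insert (transistor l r) C'.carrier := by
  have hfree : ∀ i s, r[i]? = some s → Free C (WireName.out l r i, ⟨s, 1⟩) := fun i s hs =>
    hl _ (mem_outs.2 ⟨i, s, hs, rfl⟩)
  have hmem : transistor l r ∈ C.carrier := by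
    obtain ⟨s, r, rfl⟩ := List.exists_cons_of_ne_nil hr
    exact (hfree 0 s (by simp)).1.2.1 _ _ _ rfl
  refine ⟨⟨C.carrier \ {transistor l r}, C.finite.subset Set.sdiff_subset,
    fun e he => C.valid e he.1, fun e he d hd => ⟨C.closed e he.1 d hd, ?_⟩,
    fun e he f hf => C.consistent e he.1 f hf.1⟩, by simp, ?_⟩
  · rintro rfl
    cases e with
    | transistor l' r' =>
      obtain ⟨v, hv, j, hj⟩ := hd
      have hs := (live_of_transistor he.1 hv).1
      rw [hj] at hs
      exact (hfree j _ hs).2 l' r' he.1 v hv hj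
    | label v =>
      obtain ⟨j, hj⟩ := hd
      have h1 := live_of_label he.1
      have hs := h1.1
      rw [hj] at hs
      have := live_unique (hfree j _ hs).1 h1 hj.symm
      refine (C.valid _ he.1).2 ?_
      rw [← this]
  · simp [Set.insert_eq_of_mem hmem]

/-! ### Changing the label of a wire -/

theorem free_relabel {x : WireName A G} {g h : Sigma G} (hx : Free C (x, g))
    (hx' : Live C' (x, h))
    (hC : ∀ k, k ≠ Sum.inr x → C.val k = C'.val k) (v : WireValue A G) :
    Free C' v ↔ (Free C v ∧ v ≠ (x, g)) ∨ v = (x, h) := by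
  have htr : ∀ l r, transistor l r ∈ C.carrier ↔ transistor l r ∈ C'.carrier := fun l r =>
    Configuration.val_eq_iff.1 (hC (Sum.inl (l, r)) (by simp)) _ rfl
  have hlab : ∀ y g, y ≠ x → (label (y, g) ∈ C.carrier ↔ label (y, g) ∈ C'.carrier) :=
    fun y g hy => Configuration.val_eq_iff.1 (hC (Sum.inr y) (by simpa using hy)) _ rfl
  obtain ⟨y, k⟩ := v
  by_cases hyx : y = x
  · subst hyx
    constructor
    · intro hv
      exact Or.inr (live_unique hv.1 hx' rfl)
    · rintro (⟨hv, hne⟩ | hv)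
      · exact absurd (live_unique hv.1 hx.1 rfl) hne
      · rw [hv]
        exact ⟨hx', fun l r hlr u hu => hx.2 l r ((htr l r).2 hlr) u hu⟩
  · simp [Free, Live, hyx, htr, hlab y _ hyx]

theorem exists_relabel {x : WireName A G} {s : A} {g : G s} (hx : Free C (x, ⟨s, g⟩)) (h : G s) :
    ∃ C' : (wireEvents P G w).Configuration, Live C' (x, ⟨s, h⟩) ∧
      ∀ k, k ≠ Sum.inr x → C.val k = C'.val k := by
  -- All label events on `x` are dropped, and a new one is put back only if `h` is nontrivial.
  set S : Set (WireEvent A G) := {e | e ∈ C.carrier ∧ e.key ≠ Sum.inr x} ∪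
    {e | e = label (x, ⟨s, h⟩) ∧ h ≠ 1} with hS
  have hcon : ∀ f ∈ C.carrier, f.key ≠ Sum.inr x → ¬ WireEvent.conflict f (label (x, ⟨s, h⟩)) := by
    rintro (⟨l, r⟩ | v) hf hk hc
    · obtain ⟨u, hu, hux, -⟩ := hc
      exact hx.2 l r hf u hu hux
    · exact hk (congrArg Sum.inr hc.1)
  have htr : ∀ l r, transistor l r ∈ C.carrier → transistor l r ∈ S := fun l r hlr =>
    Or.inl ⟨hlr, by simp [WireEvent.key]⟩
  refine ⟨⟨S, ?_, ?_, ?_, ?_⟩, ⟨hx.1.1, fun l r j hj => htr l r (hx.1.2.1 l r j hj), ?_⟩, ?_⟩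
  · exact (C.finite.subset fun e he => he.1).union
      ((Set.finite_singleton (label (x, ⟨s, h⟩))).subset fun e he => he.1)
  · rintro e (he | ⟨rfl, he⟩)
    · exact C.valid e he.1
    · exact ⟨hx.1.1, he⟩
  · rintro e (⟨he, hk⟩ | ⟨rfl, he⟩) d hd
    · have hdC := C.closed e he d hd
      refine Or.inl ⟨hdC, fun hdk => ?_⟩
      rcases d with ⟨l, r⟩ | v
      · simp [WireEvent.key] at hdk
      · rcases e with ⟨l, r⟩ | u
        · exact hx.2 l r he v hd.1 (Sum.inr_injective hdk)
        · exact hd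
    · rcases d with ⟨l, r⟩ | v
      · obtain ⟨j, hj⟩ := hd
        exact htr l r (hx.1.2.1 l r j hj)
      · exact hd.elim
  · rintro e (⟨he, hk⟩ | ⟨rfl, he⟩) f (⟨hf, hk'⟩ | ⟨rfl, hf⟩)
    · exact C.consistent e he f hf
    · exact hcon e he hk
    · exact fun hc => hcon f hf hk' ((wireEvents P G w).conflict_symm _ _ hc)
    · exact fun hc => hc.2 rfl
  · by_cases h1 : h = 1
    · refine Or.inr ⟨h1, ?_⟩
      rintro k (⟨-, hk⟩ | ⟨-, hk⟩)
      · exact hk rfl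
      · exact hk h1
    · exact Or.inl (Or.inr ⟨rfl, h1⟩)
  · intro k hk
    rw [Configuration.val_eq_iff]
    rintro e rfl
    constructor
    · exact fun he => Or.inl ⟨he, hk⟩
    · rintro (⟨he, -⟩ | ⟨rfl, -⟩)
      · exact he
      · exact absurd rfl hk

end WireConfig

end Configurations

/-! ### Attachments -/

/-- The elements of `S` are attached exactly once to the contacts `c : K`, and nothing else is. -/
structure IsAttachment {K W : Type*} (f : K → List W) (S : Set W) : Prop where
  nodup : ∀ c, (f c).Nodup
  mem_iff : ∀ x, x ∈ S ↔ ∃ c, x ∈ f c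
  eq_of_mem : ∀ c c' x, x ∈ f c → x ∈ f c' → c = c'

theorem isAttachment_univ_iff {K W : Type*} {f : K → List W} :
    IsAttachment f Set.univ ↔ ∀ x : W, ∃! p : K × ℕ, (f p.1)[p.2]? = some x := by
  constructor
  · intro h x
    obtain ⟨c, hc⟩ := (h.mem_iff x).1 trivial
    obtain ⟨i, hi⟩ := List.mem_iff_getElem?.1 hc
    refine ⟨(c, i), hi, ?_⟩
    rintro ⟨c', i'⟩ hi'
    obtain rfl := h.eq_of_mem c c' x hc (List.mem_of_getElem? hi')
    have hlt : i < (f c).length := (List.getElem?_eq_some_iff.1 hi).1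
    rw [(List.getElem?_inj hlt (h.nodup c)).1 (hi.trans hi'.symm)]
  · intro h
    refine ⟨fun c => ?_, fun x => ⟨fun _ => ?_, fun _ => trivial⟩, fun c c' x hc hc' => ?_⟩
    · rw [List.nodup_iff_getElem?_ne_getElem?]
      intro i j hij hj he
      have h1 := (h ((f c)[j])).unique (y₁ := (c, i)) (y₂ := (c, j))
        (by simp [he]) (by simp)
      simp only [Prod.mk.injEq] at h1
      omega
    · obtain ⟨p, hp, -⟩ := h x
      exact ⟨p.1, List.mem_of_getElem? hp⟩
    · obtain ⟨i, hi⟩ := List.mem_iff_getElem?.1 hc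
      obtain ⟨i', hi'⟩ := List.mem_iff_getElem?.1 hc'
      have h1 := (h x).unique (y₁ := (c, i)) (y₂ := (c', i')) hi hi'
      exact congrArg Prod.fst h1

namespace BraidedDiagram

variable {A : Type u} {Q : SemigroupPresentation A} (D : BraidedDiagram Q)

theorem below_attachment : IsAttachment D.wiresBelow Set.univ :=
  isAttachment_univ_iff.2 D.top_attached

theorem above_attachment : IsAttachment D.wiresAbove Set.univ :=
  isAttachment_univ_iff.2 D.bottom_attached

theorem exists_mem_below (x : D.Wire) : ∃ c, x ∈ D.wiresBelow c :=
  (D.below_attachment.mem_iff x).1 trivial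

theorem exists_mem_above (x : D.Wire) : ∃ c, x ∈ D.wiresAbove c :=
  (D.above_attachment.mem_iff x).1 trivial

variable {D} in
theorem below_unique {c c' : Option D.Transistor} {x : D.Wire} (h : x ∈ D.wiresBelow c)
    (h' : x ∈ D.wiresBelow c') : c = c' := D.below_attachment.eq_of_mem c c' x h h'

variable {D} in
theorem above_unique {c c' : Option D.Transistor} {x : D.Wire} (h : x ∈ D.wiresAbove c)
    (h' : x ∈ D.wiresAbove c') : c = c' := D.above_attachment.eq_of_mem c c' x h h'

theorem above_ne_nil (T : D.Transistor) : D.wiresAbove (some T) ≠ [] := by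
  intro h
  have h1 := D.transistor_rel T
  rw [h] at h1
  rcases h1 with h1 | h1
  · exact Q.ne_nil_left _ _ h1 rfl
  · exact Q.ne_nil_right _ _ h1 rfl

theorem below_ne_nil (T : D.Transistor) : D.wiresBelow (some T) ≠ [] := by
  intro h
  have h1 := D.transistor_rel T
  rw [h] at h1
  rcases h1 with h1 | h1
  · exact Q.ne_nil_right _ _ h1 rfl
  · exact Q.ne_nil_left _ _ h1 rfl

/-- A height function on transistors, decreasing from top to bottom. -/
theorem exists_height : ∃ ρ : D.Transistor → ℕ, ∀ T₁ T₂ x, x ∈ D.wiresAbove (some T₁) →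
    x ∈ D.wiresBelow (some T₂) → ρ T₁ < ρ T₂ := by
  have := D.finite_transistor
  -- The height of a transistor is the number of transistors strictly below it; acyclicity makes the
  -- inclusion of these sets strict along a wire.
  refine ⟨fun T => {S | Relation.TransGen (fun T₁ T₂ : D.Transistor =>
    ∃ x, x ∈ D.wiresAbove (some T₁) ∧ x ∈ D.wiresBelow (some T₂)) S T}.ncard,
    fun T₁ T₂ x h₁ h₂ => Set.ncard_lt_ncard ?_ (Set.toFinite _)⟩
  have h12 : Relation.TransGen (fun T₁ T₂ : D.Transistor =>
    ∃ x, x ∈ D.wiresAbove (some T₁) ∧ x ∈ D.wiresBelow (some T₂)) T₁ T₂ :=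
    Relation.TransGen.single ⟨x, h₁, h₂⟩
  refine ⟨fun S hS => Relation.TransGen.trans hS h12, fun hsub => ?_⟩
  exact D.acyclic T₁ (hsub h12)

theorem acyclic_of_height {T W : Type} {below above : Option T → List W} (ρ : T → ℕ)
    (h : ∀ T₁ T₂ x, x ∈ above (some T₁) → x ∈ below (some T₂) → ρ T₁ < ρ T₂) (t : T) :
    ¬ Relation.TransGen (fun T₁ T₂ : T => ∃ x, x ∈ above (some T₁) ∧ x ∈ below (some T₂)) t t := by
  have key : ∀ a b, Relation.TransGen
      (fun T₁ T₂ : T => ∃ x, x ∈ above (some T₁) ∧ x ∈ below (some T₂)) a b → ρ a < ρ b := by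
    intro a b hab
    induction hab with
    | single h1 =>
      obtain ⟨x, h1, h2⟩ := h1
      exact h _ _ x h1 h2
    | tail _ h1 ih =>
      obtain ⟨x, h1, h2⟩ := h1
      exact ih.trans (h _ _ x h1 h2)
  exact fun ht => lt_irrefl _ (key t t ht)

/-- A depth function on transistors, increasing from top to bottom. -/
theorem exists_depth : ∃ ρ : D.Transistor → ℕ, ∀ T₁ T₂ x, x ∈ D.wiresAbove (some T₁) →
    x ∈ D.wiresBelow (some T₂) → ρ T₂ < ρ T₁ := by
  have := D.finite_transistor
  obtain ⟨ρ, hρ⟩ := D.exists_height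
  obtain ⟨N, hN⟩ := (Set.finite_range ρ).bddAbove
  refine ⟨fun T => N - ρ T, fun T₁ T₂ x h₁ h₂ => ?_⟩
  have h1 := hρ T₁ T₂ x h₁ h₂
  have h2 : ρ T₂ ≤ N := hN ⟨T₂, rfl⟩
  simp only
  omega

/-- A depth function on wires, increasing from top to bottom. -/
theorem exists_wire_depth : ∃ d : D.Wire → ℕ, ∀ T x y, x ∈ D.wiresAbove (some T) →
    y ∈ D.wiresBelow (some T) → d x < d y := by
  obtain ⟨ρ, hρ⟩ := D.exists_depth
  choose c hc using D.exists_mem_below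
  -- Wires starting at the frame get depth 0; the shift by one keeps them strictly above the wires
  -- starting at transistors.
  refine ⟨fun x => (c x).elim 0 fun T => ρ T + 1, fun T x y hx hy => ?_⟩
  have hcy : c y = some T := below_unique (hc y) hy
  simp only [hcy, Option.elim_some]
  cases hcx : c x with
  | none => simp
  | some T' =>
    have h1 := hρ T T' x hx (hcx ▸ hc x)
    simpa using h1

end BraidedDiagram

/-! ### Gluing -/

section Gluing

variable {A : Type u} {P : SemigroupPresentation A} {G : A → Type v}

variable (P G) in
/-- A diagram with a hole: the bottom endpoints of the wires `upper` and the top endpoints of the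
wires `lower` are attached to the hole. Only the wires in `carrier` are used. -/
structure OpenDiagram where
  Wire : Type
  Transistor : Type
  finite_wire : Finite Wire
  finite_transistor : Finite Transistor
  label : Wire → Sigma G
  below : Option Transistor → List Wire
  above : Option Transistor → List Wire
  upper : List Wire
  lower : List Wire
  carrier : Set Wire
  below_attachment : IsAttachment (fun c : Option (Option Transistor) => c.elim lower below) carrier
  above_attachment : IsAttachment (fun c : Option (Option Transistor) => c.elim upper above) carrier
  transistor_rel : ∀ T : Transistor,
    (P.extend G).rel ((above (some T)).map label) ((below (some T)).map label) ∨
    (P.extend G).rel ((below (some T)).map label) ((above (some T)).map label)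
  word_eq : upper.map (fun x => (label x).1) = lower.map (fun x => (label x).1)
  -- The number `n` is a height for the hole: wires starting at the hole lead to transistors of
  -- smaller height, and wires ending there come from larger height. This keeps the glued diagram
  -- acyclic.
  exists_height : ∃ (ρ : Transistor → ℕ) (n : ℕ),
    (∀ T₁ T₂ x, x ∈ above (some T₁) → x ∈ below (some T₂) → ρ T₁ < ρ T₂) ∧
    (∀ T x, x ∈ above (some T) → x ∈ lower → ρ T < n) ∧
    ∀ T x, x ∈ upper → x ∈ below (some T) → n < ρ T
  not_mem_lower : ∀ x ∈ upper, x ∉ lower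

namespace OpenDiagram

variable (O : OpenDiagram P G)

theorem length_eq : O.upper.length = O.lower.length := by
  simpa using congrArg List.length O.word_eq

theorem upper_nodup : O.upper.Nodup := O.above_attachment.nodup none

theorem lower_nodup : O.lower.Nodup := O.below_attachment.nodup none

theorem below_nodup (c) : (O.below c).Nodup := O.below_attachment.nodup (some c)

theorem above_nodup (c) : (O.above c).Nodup := O.above_attachment.nodup (some c)

theorem mem_carrier_of_below {c x} (h : x ∈ O.below c) : x ∈ O.carrier :=
  (O.below_attachment.mem_iff x).2 ⟨some c, h⟩

theorem mem_carrier_of_above {c x} (h : x ∈ O.above c) : x ∈ O.carrier :=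
  (O.above_attachment.mem_iff x).2 ⟨some c, h⟩

theorem mem_carrier_of_upper {x} (h : x ∈ O.upper) : x ∈ O.carrier :=
  (O.above_attachment.mem_iff x).2 ⟨none, h⟩

theorem mem_carrier_of_lower {x} (h : x ∈ O.lower) : x ∈ O.carrier :=
  (O.below_attachment.mem_iff x).2 ⟨none, h⟩

theorem not_mem_lower_of_below {c x} (h : x ∈ O.below c) : x ∉ O.lower := fun h' => by
  simpa using O.below_attachment.eq_of_mem (some c) none x h h'

theorem not_mem_upper_of_above {c x} (h : x ∈ O.above c) : x ∉ O.upper := fun h' => by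
  simpa using O.above_attachment.eq_of_mem (some c) none x h h'

theorem exists_mem_below {x} (hx : x ∈ O.carrier) (h : x ∉ O.lower) : ∃ c, x ∈ O.below c := by
  obtain ⟨_ | c, hc⟩ := (O.below_attachment.mem_iff x).1 hx
  · exact absurd hc h
  · exact ⟨c, hc⟩

theorem exists_mem_above {x} (hx : x ∈ O.carrier) (h : x ∉ O.upper) : ∃ c, x ∈ O.above c := by
  obtain ⟨_ | c, hc⟩ := (O.above_attachment.mem_iff x).1 hx
  · exact absurd hc h
  · exact ⟨c, hc⟩

/-- The wire of the glued diagram that contains `x` is named by its uppermost part. -/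
theorem exists_repr (x : O.Wire) : ∃ y, (x ∉ O.lower ∧ y = x) ∨
    ∃ i : ℕ, O.lower[i]? = some x ∧ O.upper[i]? = some y := by
  by_cases hx : x ∈ O.lower
  · obtain ⟨i, hi⟩ := List.mem_iff_getElem?.1 hx
    have hlt := (List.getElem?_eq_some_iff.1 hi).1
    rw [← O.length_eq] at hlt
    exact ⟨O.upper[i], Or.inr ⟨i, hi, by simp⟩⟩
  · exact ⟨x, Or.inl ⟨hx, rfl⟩⟩

end OpenDiagram

variable [∀ s, Group (G s)]

namespace OpenDiagram

/-- `E` is obtained from `O` by gluing the bottom endpoints of the upper wires of the hole to the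
top endpoints of the lower wires. -/
def IsGluing (O : OpenDiagram P G) (E : PictureDiagram P G) : Prop :=
  ∃ (j : O.Wire → E.Wire) (t : O.Transistor ≃ E.Transistor),
    (∀ c, E.wiresBelow (c.map t) = (O.below c).map j) ∧
    (∀ c, E.wiresAbove (c.map t) = (O.above c).map j) ∧
    O.upper.map j = O.lower.map j ∧
    (∀ x ∈ O.carrier, x ∉ O.upper → x ∉ O.lower → E.label (j x) = O.label x) ∧
    ∀ p ∈ O.upper.zip O.lower,
      PictureDiagram.LabelMul (O.label p.1) (O.label p.2) (E.label (j p.1))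

end OpenDiagram

theorem PictureDiagram.LabelMul.fst_eq {a b c : Sigma G} (h : PictureDiagram.LabelMul a b c) :
    c.1 = a.1 ∧ c.1 = b.1 ∧ a.1 = b.1 := by
  obtain ⟨s, g, h, rfl, rfl, rfl⟩ := h
  exact ⟨rfl, rfl, rfl⟩

theorem PictureDiagram.exists_labelMul {a b : Sigma G} (h : a.1 = b.1) :
    ∃ c, PictureDiagram.LabelMul a b c := by
  obtain ⟨s, g⟩ := a
  obtain ⟨t, k⟩ := b
  obtain rfl : s = t := h
  exact ⟨_, s, g, k, rfl, rfl, rfl⟩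

theorem PictureDiagram.LabelMul.unique {a b c c' : Sigma G} (h : PictureDiagram.LabelMul a b c)
    (h' : PictureDiagram.LabelMul a b c') : c = c' := by
  obtain ⟨s, g, k, rfl, rfl, rfl⟩ := h
  obtain ⟨t, g', k', h1, h2, rfl⟩ := h'
  cases h1
  cases h2
  rfl

namespace OpenDiagram

variable (O : OpenDiagram P G)

/-- Each glued wire has exactly two pieces, since no wire runs from the hole to the hole. It is
represented by its upper piece, so the new wires are the elements of the carrier outside `lower`,
and `q` sends a lower wire to its partner. -/
theorem exists_gluing (hne : ∃ c, O.below c ≠ []) : ∃ E : PictureDiagram P G, O.IsGluing E := by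
  have := O.finite_wire
  obtain ⟨ρ, n, hρ, hρ₁, hρ₂⟩ := O.exists_height
  choose q hq using O.exists_repr
  have hq1 : ∀ x, x ∉ O.lower → q x = x := by
    intro x hx
    rcases hq x with h | ⟨i, h, -⟩
    · exact h.2
    · exact absurd (List.mem_of_getElem? h) hx
  have hq2 : ∀ x ∈ O.lower, ∃ i : ℕ, O.lower[i]? = some x ∧ O.upper[i]? = some (q x) :=
    fun x hx => (hq x).resolve_left fun h => h.1 hx
  have hq3 : ∀ i : ℕ, ∀ x y, O.lower[i]? = some x → O.upper[i]? = some y → q x = y := by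
    intro i x y hx hy
    obtain ⟨i', h1, h2⟩ := hq2 x (List.mem_of_getElem? hx)
    have hlt := (List.getElem?_eq_some_iff.1 hx).1
    obtain rfl := (List.getElem?_inj hlt O.lower_nodup).1 (hx.trans h1.symm)
    exact Option.some_injective _ (h2.symm.trans hy)
  have hqu : ∀ x ∈ O.lower, q x ∈ O.upper := fun x hx => by
    obtain ⟨i, -, h⟩ := hq2 x hx
    exact List.mem_of_getElem? h
  have hql : ∀ x, q x ∉ O.lower := by
    intro x
    by_cases hx : x ∈ O.lower
    · exact O.not_mem_lower _ (hqu x hx)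
    · rwa [hq1 x hx]
  have hqc : ∀ x ∈ O.carrier, q x ∈ O.carrier := by
    intro x hxc
    by_cases hx : x ∈ O.lower
    · exact O.mem_carrier_of_upper (hqu x hx)
    · rwa [hq1 x hx]
  have hlab : ∀ x, ∃ c : Sigma G, c.1 = (O.label x).1 ∧ (x ∉ O.upper → c = O.label x) ∧
      ∀ y, (x, y) ∈ O.upper.zip O.lower → PictureDiagram.LabelMul (O.label x) (O.label y) c := by
    intro x
    by_cases hx : x ∈ O.upper
    · obtain ⟨i, hi⟩ := List.mem_iff_getElem?.1 hx
      have hlt := (List.getElem?_eq_some_iff.1 hi).1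
      have hlt' := O.length_eq ▸ hlt
      have hw : (O.label x).1 = (O.label O.lower[i]).1 := by
        have h1 := congrArg (·[i]?) O.word_eq
        simpa [hi, hlt'] using h1
      obtain ⟨c, hc⟩ := PictureDiagram.exists_labelMul hw
      refine ⟨c, hc.fst_eq.1, fun h => absurd hx h, fun y hy => ?_⟩
      obtain ⟨i', hi'⟩ := List.mem_iff_getElem?.1 hy
      rw [List.getElem?_zip_eq_some] at hi'
      obtain rfl := (List.getElem?_inj hlt O.upper_nodup).1 (hi.trans hi'.1.symm)
      have : O.lower[i] = y := by
        have := hi'.2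
        rwa [List.getElem?_eq_getElem hlt', Option.some_inj] at this
      rwa [← this]
    · exact ⟨O.label x, rfl, fun _ => rfl, fun y hy => absurd (List.of_mem_zip hy).1 hx⟩
  choose lab hlab1 hlab2 hlab3 using hlab
  have hwq : ∀ x, (O.label (q x)).1 = (O.label x).1 := by
    intro x
    by_cases hx : x ∈ O.lower
    · obtain ⟨i, h1, h2⟩ := hq2 x hx
      have h3 := congrArg (·[i]?) O.word_eq
      simpa [h1, h2] using h3
    · rw [hq1 x hx]
  let W := {x // x ∈ O.carrier ∧ x ∉ O.lower}
  obtain ⟨c₀, hc₀⟩ := hne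
  obtain ⟨x₀, hx₀⟩ := List.exists_mem_of_ne_nil _ hc₀
  have hW : Nonempty W := ⟨⟨x₀, O.mem_carrier_of_below hx₀, O.not_mem_lower_of_below hx₀⟩⟩
  have hj : ∃ j : O.Wire → W, ∀ x ∈ O.carrier, (j x).1 = q x := by
    classical
    exact ⟨fun x => if h : x ∈ O.carrier then ⟨q x, hqc x h, hql x⟩ else hW.some,
      fun x hx => by simp [hx]⟩
  obtain ⟨j, hj⟩ := hj
  have hjlow : ∀ x ∈ O.carrier, x ∉ O.lower → (j x).1 = x := fun x hxc hx =>
    (hj x hxc).trans (hq1 x hx)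
  -- The gluing map `j` is injective on wires whose top endpoint is kept, and also on wires whose
  -- bottom endpoint is kept. These two facts make each endpoint of a new wire attached only once.
  have hinj1 : ∀ x ∈ O.carrier, ∀ y ∈ O.carrier, x ∉ O.lower → y ∉ O.lower → j x = j y →
      x = y := by
    intro x hxc y hyc hx hy h
    rw [← hjlow x hxc hx, h, hjlow y hyc hy]
  have hinj2 : ∀ x ∈ O.carrier, ∀ y ∈ O.carrier, x ∉ O.upper → y ∉ O.upper → j x = j y →
      x = y := by
    intro x hxc y hyc hx hy h
    have h' : q x = q y := by rw [← hj x hxc, h, hj y hyc]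
    by_cases hxl : x ∈ O.lower <;> by_cases hyl : y ∈ O.lower
    · obtain ⟨i, h1, h2⟩ := hq2 x hxl
      obtain ⟨i', h1', h2'⟩ := hq2 y hyl
      rw [h'] at h2
      have hlt := (List.getElem?_eq_some_iff.1 h2).1
      obtain rfl := (List.getElem?_inj hlt O.upper_nodup).1 (h2.trans h2'.symm)
      exact Option.some_injective _ (h1.symm.trans h1')
    · exact absurd (hq1 y hyl ▸ h' ▸ hqu x hxl) hy
    · exact absurd (hq1 x hxl ▸ h'.symm ▸ hqu y hyl) hx
    · rwa [hq1 x hxl, hq1 y hyl] at h'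
  have hbelow : IsAttachment (fun c => (O.below c).map j) Set.univ := by
    refine ⟨fun c => (O.below_nodup c).map_on fun x hx y hy => hinj1 x (O.mem_carrier_of_below hx)
      y (O.mem_carrier_of_below hy) (O.not_mem_lower_of_below hx) (O.not_mem_lower_of_below hy),
      fun y => ⟨fun _ => ?_, fun _ => trivial⟩, fun c c' y hc hc' => ?_⟩
    · obtain ⟨c, hc⟩ := O.exists_mem_below y.2.1 y.2.2
      exact ⟨c, List.mem_map.2 ⟨y.1, hc, Subtype.ext (hjlow y.1 y.2.1 y.2.2)⟩⟩
    · obtain ⟨x, hx, rfl⟩ := List.mem_map.1 hc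
      obtain ⟨x', hx', he⟩ := List.mem_map.1 hc'
      obtain rfl := hinj1 x' (O.mem_carrier_of_below hx') x (O.mem_carrier_of_below hx)
        (O.not_mem_lower_of_below hx') (O.not_mem_lower_of_below hx) he
      exact Option.some_injective _
        (O.below_attachment.eq_of_mem (some c) (some c') x' hx hx')
  have habove : IsAttachment (fun c => (O.above c).map j) Set.univ := by
    refine ⟨fun c => (O.above_nodup c).map_on fun x hx y hy => hinj2 x (O.mem_carrier_of_above hx)
      y (O.mem_carrier_of_above hy) (O.not_mem_upper_of_above hx) (O.not_mem_upper_of_above hy),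
      fun y => ⟨fun _ => ?_, fun _ => trivial⟩, fun c c' y hc hc' => ?_⟩
    · by_cases hy : y.1 ∈ O.upper
      · obtain ⟨i, hi⟩ := List.mem_iff_getElem?.1 hy
        have hlt := (List.getElem?_eq_some_iff.1 hi).1
        rw [O.length_eq] at hlt
        have hmem : O.lower[i] ∈ O.lower := List.getElem_mem hlt
        obtain ⟨c, hc⟩ := O.exists_mem_above (O.mem_carrier_of_lower hmem)
          fun h => O.not_mem_lower _ h hmem
        refine ⟨c, List.mem_map.2 ⟨_, hc, Subtype.ext ?_⟩⟩
        rw [hj _ (O.mem_carrier_of_lower hmem), hq3 i _ y.1 (by simp) hi]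
      · obtain ⟨c, hc⟩ := O.exists_mem_above y.2.1 hy
        exact ⟨c, List.mem_map.2 ⟨y.1, hc, Subtype.ext (hjlow y.1 y.2.1 y.2.2)⟩⟩
    · obtain ⟨x, hx, rfl⟩ := List.mem_map.1 hc
      obtain ⟨x', hx', he⟩ := List.mem_map.1 hc'
      obtain rfl := hinj2 x' (O.mem_carrier_of_above hx') x (O.mem_carrier_of_above hx)
        (O.not_mem_upper_of_above hx') (O.not_mem_upper_of_above hx) he
      exact Option.some_injective _
        (O.above_attachment.eq_of_mem (some c) (some c') x' hx hx')
  have hfst : ∀ x ∈ O.carrier, (lab (j x).1).1 = (O.label x).1 := by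
    intro x hx
    rw [hlab1, hj x hx, hwq]
  refine ⟨{
    Wire := W
    Transistor := O.Transistor
    finite_wire := inferInstance
    nonempty_wire := hW
    finite_transistor := O.finite_transistor
    label := fun y => lab y.1
    wiresBelow := fun c => (O.below c).map j
    wiresAbove := fun c => (O.above c).map j
    top_attached := isAttachment_univ_iff.1 hbelow
    bottom_attached := isAttachment_univ_iff.1 habove
    transistor_rel := fun T => ?_
    acyclic := BraidedDiagram.acyclic_of_height (below := fun c => (O.below c).map j)
      (above := fun c => (O.above c).map j) ρ fun T₁ T₂ y h₁ h₂ => ?_ },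
    j, Equiv.refl _, fun c => ?_, fun c => ?_, ?_, ?_, ?_⟩
  · have h1 : ∀ l : List O.Wire, (∀ x ∈ l, x ∈ O.carrier) →
        ((l.map j).map fun y : W => lab y.1).map Sigma.fst = (l.map O.label).map Sigma.fst := by
      intro l hl
      simp only [List.map_map]
      exact List.map_congr_left fun x hx => hfst x (hl x hx)
    have h2 := O.transistor_rel T
    simp only [SemigroupPresentation.extend] at h2 ⊢
    rwa [h1 _ fun x => O.mem_carrier_of_above, h1 _ fun x => O.mem_carrier_of_below]
  · obtain ⟨x, hx, rfl⟩ := List.mem_map.1 h₁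
    obtain ⟨x', hx', he⟩ := List.mem_map.1 h₂
    have hxl' := O.not_mem_lower_of_below hx'
    have h3 : x' = q x := by
      rw [← hjlow x' (O.mem_carrier_of_below hx') hxl', he, hj x (O.mem_carrier_of_above hx)]
    by_cases hxl : x ∈ O.lower
    · exact (hρ₁ T₁ x hx hxl).trans
        (hρ₂ T₂ x' (h3 ▸ hqu x hxl) hx')
    · rw [hq1 x hxl] at h3
      subst h3
      exact hρ T₁ T₂ x' hx hx'
  · cases c <;> rfl
  · cases c <;> rfl
  · refine List.ext_getElem (by simp [O.length_eq]) fun i h1 h2 => ?_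
    simp only [List.getElem_map]
    simp only [List.length_map] at h1 h2
    have hu : O.upper[i] ∈ O.upper := List.getElem_mem h1
    have hl : O.lower[i] ∈ O.lower := List.getElem_mem h2
    refine Subtype.ext ?_
    rw [hjlow _ (O.mem_carrier_of_upper hu) (O.not_mem_lower _ hu),
      hj _ (O.mem_carrier_of_lower hl), hq3 i _ O.upper[i] (by simp) (by simp)]
  · intro x hxc hxu hxl
    simp only
    rw [hjlow x hxc hxl, hlab2 x hxu]
  · rintro ⟨x, y⟩ hp
    have hxu := (List.of_mem_zip hp).1
    simp only
    rw [hjlow x (O.mem_carrier_of_upper hxu) (O.not_mem_lower _ hxu)]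
    exact hlab3 x y hp

end OpenDiagram

end Gluing

/-! ### Evaluation of diagrams -/

section Valuation

variable {A : Type u} {P : SemigroupPresentation A} {G : A → Type v} [∀ s, Group (G s)]

open WireValue PictureDiagram

theorem PictureDiagram.LabelMul.assoc {a b c p q r : Sigma G} (h₁ : LabelMul a b p)
    (h₂ : LabelMul p c q) (h₃ : LabelMul b c r) : LabelMul a r q := by
  obtain ⟨s, g, h, rfl, rfl, rfl⟩ := h₁
  obtain ⟨t, g', k, h4, rfl, rfl⟩ := h₂
  cases h4
  obtain ⟨t, g'', k', h4, h5, rfl⟩ := h₃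
  cases h4
  cases h5
  exact ⟨s, g, h * k, rfl, rfl, by rw [mul_assoc]⟩

namespace WireValue

/-- `v` is the value at the bottom of a wire labelled `c` with value `u` at its top. -/
def Along (u : WireValue A G) (c : Sigma G) (v : WireValue A G) : Prop :=
  v.1 = u.1 ∧ LabelMul u.2 c v.2

theorem Along.word_eq {u v : WireValue A G} {c : Sigma G} (h : Along u c v) :
    v.2.1 = c.1 ∧ u.2.1 = c.1 := ⟨h.2.fst_eq.2.1, h.2.fst_eq.2.2⟩

theorem Along.unique {u v v' : WireValue A G} {c : Sigma G} (h : Along u c v) (h' : Along u c v') :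
    v = v' := Prod.ext (h.1.trans h'.1.symm) (h.2.unique h'.2)

theorem Along.eq_of_trivial {u v : WireValue A G} {c : Sigma G} (h : Along u c v) (hc : c.2 = 1) :
    v = u := by
  obtain ⟨x, l⟩ := u
  obtain ⟨y, l'⟩ := v
  obtain ⟨h1, s, g, k, h2, h3, h4⟩ := h
  simp only at h1 h2 h3 h4
  subst h1 h2 h3 h4
  simp only at hc
  rw [hc, mul_one]

/-- The implication sits inside the existential so that choice yields a total function in the
recursion building a valuation. -/
theorem exists_along (u : WireValue A G) (c : Sigma G) : ∃ v, u.2.1 = c.1 → Along u c v := by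
  by_cases h : u.2.1 = c.1
  · obtain ⟨d, hd⟩ := exists_labelMul h
    exact ⟨(u.1, d), fun _ => ⟨rfl, hd⟩⟩
  · exact ⟨u, fun h' => absurd h' h⟩

end WireValue

namespace PictureDiagram

/-- The values `top x` and `bot x` at the top and at the bottom of the wires `x` are compatible with
the labels and the transistors. -/
structure IsValuation (D : PictureDiagram P G) (top bot : D.Wire → WireValue A G) : Prop where
  along : ∀ x, Along (top x) (D.label x) (bot x)
  act : ∀ T, (D.wiresBelow (some T)).map top =
    act ((D.wiresAbove (some T)).map bot) (D.word (D.wiresBelow (some T)))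

/-- Evaluating `D` with the values `s` on the top side of the frame gives the values `e` on the
bottom side. -/
def Evaluates (D : PictureDiagram P G) (s e : List (WireValue A G)) : Prop :=
  ∃ top bot, D.IsValuation top bot ∧ (D.wiresBelow none).map top = s ∧
    (D.wiresAbove none).map bot = e

variable {D : PictureDiagram P G} {top bot : D.Wire → WireValue A G}

theorem IsValuation.word_bot (h : D.IsValuation top bot) (l : List D.Wire) :
    WireValue.word (l.map bot) = D.word l := by
  simp only [WireValue.word, PictureDiagram.word, List.map_map]
  exact List.map_congr_left fun x _ => (h.along x).word_eq.1

theorem IsValuation.word_top (h : D.IsValuation top bot) (l : List D.Wire) :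
    WireValue.word (l.map top) = D.word l := by
  simp only [WireValue.word, PictureDiagram.word, List.map_map]
  exact List.map_congr_left fun x _ => (h.along x).word_eq.2

theorem Evaluates.word_eq {s e : List (WireValue A G)} (h : D.Evaluates s e) :
    WireValue.word s = D.topWord ∧ WireValue.word e = D.botWord := by
  obtain ⟨top, bot, h, rfl, rfl⟩ := h
  exact ⟨h.word_top _, h.word_bot _⟩

variable (D) in
theorem exists_valuation (s : List (WireValue A G)) (hs : WireValue.word s = D.topWord) :
    ∃ top bot, D.IsValuation top bot ∧ (D.wiresBelow none).map top = s := by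
  classical
  obtain ⟨d, hd⟩ := BraidedDiagram.exists_wire_depth D
  choose p hp using fun x => (D.top_attached x).exists
  choose mul hmul using WireValue.exists_along (A := A) (G := G)
  let outsOf : (D.Wire → WireValue A G) → Option D.Transistor → List (WireValue A G) := fun f c =>
    c.elim s fun T => WireValue.act
      ((D.wiresAbove (some T)).map fun y => mul (f y) (D.label y)) (D.word (D.wiresBelow (some T)))
  -- Values are defined by recursion on the depth of wires. Neither default is ever read: the wires
  -- on the top side of a transistor are less deep than those on its bottom side, and by `hword` the
  -- list of outputs has the length of the list of wires.
  let F : ∀ x : D.Wire, (∀ y, d y < d x → WireValue A G) → WireValue A G := fun x rec =>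
    (outsOf (fun y => if h : d y < d x then rec y h else (.gen 0, D.label y)) (p x).1)[(p x).2]?.getD
      (.gen 0, D.label x)
  let wf : WellFounded fun x y : D.Wire => d x < d y := InvImage.wf d wellFounded_lt
  let top : D.Wire → WireValue A G := wf.fix F
  have hword : ∀ f c, WireValue.word (outsOf f c) = D.word (D.wiresBelow c) := by
    rintro f (_ | T)
    · exact hs
    · exact word_act _ _
  have htop : ∀ x, top x = (outsOf top (p x).1)[(p x).2]?.getD (.gen 0, D.label x) := by
    intro x
    have h1 : top x = F x fun y _ => top y := wf.fix_eq F x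
    rw [h1]
    have hpx := hp x
    simp only [F]
    congr 2
    cases hc : (p x).1 with
    | none => rfl
    | some T =>
      rw [hc] at hpx
      simp only [outsOf, Option.elim_some]
      congr 1
      refine List.map_congr_left fun y hy => ?_
      rw [dif_pos (hd T y x hy (List.mem_of_getElem? hpx))]
  have htop' : ∀ c, (D.wiresBelow c).map top = outsOf top c := by
    intro c
    have hlen : (outsOf top c).length = (D.wiresBelow c).length := by
      have := congrArg List.length (hword top c)
      simpa [PictureDiagram.word] using this
    refine List.ext_getElem (by simp [hlen]) fun i h1 h2 => ?_
    simp only [List.length_map] at h1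
    rw [List.getElem_map, htop]
    have h3 := (D.top_attached (D.wiresBelow c)[i]).unique (hp _) (y₂ := (c, i)) (by simp)
    simp [h3, h2]
  have hsort : ∀ x, (top x).2.1 = (D.label x).1 := by
    intro x
    obtain ⟨c, hc⟩ := BraidedDiagram.exists_mem_below D x
    have h1 : ((D.wiresBelow c).map top).map (fun v => v.2.1) =
        (D.wiresBelow c).map fun x => (D.label x).1 := by
      rw [htop']
      exact hword top c
    rw [List.map_map, List.map_inj_left] at h1
    exact h1 x hc
  exact ⟨top, fun x => mul (top x) (D.label x), ⟨fun x => hmul _ _ (hsort x),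
    fun T => htop' (some T)⟩, htop' none⟩

theorem IsValuation.unique {top' bot' : D.Wire → WireValue A G} (h : D.IsValuation top bot)
    (h' : D.IsValuation top' bot')
    (hs : (D.wiresBelow none).map top = (D.wiresBelow none).map top') :
    top = top' ∧ bot = bot' := by
  obtain ⟨d, hd⟩ := BraidedDiagram.exists_wire_depth D
  have hbot : ∀ x, top x = top' x → bot x = bot' x := fun x hx =>
    (h.along x).unique (hx ▸ h'.along x)
  have htop : ∀ n, ∀ x, d x = n → top x = top' x := by
    intro n
    induction n using Nat.strong_induction_on with
    | _ n ih =>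
      rintro x rfl
      obtain ⟨_ | T, hc⟩ := BraidedDiagram.exists_mem_below D x
      · exact List.map_inj_left.1 hs x hc
      · have h1 : (D.wiresBelow (some T)).map top = (D.wiresBelow (some T)).map top' := by
          rw [h.act, h'.act]
          congr 1
          exact List.map_congr_left fun y hy => hbot y (ih (d y) (hd T y x hy hc) y rfl)
        exact List.map_inj_left.1 h1 x hc
  have htop : top = top' := funext fun x => htop _ x rfl
  exact ⟨htop, funext fun x => hbot x (congrFun htop x)⟩

theorem Evaluates.unique {s e e' : List (WireValue A G)} (h : D.Evaluates s e)
    (h' : D.Evaluates s e') : e = e' := by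
  obtain ⟨top, bot, h, hs, rfl⟩ := h
  obtain ⟨top', bot', h', hs', rfl⟩ := h'
  rw [(h.unique h' (hs.trans hs'.symm)).2]

theorem exists_evaluates (D : PictureDiagram P G) {s : List (WireValue A G)}
    (hs : WireValue.word s = D.topWord) : ∃ e, D.Evaluates s e := by
  obtain ⟨top, bot, h, rfl⟩ := D.exists_valuation s hs
  exact ⟨_, top, bot, h, rfl, rfl⟩

theorem IsValuation.normal (h : D.IsValuation top bot)
    (hs : ∀ x ∈ D.wiresBelow none, (top x).1.Normal) (x : D.Wire) : (top x).1.Normal := by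
  obtain ⟨d, hd⟩ := BraidedDiagram.exists_wire_depth D
  have key : ∀ n, ∀ x, d x = n → (top x).1.Normal := by
    intro n
    induction n using Nat.strong_induction_on with
    | _ n ih =>
      rintro x rfl
      obtain ⟨_ | T, hc⟩ := BraidedDiagram.exists_mem_below D x
      · exact hs x hc
      · have h1 := List.mem_map_of_mem (f := top) hc
        rw [h.act] at h1
        refine normal_act ?_ ?_ _ h1
        · simpa using BraidedDiagram.above_ne_nil D T
        · intro v hv
          obtain ⟨y, hy, rfl⟩ := List.mem_map.1 hv
          rw [(h.along y).1]
          exact ih (d y) (hd T y x hy hc) y rfl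
  exact key _ x rfl

end PictureDiagram

/-- The values at the ends of the wires of a diagram with a hole pass to the glued diagram. -/
theorem OpenDiagram.IsGluing.evaluates {O : OpenDiagram P G} {E : PictureDiagram P G}
    (h : O.IsGluing E) {top bot : O.Wire → WireValue A G}
    (along : ∀ x ∈ O.carrier, Along (top x) (O.label x) (bot x))
    (hact : ∀ T, (O.below (some T)).map top = act ((O.above (some T)).map bot)
      ((O.below (some T)).map fun x => (O.label x).1))
    (hole : O.upper.map bot = O.lower.map top) :
    E.Evaluates ((O.below none).map top) ((O.above none).map bot) := by
  obtain ⟨j, t, hb, ha, hul, hlab, hlab'⟩ := h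
  have htop : ∀ y, ∃ x c, x ∈ O.below c ∧ j x = y := by
    intro y
    obtain ⟨c, hc⟩ := BraidedDiagram.exists_mem_below E y
    obtain ⟨c, rfl⟩ : ∃ c', c'.map t = c := ⟨c.map t.symm, by simp⟩
    rw [hb] at hc
    obtain ⟨x, hx, rfl⟩ := List.mem_map.1 hc
    exact ⟨x, c, hx, rfl⟩
  have hbot : ∀ y, ∃ x c, x ∈ O.above c ∧ j x = y := by
    intro y
    obtain ⟨c, hc⟩ := BraidedDiagram.exists_mem_above E y
    obtain ⟨c, rfl⟩ : ∃ c', c'.map t = c := ⟨c.map t.symm, by simp⟩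
    rw [ha] at hc
    obtain ⟨x, hx, rfl⟩ := List.mem_map.1 hc
    exact ⟨x, c, hx, rfl⟩
  choose σ cσ hσ hjσ using htop
  choose τ cτ hτ hjτ using hbot
  have hσj : ∀ c, ∀ x ∈ O.below c, σ (j x) = x := by
    intro c x hx
    have h1 : j x ∈ E.wiresBelow (c.map t) := by
      rw [hb]
      exact List.mem_map_of_mem hx
    have h2 : j x ∈ E.wiresBelow ((cσ (j x)).map t) := by
      rw [hb]
      exact List.mem_map.2 ⟨_, hσ (j x), hjσ (j x)⟩
    have h3 := Option.map_injective t.injective (BraidedDiagram.below_unique h1 h2)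
    have hnd := E.below_attachment.nodup (c.map t)
    rw [hb] at hnd
    exact List.inj_on_of_nodup_map hnd (h3 ▸ hσ (j x)) hx (hjσ (j x))
  have hτj : ∀ c, ∀ x ∈ O.above c, τ (j x) = x := by
    intro c x hx
    have h1 : j x ∈ E.wiresAbove (c.map t) := by
      rw [ha]
      exact List.mem_map_of_mem hx
    have h2 : j x ∈ E.wiresAbove ((cτ (j x)).map t) := by
      rw [ha]
      exact List.mem_map.2 ⟨_, hτ (j x), hjτ (j x)⟩
    have h3 := Option.map_injective t.injective (BraidedDiagram.above_unique h1 h2)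
    have hnd := E.above_attachment.nodup (c.map t)
    rw [ha] at hnd
    exact List.inj_on_of_nodup_map hnd (h3 ▸ hτ (j x)) hx (hjτ (j x))
  have hmapb : ∀ c, (E.wiresBelow (c.map t)).map (top ∘ σ) = (O.below c).map top := by
    intro c
    rw [hb, List.map_map]
    exact List.map_congr_left fun x hx => by simp [hσj c x hx]
  have hmapa : ∀ c, (E.wiresAbove (c.map t)).map (bot ∘ τ) = (O.above c).map bot := by
    intro c
    rw [ha, List.map_map]
    exact List.map_congr_left fun x hx => by simp [hτj c x hx]
  have halong : ∀ y, Along (top (σ y)) (E.label y) (bot (τ y)) := by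
    intro y
    have hx := hσ y
    have hjx := hjσ y
    generalize σ y = x at hx hjx
    subst hjx
    have hxc := O.mem_carrier_of_below hx
    -- Here `x` is the uppermost piece of the wire. If it ends at the hole, the value continues
    -- along its partner `z`, and associativity combines the two labels.
    by_cases hxu : x ∈ O.upper
    · obtain ⟨i, hi⟩ := List.mem_iff_getElem?.1 hxu
      have hlt := (List.getElem?_eq_some_iff.1 hi).1
      rw [O.length_eq] at hlt
      obtain ⟨z, hz⟩ : ∃ z, O.lower[i]? = some z := ⟨_, List.getElem?_eq_getElem hlt⟩
      have hzl := List.mem_of_getElem? hz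
      have hzc := O.mem_carrier_of_lower hzl
      obtain ⟨c, hc⟩ := O.exists_mem_above hzc fun h => O.not_mem_lower _ h hzl
      have hjz : j x = j z := by
        have h1 := congrArg (·[i]?) hul
        simpa [hi, hz] using h1
      have hbz : bot x = top z := by
        have h1 := congrArg (·[i]?) hole
        simpa [hi, hz] using h1
      have hτx : τ (j x) = z := by rw [hjz, hτj c z hc]
      have h1 := along x hxc
      have h2 := along z hzc
      have h3 : LabelMul (O.label x) (O.label z) (E.label (j x)) := hlab' (x, z)
        (List.mem_iff_getElem?.2 ⟨i, List.getElem?_zip_eq_some.2 ⟨hi, hz⟩⟩)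
      rw [hτx]
      rw [← hbz] at h2
      exact ⟨h2.1.trans h1.1, h1.2.assoc h2.2 h3⟩
    · obtain ⟨c, hc⟩ := O.exists_mem_above hxc hxu
      rw [hτj c x hc, hlab x hxc hxu (O.not_mem_lower_of_below hx)]
      exact along x hxc
  refine ⟨top ∘ σ, bot ∘ τ, ⟨halong, fun T => ?_⟩, hmapb none, hmapa none⟩
  obtain ⟨T, rfl⟩ := t.surjective T
  have h1 := hmapb (some T)
  have h2 := hmapa (some T)
  simp only [Option.map_some] at h1 h2
  rw [h1, h2, hact]
  congr 1
  have h3 := congrArg WireValue.word h1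
  have h4 : WireValue.word ((E.wiresBelow (some (t T))).map (top ∘ σ)) =
      E.word (E.wiresBelow (some (t T))) := by
    simp only [WireValue.word, PictureDiagram.word, List.map_map]
    exact List.map_congr_left fun x _ => (halong x).word_eq.2
  rw [← h4, h3]
  simp only [WireValue.word, List.map_map]
  exact List.map_congr_left fun x hx =>
    ((along x (O.mem_carrier_of_below hx)).word_eq.2).symm

end Valuation

/-! ### Concatenation and dipole reduction as gluings -/

section Operations

variable {A : Type u} {P : SemigroupPresentation A} {G : A → Type v}

/-- Two disjoint attachments. -/
theorem IsAttachment.sum {K K₁ K₂ W₁ W₂ : Type*} {f₁ : K₁ → List W₁} {f₂ : K₂ → List W₂}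
    (h₁ : IsAttachment f₁ Set.univ) (h₂ : IsAttachment f₂ Set.univ) (e : K ≃ K₁ ⊕ K₂)
    {f : K → List (W₁ ⊕ W₂)}
    (hf : ∀ c, f c = Sum.elim (fun c => (f₁ c).map Sum.inl) (fun c => (f₂ c).map Sum.inr) (e c)) :
    IsAttachment f Set.univ := by
  refine ⟨fun c => ?_, fun x => ⟨fun _ => ?_, fun _ => trivial⟩, fun c c' x hc hc' => ?_⟩
  · rw [hf]
    rcases e c with c | c
    · exact (h₁.nodup c).map Sum.inl_injective
    · exact (h₂.nodup c).map Sum.inr_injective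
  · rcases x with x | x
    · obtain ⟨c, hc⟩ := (h₁.mem_iff x).1 trivial
      exact ⟨e.symm (Sum.inl c), by simpa [hf] using hc⟩
    · obtain ⟨c, hc⟩ := (h₂.mem_iff x).1 trivial
      exact ⟨e.symm (Sum.inr c), by simpa [hf] using hc⟩
  · rw [hf] at hc hc'
    apply e.injective
    generalize e c = a at *
    generalize e c' = a' at *
    rcases a with c | c <;> rcases a' with c' | c' <;> rcases x with x | x <;>
      simp at hc hc'
    · rw [h₁.eq_of_mem c c' x hc hc']
    · rw [h₂.eq_of_mem c c' x hc hc']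

/-- The contacts of the concatenation of two diagrams, when the bottom side of the frame of the
first and the top side of the frame of the second form a hole. -/
def lowerContacts (T₁ T₂ : Type) : Option (Option (T₁ ⊕ T₂)) ≃ Option T₁ ⊕ Option T₂ where
  toFun c := match c with
    | none => Sum.inr none
    | some none => Sum.inl none
    | some (some (Sum.inl T)) => Sum.inl (some T)
    | some (some (Sum.inr T)) => Sum.inr (some T)
  invFun c := match c with
    | Sum.inr none => none
    | Sum.inl none => some none
    | Sum.inl (some T) => some (some (Sum.inl T))
    | Sum.inr (some T) => some (some (Sum.inr T))
  left_inv c := by rcases c with _ | _ | T | T <;> rfl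
  right_inv c := by rcases c with (_ | T) | (_ | T) <;> rfl

/-- The contacts of the concatenation of two diagrams, when the bottom side of the frame of the
first and the top side of the frame of the second form a hole. -/
def upperContacts (T₁ T₂ : Type) : Option (Option (T₁ ⊕ T₂)) ≃ Option T₁ ⊕ Option T₂ where
  toFun c := match c with
    | none => Sum.inl none
    | some none => Sum.inr none
    | some (some (Sum.inl T)) => Sum.inl (some T)
    | some (some (Sum.inr T)) => Sum.inr (some T)
  invFun c := match c with
    | Sum.inl none => none
    | Sum.inr none => some none
    | Sum.inl (some T) => some (some (Sum.inl T))
    | Sum.inr (some T) => some (some (Sum.inr T))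
  left_inv c := by rcases c with _ | _ | T | T <;> rfl
  right_inv c := by rcases c with (_ | T) | (_ | T) <;> rfl

namespace OpenDiagram

/-- Two diagrams put below each other, before gluing. -/
noncomputable def concat (D₁ D₂ : PictureDiagram P G) (h : D₁.botWord = D₂.topWord) :
    OpenDiagram P G where
  Wire := D₁.Wire ⊕ D₂.Wire
  Transistor := D₁.Transistor ⊕ D₂.Transistor
  finite_wire := by
    have := D₁.finite_wire
    have := D₂.finite_wire
    infer_instance
  finite_transistor := by
    have := D₁.finite_transistor
    have := D₂.finite_transistor
    infer_instance
  label := Sum.elim D₁.label D₂.label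
  below c := match c with
    | none => (D₁.wiresBelow none).map Sum.inl
    | some (Sum.inl T) => (D₁.wiresBelow (some T)).map Sum.inl
    | some (Sum.inr T) => (D₂.wiresBelow (some T)).map Sum.inr
  above c := match c with
    | none => (D₂.wiresAbove none).map Sum.inr
    | some (Sum.inl T) => (D₁.wiresAbove (some T)).map Sum.inl
    | some (Sum.inr T) => (D₂.wiresAbove (some T)).map Sum.inr
  upper := (D₁.wiresAbove none).map Sum.inl
  lower := (D₂.wiresBelow none).map Sum.inr
  carrier := Set.univ
  below_attachment := D₁.below_attachment.sum D₂.below_attachment (lowerContacts _ _) fun c => by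
    rcases c with _ | _ | T | T <;> rfl
  above_attachment := D₁.above_attachment.sum D₂.above_attachment (upperContacts _ _) fun c => by
    rcases c with _ | _ | T | T <;> rfl
  transistor_rel := by
    rintro (T | T)
    · simpa [Function.comp_def] using D₁.transistor_rel T
    · simpa [Function.comp_def] using D₂.transistor_rel T
  word_eq := by
    simpa [Function.comp_def, PictureDiagram.botWord, PictureDiagram.topWord,
      PictureDiagram.word] using h
  exists_height := by
    have := D₂.finite_transistor
    obtain ⟨ρ₁, hρ₁⟩ := D₁.exists_height
    obtain ⟨ρ₂, hρ₂⟩ := D₂.exists_height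
    obtain ⟨N, hN⟩ := (Set.finite_range ρ₂).bddAbove
    have hN' : ∀ T, ρ₂ T ≤ N := fun T => hN ⟨T, rfl⟩
    -- The hole gets height `N + 1`, above all heights in `D₂`; those of `D₁` are shifted beyond it.
    refine ⟨Sum.elim (fun T => N + 2 + ρ₁ T) ρ₂, N + 1, ?_, ?_, ?_⟩
    · rintro (T₁ | T₁) (T₂ | T₂) x h₁ h₂ <;> obtain ⟨x, h₁, rfl⟩ := List.mem_map.1 h₁ <;>
        simp at h₂
      · simpa using hρ₁ T₁ T₂ x (by simpa using h₁) h₂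
      · simpa using hρ₂ T₁ T₂ x (by simpa using h₁) h₂
    · rintro (T | T) x h₁ h₂ <;> obtain ⟨x, h₁, rfl⟩ := List.mem_map.1 h₁ <;> simp at h₂
      have := hN' T
      simp only [Sum.elim_inr]
      omega
    · rintro (T | T) x h₁ h₂ <;> obtain ⟨x, h₁, rfl⟩ := List.mem_map.1 h₁ <;> simp at h₂
      simp only [Sum.elim_inl]
      omega
  not_mem_lower := by simp

/-- A diagram with a dipole `T₁`, `T₂`, with the dipole replaced by a hole. -/
noncomputable def dipole [∀ s, Group (G s)] (D : PictureDiagram P G) (T₁ T₂ : D.Transistor)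
    (h : D.IsDipole T₁ T₂) : OpenDiagram P G :=
  have hne : T₁ ≠ T₂ := by
    rintro rfl
    obtain ⟨x, hx⟩ := List.exists_mem_of_ne_nil _ (D.above_ne_nil T₁)
    exact D.acyclic T₁ (.single ⟨x, hx, h.1 ▸ hx⟩)
  { Wire := D.Wire
    Transistor := {T : D.Transistor // T ≠ T₁ ∧ T ≠ T₂}
    finite_wire := D.finite_wire
    finite_transistor := by
      have := D.finite_transistor
      infer_instance
    label := D.label
    below := fun c => D.wiresBelow (c.map Subtype.val)
    above := fun c => D.wiresAbove (c.map Subtype.val)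
    upper := D.wiresAbove (some T₂)
    lower := D.wiresBelow (some T₁)
    -- The wires between the two transistors of the dipole are discarded.
    carrier := {x | x ∉ D.wiresAbove (some T₁)}
    below_attachment := by
      refine ⟨?_, fun x => ?_, ?_⟩
      · rintro (_ | c)
        · exact D.below_attachment.nodup _
        · exact D.below_attachment.nodup _
      · rw [h.1]
        constructor
        · intro hx
          obtain ⟨c, hc⟩ := D.exists_mem_below x
          by_cases h1 : c = some T₁
          · exact ⟨none, h1 ▸ hc⟩
          · have h2 : c ≠ some T₂ := by
              rintro rfl
              exact hx hc
            rcases c with _ | T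
            · exact ⟨some none, hc⟩
            · exact ⟨some (some ⟨T, by simpa using h1, by simpa using h2⟩), hc⟩
        · rintro ⟨_ | _ | T, hc⟩ hx
          · exact hne (Option.some_injective _ (BraidedDiagram.below_unique hc hx))
          · exact absurd (BraidedDiagram.below_unique hc hx) (by simp)
          · exact T.2.2 (Option.some_injective _ (BraidedDiagram.below_unique hc hx))
      · rintro (_ | _ | T) (_ | _ | T') x hx hx' <;> have hu := BraidedDiagram.below_unique hx hx'
        · rfl
        · simp at hu
        · exact absurd (Option.some_injective _ hu).symm T'.2.1
        · simp at hu
        · rfl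
        · simp at hu
        · exact absurd (Option.some_injective _ hu) T.2.1
        · simp at hu
        · simpa [Subtype.ext_iff] using hu
    above_attachment := by
      refine ⟨?_, fun x => ?_, ?_⟩
      · rintro (_ | c)
        · exact D.above_attachment.nodup _
        · exact D.above_attachment.nodup _
      · constructor
        · intro hx
          obtain ⟨c, hc⟩ := D.exists_mem_above x
          by_cases h1 : c = some T₂
          · exact ⟨none, h1 ▸ hc⟩
          · have h2 : c ≠ some T₁ := by
              rintro rfl
              exact hx hc
            rcases c with _ | T
            · exact ⟨some none, hc⟩
            · exact ⟨some (some ⟨T, by simpa using h2, by simpa using h1⟩), hc⟩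
        · rintro ⟨_ | _ | T, hc⟩ hx
          · exact hne (Option.some_injective _ (BraidedDiagram.above_unique hx hc))
          · exact absurd (BraidedDiagram.above_unique hc hx) (by simp)
          · exact T.2.1 (Option.some_injective _ (BraidedDiagram.above_unique hc hx))
      · rintro (_ | _ | T) (_ | _ | T') x hx hx' <;> have hu := BraidedDiagram.above_unique hx hx'
        · rfl
        · simp at hu
        · exact absurd (Option.some_injective _ hu).symm T'.2.2
        · simp at hu
        · rfl
        · simp at hu
        · exact absurd (Option.some_injective _ hu) T.2.2
        · simp at hu
        · simpa [Subtype.ext_iff] using hu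
    transistor_rel := fun T => D.transistor_rel T.1
    word_eq := h.2.1
    exists_height := by
      obtain ⟨ρ, hρ⟩ := D.exists_height
      obtain ⟨x₀, hx₀⟩ := List.exists_mem_of_ne_nil _ (D.above_ne_nil T₁)
      have h12 : ρ T₁ < ρ T₂ := hρ T₁ T₂ x₀ hx₀ (h.1 ▸ hx₀)
      exact ⟨fun T => ρ T.1, ρ T₁, fun S₁ S₂ x => hρ S₁.1 S₂.1 x, fun S x => hρ S.1 T₁ x,
        fun S x h1 h2 => h12.trans (hρ T₂ S.1 x h1 h2)⟩
    -- A wire from the bottom side of `T₁` to the top side of `T₂` would close a cycle with the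
    -- wires of the dipole.
    not_mem_lower := by
      intro x h1 h2
      obtain ⟨y, hy⟩ := List.exists_mem_of_ne_nil _ (D.above_ne_nil T₁)
      exact D.acyclic T₁ (.tail (.single ⟨y, hy, h.1 ▸ hy⟩) ⟨x, h1, h2⟩) }

end OpenDiagram

/-- Going up through transistors strictly decreases the depth of wires, so the climb ends at the
frame. -/
theorem BraidedDiagram.below_none_ne_nil {Q : SemigroupPresentation A} (D : BraidedDiagram Q) :
    D.wiresBelow none ≠ [] := by
  intro h
  obtain ⟨d, hd⟩ := BraidedDiagram.exists_wire_depth D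
  have key : ∀ n, ∀ x : D.Wire, d x = n → False := by
    intro n
    induction n using Nat.strong_induction_on with
    | _ n ih =>
      rintro x rfl
      obtain ⟨_ | T, hc⟩ := BraidedDiagram.exists_mem_below D x
      · simp [h] at hc
      · obtain ⟨y, hy⟩ := List.exists_mem_of_ne_nil _ (D.above_ne_nil T)
        exact ih _ (hd T y x hy hc) y rfl
  obtain ⟨x⟩ := D.nonempty_wire
  exact key _ x rfl

theorem BraidedDiagram.above_none_ne_nil {Q : SemigroupPresentation A} (D : BraidedDiagram Q) :
    D.wiresAbove none ≠ [] := by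
  intro h
  obtain ⟨d, hd⟩ := BraidedDiagram.exists_wire_depth D
  have := D.finite_wire
  obtain ⟨N, hN⟩ := (Set.finite_range d).bddAbove
  have key : ∀ n, ∀ x : D.Wire, N - d x = n → False := by
    intro n
    induction n using Nat.strong_induction_on with
    | _ n ih =>
      rintro x rfl
      obtain ⟨_ | T, hc⟩ := BraidedDiagram.exists_mem_above D x
      · simp [h] at hc
      · obtain ⟨y, hy⟩ := List.exists_mem_of_ne_nil _ (D.below_ne_nil T)
        have h1 := hd T x y hc hy
        have h2 := hN ⟨y, rfl⟩
        exact ih _ (by omega) y rfl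
  obtain ⟨x⟩ := D.nonempty_wire
  exact key _ x rfl

variable [∀ s, Group (G s)]

namespace PictureDiagram

open OpenDiagram WireValue

/-- Viewing concatenation, and likewise dipole reduction, as a gluing through a hole allows
existence and evaluation to be proved once for both. -/
theorem isConcat_iff {D₁ D₂ D : PictureDiagram P G} :
    IsConcat D₁ D₂ D ↔ ∃ h : D₁.botWord = D₂.topWord, (OpenDiagram.concat D₁ D₂ h).IsGluing D := by
  constructor
  · rintro ⟨h, j₁, j₂, t, hb₁, ha₁, hb₂, ha₂, hb, ha, hg, hl₁, hl₂, hl⟩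
    have e₁ : ∀ l : List D₁.Wire, l.map j₁ = (l.map Sum.inl).map (Sum.elim j₁ j₂) := fun l => by
      simp
    have e₂ : ∀ l : List D₂.Wire, l.map j₂ = (l.map Sum.inr).map (Sum.elim j₁ j₂) := fun l => by
      simp
    refine ⟨h, Sum.elim j₁ j₂, t, ?_, ?_, (e₁ _).symm.trans (hg.trans (e₂ _)), ?_, ?_⟩
    · rintro (_ | T | T)
      exacts [hb.trans (e₁ _), (hb₁ T).trans (e₁ _), (hb₂ T).trans (e₂ _)]
    · rintro (_ | T | T)
      exacts [ha.trans (e₂ _), (ha₁ T).trans (e₁ _), (ha₂ T).trans (e₂ _)]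
    · rintro (x | x) - hu hlo
      · exact hl₁ x fun hx => hu (List.mem_map_of_mem hx)
      · exact hl₂ x fun hx => hlo (List.mem_map_of_mem hx)
    · intro p hp
      change p ∈ ((D₁.wiresAbove none).map Sum.inl).zip ((D₂.wiresBelow none).map Sum.inr) at hp
      rw [List.zip_map] at hp
      obtain ⟨q, hq, rfl⟩ := List.mem_map.1 hp
      exact hl q hq
  · rintro ⟨h, j, t, hb, ha, hg, hl, hl'⟩
    refine ⟨h, j ∘ Sum.inl, j ∘ Sum.inr, t, fun T => (hb (some (Sum.inl T))).trans List.map_map,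
      fun T => (ha (some (Sum.inl T))).trans List.map_map,
      fun T => (hb (some (Sum.inr T))).trans List.map_map,
      fun T => (ha (some (Sum.inr T))).trans List.map_map,
      (hb none).trans List.map_map, (ha none).trans List.map_map,
      List.map_map.symm.trans (hg.trans List.map_map), fun x hx => ?_, fun x hx => ?_,
      fun p hp => ?_⟩
    · refine hl (Sum.inl x) trivial (fun hx' => ?_) fun hx' => ?_ <;>
        obtain ⟨y, hy, he⟩ := List.mem_map.1 hx'
      · exact hx (Sum.inl_injective he ▸ hy)
      · exact Sum.inr_ne_inl he
    · refine hl (Sum.inr x) trivial (fun hx' => ?_) fun hx' => ?_ <;>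
        obtain ⟨y, hy, he⟩ := List.mem_map.1 hx'
      · exact Sum.inl_ne_inr he
      · exact hx (Sum.inr_injective he ▸ hy)
    · refine hl' (Sum.inl p.1, Sum.inr p.2) ?_
      change _ ∈ ((D₁.wiresAbove none).map Sum.inl).zip ((D₂.wiresBelow none).map Sum.inr)
      rw [List.zip_map]
      exact List.mem_map.2 ⟨p, hp, rfl⟩

theorem dipoleReduction_iff {D E : PictureDiagram P G} :
    DipoleReduction D E ↔ ∃ T₁ T₂, ∃ h : D.IsDipole T₁ T₂,
      (OpenDiagram.dipole D T₁ T₂ h).IsGluing E := by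
  constructor
  · rintro ⟨T₁, T₂, h, j, t, hb, ha, hb', ha', hg, hl, hl'⟩
    refine ⟨T₁, T₂, h, j, t.symm, ?_, ?_, hg, fun x h1 h2 h3 => hl x h1 h2 h3, hl'⟩
    · rintro (_ | T)
      · exact hb'
      · obtain ⟨T, rfl⟩ := t.surjective T
        exact (congrArg (fun S => E.wiresBelow (some S)) (t.symm_apply_apply T)).trans (hb T)
    · rintro (_ | T)
      · exact ha'
      · obtain ⟨T, rfl⟩ := t.surjective T
        exact (congrArg (fun S => E.wiresAbove (some S)) (t.symm_apply_apply T)).trans (ha T)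
  · rintro ⟨T₁, T₂, h, j, t, hb, ha, hg, hl, hl'⟩
    refine ⟨T₁, T₂, h, j, t.symm, fun T => ?_, fun T => ?_, hb none, ha none, hg,
      fun x h1 h2 h3 => hl x h1 h2 h3, hl'⟩
    · have := hb (some (t.symm T))
      rwa [Option.map_some, Equiv.apply_symm_apply] at this
    · have := ha (some (t.symm T))
      rwa [Option.map_some, Equiv.apply_symm_apply] at this

/-! ### Existence of concatenations and reductions -/

theorem exists_concat {D₁ D₂ : PictureDiagram P G} (h : D₁.botWord = D₂.topWord) :
    ∃ D, IsConcat D₁ D₂ D := by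
  obtain ⟨D, hD⟩ := (OpenDiagram.concat D₁ D₂ h).exists_gluing
    ⟨none, by simpa [OpenDiagram.concat] using D₁.below_none_ne_nil⟩
  exact ⟨D, isConcat_iff.2 ⟨h, hD⟩⟩

theorem IsDipole.exists_reduction {D : PictureDiagram P G} {T₁ T₂ : D.Transistor}
    (h : D.IsDipole T₁ T₂) : ∃ E, DipoleReduction D E ∧
      Nat.card E.Transistor < Nat.card D.Transistor := by
  obtain ⟨E, hE⟩ := (OpenDiagram.dipole D T₁ T₂ h).exists_gluing
    ⟨none, by simpa [OpenDiagram.dipole] using D.below_none_ne_nil⟩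
  refine ⟨E, dipoleReduction_iff.2 ⟨T₁, T₂, h, hE⟩, ?_⟩
  obtain ⟨j, t, -⟩ := hE
  have := D.finite_transistor
  rw [← Nat.card_congr t]
  exact Finite.card_subtype_lt (p := fun T => T ≠ T₁ ∧ T ≠ T₂) (x := T₁) (by simp)

theorem exists_reduction (D : PictureDiagram P G) : ∃ R, IsReductionOf R D := by
  have key : ∀ n, ∀ D : PictureDiagram P G, Nat.card D.Transistor = n →
      ∃ R, IsReductionOf R D := by
    intro n
    induction n using Nat.strong_induction_on with
    | _ n ih =>
      rintro D rfl
      by_cases h : D.IsReduced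
      · exact ⟨D, h, .refl⟩
      · simp only [IsReduced, not_forall, not_not] at h
        obtain ⟨T₁, T₂, h⟩ := h
        obtain ⟨E, hE, hlt⟩ := h.exists_reduction
        obtain ⟨R, hR, hER⟩ := ih _ hlt E rfl
        exact ⟨R, hR, .head (Or.inl hE) hER⟩
  exact key _ D rfl

theorem exists_product {D₁ D₂ : PictureDiagram P G} (h : D₁.botWord = D₂.topWord) :
    ∃ D, IsProduct D₁ D₂ D := by
  obtain ⟨C, hC⟩ := exists_concat h
  obtain ⟨R, hR⟩ := C.exists_reduction
  exact ⟨R, C, hC, hR⟩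

/-! ### Evaluation of concatenations and reductions -/

theorem IsConcat.evaluates {D₁ D₂ D : PictureDiagram P G} (h : IsConcat D₁ D₂ D)
    {s m e : List (WireValue A G)} (h₁ : D₁.Evaluates s m) (h₂ : D₂.Evaluates m e) :
    D.Evaluates s e := by
  obtain ⟨h, hD⟩ := isConcat_iff.1 h
  obtain ⟨top₁, bot₁, h₁, rfl, rfl⟩ := h₁
  obtain ⟨top₂, bot₂, h₂, hm, rfl⟩ := h₂
  have := hD.evaluates (top := Sum.elim top₁ top₂) (bot := Sum.elim bot₁ bot₂) ?_ ?_ ?_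
  · simpa [OpenDiagram.concat, Function.comp_def] using this
  · rintro (x | x) -
    · exact h₁.along x
    · exact h₂.along x
  · rintro (T | T)
    · simpa [OpenDiagram.concat, Function.comp_def, PictureDiagram.word] using h₁.act T
    · simpa [OpenDiagram.concat, Function.comp_def, PictureDiagram.word] using h₂.act T
  · simpa [OpenDiagram.concat, Function.comp_def] using hm.symm

theorem Evaluates.of_equivalent {D E : PictureDiagram P G} {s e : List (WireValue A G)}
    (h : D.Evaluates s e) (hE : BraidedDiagram.Equivalent D E) : E.Evaluates s e := by
  obtain ⟨j, t, hl, hb, ha⟩ := hE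
  obtain ⟨top, bot, h, rfl, rfl⟩ := h
  refine ⟨top ∘ j.symm, bot ∘ j.symm, ⟨fun x => ?_, fun T => ?_⟩, ?_, ?_⟩
  · have := h.along (j.symm x)
    rwa [← hl, Equiv.apply_symm_apply] at this
  · obtain ⟨T, rfl⟩ := t.surjective T
    have hb := hb (some T)
    have ha := ha (some T)
    simp only [Option.map_some] at hb ha
    rw [hb, ha]
    simpa [Function.comp_def, PictureDiagram.word, hl] using h.act T
  · have hb := hb none
    simp only [Option.map_none] at hb
    rw [hb]
    simp [Function.comp_def]
  · have ha := ha none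
    simp only [Option.map_none] at ha
    rw [ha]
    simp [Function.comp_def]

/-- Across a dipole the values undergo a transistor and then its inverse, with no label in between.
By `act_act` they return unchanged, which is the compatibility required at the hole; normality comes
from the top of the frame. -/
theorem Evaluates.of_dipoleReduction {D E : PictureDiagram P G} {s e : List (WireValue A G)}
    (hs : ∀ v ∈ s, v.1.Normal) (h : D.Evaluates s e) (hE : DipoleReduction D E) :
    E.Evaluates s e := by
  obtain ⟨T₁, T₂, hT, hE⟩ := dipoleReduction_iff.1 hE
  obtain ⟨top, bot, h, rfl, rfl⟩ := h
  refine hE.evaluates (top := top) (bot := bot) (fun x _ => h.along x) (fun T => h.act T.1) ?_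
  have hnorm := h.normal fun x hx => hs _ (List.mem_map_of_mem hx)
  have hmid : (D.wiresAbove (some T₁)).map bot = (D.wiresBelow (some T₂)).map top := by
    rw [← hT.1]
    exact List.map_congr_left fun x hx => (h.along x).eq_of_trivial (hT.2.2 x hx)
  change (D.wiresAbove (some T₂)).map bot = (D.wiresBelow (some T₁)).map top
  rw [h.act T₁, hmid, h.act T₂, ← hT.2.1, ← h.word_bot (D.wiresAbove (some T₂)), act_act]
  · simpa using D.above_ne_nil T₂
  · simpa [PictureDiagram.word] using D.below_ne_nil T₂
  · intro v hv
    obtain ⟨x, hx, rfl⟩ := List.mem_map.1 hv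
    rw [(h.along x).1]
    exact hnorm x

theorem Evaluates.of_reduction {D R : PictureDiagram P G} {s e : List (WireValue A G)}
    (hs : ∀ v ∈ s, v.1.Normal) (h : D.Evaluates s e) (hR : IsReductionOf R D) :
    R.Evaluates s e := by
  obtain ⟨-, hR⟩ := hR
  induction hR with
  | refl => exact h
  | tail _ hEF ih =>
    rcases hEF with hEF | hEF
    · exact ih.of_dipoleReduction hs hEF
    · exact ih.of_equivalent hEF

theorem IsProduct.evaluates {D₁ D₂ D : PictureDiagram P G} (h : IsProduct D₁ D₂ D)
    {s m e : List (WireValue A G)} (hs : ∀ v ∈ s, v.1.Normal) (h₁ : D₁.Evaluates s m)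
    (h₂ : D₂.Evaluates m e) : D.Evaluates s e := by
  obtain ⟨C, hC, hD⟩ := h
  exact (hC.evaluates h₁ h₂).of_reduction hs hD

end PictureDiagram

end Operations

/-! ### Reduced diagrams and their configurations -/

section Reduced

variable {A : Type u} {P : SemigroupPresentation A} {G : A → Type v} [∀ s, Group (G s)]

open WireValue PictureDiagram WireEvent

namespace WireValue

variable (G) in
/-- The values on the top side of the frame of a diagram with top word `w`. -/
def gens (w : List A) : List (WireValue A G) := w.mapIdx fun i s => (.gen i, ⟨s, 1⟩)

theorem getElem?_gens (w : List A) (i : ℕ) :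
    (gens G w)[i]? = w[i]?.map fun s => (.gen i, ⟨s, 1⟩) := by
  simp [gens, List.getElem?_mapIdx]

@[simp] theorem word_gens (w : List A) : word (gens G w) = w := by
  apply List.ext_getElem?
  intro i
  simp [word, gens, List.getElem?_mapIdx, Function.comp_def]

theorem normal_gens (w : List A) : ∀ v ∈ gens G w, v.1.Normal := by
  intro v hv
  obtain ⟨i, hi⟩ := List.mem_iff_getElem?.1 hv
  rw [getElem?_gens, Option.map_eq_some_iff] at hi
  obtain ⟨s, -, rfl⟩ := hi
  exact .gen i

theorem Along.eq_of_fst_trivial {x : WireName A G} {s : A} {c : Sigma G} {v : WireValue A G}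
    (h : Along (x, ⟨s, 1⟩) c v) : v = (x, c) := by
  obtain ⟨h1, t, g, k, h2, h3, h4⟩ := h
  cases h2
  refine Prod.ext h1 ?_
  rw [h4, h3, one_mul]

end WireValue

namespace PictureDiagram

/-- The values on the top side of a transistor. -/
def insOf {D : PictureDiagram P G} (bot : D.Wire → WireValue A G) (T : D.Transistor) :
    List (WireValue A G) := (D.wiresAbove (some T)).map bot

/-- The word on the bottom side of a transistor. -/
def outWord (D : PictureDiagram P G) (T : D.Transistor) : List A := D.word (D.wiresBelow (some T))

variable {D : PictureDiagram P G} {top bot : D.Wire → WireValue A G} {w : List A}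

theorem top_of_frame (hs : (D.wiresBelow none).map top = gens G w) {x : D.Wire} {i : ℕ}
    (hx : (D.wiresBelow none)[i]? = some x) :
    ∃ s, w[i]? = some s ∧ top x = (.gen i, ⟨s, 1⟩) := by
  have h1 := congrArg (·[i]?) hs
  simp only [List.getElem?_map, hx, getElem?_gens, Option.map_some] at h1
  obtain ⟨s, h2, h3⟩ := Option.map_eq_some_iff.1 h1.symm
  exact ⟨s, h2, h3.symm⟩

theorem IsValuation.top_of_transistor (h : D.IsValuation top bot) {T : D.Transistor}
    (hT : ¬ Cancels (insOf bot T) (D.outWord T)) {x : D.Wire} {i : ℕ}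
    (hx : (D.wiresBelow (some T))[i]? = some x) :
    ∃ s, (D.outWord T)[i]? = some s ∧ top x = (.out (insOf bot T) (D.outWord T) i, ⟨s, 1⟩) := by
  have h1 := congrArg (·[i]?) ((h.act T).trans (act_of_not_cancels hT))
  simp only [List.getElem?_map, hx, getElem?_outs, Option.map_some] at h1
  obtain ⟨s, h2, h3⟩ := Option.map_eq_some_iff.1 h1.symm
  exact ⟨s, h2, h3.symm⟩

/-- If no transistor in an upward closed set cancels, then the wires below this set have distinct
names. -/
theorem IsValuation.name_injOn (h : D.IsValuation top bot)
    (hs : (D.wiresBelow none).map top = gens G w) (p : D.Transistor → Prop)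
    (hp : ∀ S S' z, p S → z ∈ D.wiresAbove (some S) → z ∈ D.wiresBelow (some S') → p S')
    (hc : ∀ S, p S → ¬ Cancels (insOf bot S) (D.outWord S)) {x y : D.Wire}
    (hx : ∀ S, x ∈ D.wiresBelow (some S) → p S) (hy : ∀ S, y ∈ D.wiresBelow (some S) → p S)
    (hxy : (top x).1 = (top y).1) : x = y := by
  -- Equal names of two outputs give equal input lists, and the first inputs have equal, smaller
  -- names. By induction these inputs are one wire, so the two transistors coincide.
  have key : ∀ n, ∀ x y : D.Wire, sizeOf (top x).1 = n →
      (∀ S, x ∈ D.wiresBelow (some S) → p S) → (∀ S, y ∈ D.wiresBelow (some S) → p S) →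
      (top x).1 = (top y).1 → x = y := by
    intro n
    induction n using Nat.strong_induction_on with
    | _ n ih =>
      rintro x y rfl hx hy hxy
      obtain ⟨c, hcx⟩ := BraidedDiagram.exists_mem_below D x
      obtain ⟨c', hcy⟩ := BraidedDiagram.exists_mem_below D y
      obtain ⟨i, hi⟩ := List.mem_iff_getElem?.1 hcx
      obtain ⟨i', hi'⟩ := List.mem_iff_getElem?.1 hcy
      rcases c with _ | S <;> rcases c' with _ | S'
      · obtain ⟨s, -, h1⟩ := top_of_frame hs hi
        obtain ⟨s', -, h2⟩ := top_of_frame hs hi'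
        rw [h1, h2] at hxy
        cases hxy
        exact Option.some_injective _ (hi.symm.trans hi')
      · obtain ⟨s, -, h1⟩ := top_of_frame hs hi
        obtain ⟨s', -, h2⟩ := h.top_of_transistor (hc S' (hy S' hcy)) hi'
        rw [h1, h2] at hxy
        cases hxy
      · obtain ⟨s, -, h1⟩ := h.top_of_transistor (hc S (hx S hcx)) hi
        obtain ⟨s', -, h2⟩ := top_of_frame hs hi'
        rw [h1, h2] at hxy
        cases hxy
      · obtain ⟨s, -, h1⟩ := h.top_of_transistor (hc S (hx S hcx)) hi
        obtain ⟨s', -, h2⟩ := h.top_of_transistor (hc S' (hy S' hcy)) hi'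
        rw [h1, h2] at hxy
        simp only [WireName.out.injEq] at hxy
        obtain ⟨z, l, hz⟩ := List.exists_cons_of_ne_nil (D.above_ne_nil S)
        obtain ⟨z', l', hz'⟩ := List.exists_cons_of_ne_nil (D.above_ne_nil S')
        have hzS : z ∈ D.wiresAbove (some S) := by simp [hz]
        have hzS' : z' ∈ D.wiresAbove (some S') := by simp [hz']
        have hbz : bot z = bot z' := by
          have h3 := hxy.1
          simp only [insOf, hz, hz', List.map_cons, List.cons.injEq] at h3
          exact h3.1
        have htz : (top z).1 = (top z').1 := by
          rw [← (h.along z).1, ← (h.along z').1, hbz]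
        have hlt : sizeOf (top z).1 < sizeOf (top x).1 := by
          have h3 : (bot z).1 = (top z).1 := (h.along z).1
          have h4 : bot z ∈ insOf bot S := List.mem_map_of_mem hzS
          have h5 : sizeOf (bot z).1 < sizeOf (insOf bot S) := sizeOf_lt_of_mem h4
          rw [h1, ← h3]
          simp
          omega
        have hzz := ih _ hlt z z' rfl (fun S'' hS'' => hp S S'' z (hx S hcx) hzS hS'')
          (fun S'' hS'' => hp S' S'' z' (hy S' hcy) hzS' hS'') htz
        have hSS := BraidedDiagram.above_unique hzS (hzz ▸ hzS')
        rw [← hSS, ← hxy.2.2] at hi'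
        exact Option.some_injective _ (hi.symm.trans hi')
  exact key _ x y rfl hx hy hxy

/-- Induct from the top. If `T` cancels, the names on its top side are those of outputs of
transistors with inputs `m` and bottom word `r`. Above `T` names are already distinct, so all these
wires leave a single transistor `S`, in the right order and with trivial labels; then `T` and `S`
form a dipole. -/
theorem IsReduced.not_cancels (hD : D.IsReduced) (h : D.IsValuation top bot)
    (hs : (D.wiresBelow none).map top = gens G w) (T : D.Transistor) :
    ¬ Cancels (insOf bot T) (D.outWord T) := by
  obtain ⟨ρ, hρ⟩ := BraidedDiagram.exists_depth D
  have key : ∀ n, ∀ T, ρ T = n → ¬ Cancels (insOf bot T) (D.outWord T) := by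
    intro n
    induction n using Nat.strong_induction_on with
    | _ n ih =>
      rintro T rfl ⟨m, hm, hmw⟩
      have hinj := fun x y => h.name_injOn hs (fun S => ρ S < ρ T)
        (fun S S' z hS h1 h2 => (hρ S S' z h1 h2).trans hS) (fun S hS => ih _ hS S rfl)
        (x := x) (y := y)
      set r := WireValue.word (insOf bot T) with hr
      have habove : ∀ (i : ℕ) (y : D.Wire), (D.wiresAbove (some T))[i]? = some y → ∃ S, ρ S < ρ T ∧
          insOf bot S = m ∧ D.outWord S = r ∧ (D.wiresBelow (some S))[i]? = some y ∧
          D.TrivialLabel y := by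
        intro i y hy
        have h1 := congrArg (·[i]?) hm
        simp only [insOf, List.getElem?_map, hy, getElem?_outs, Option.map_some] at h1
        obtain ⟨s, h2, h3⟩ := Option.map_eq_some_iff.1 h1.symm
        have hty : (top y).1 = .out m r i := by
          rw [← (h.along y).1, ← h3]
        obtain ⟨_ | S, hc⟩ := BraidedDiagram.exists_mem_below D y
        · obtain ⟨i', hi'⟩ := List.mem_iff_getElem?.1 hc
          obtain ⟨s', -, h4⟩ := top_of_frame hs hi'
          rw [h4] at hty
          cases hty
        · obtain ⟨i', hi'⟩ := List.mem_iff_getElem?.1 hc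
          have hlt := hρ T S y (List.mem_of_getElem? hy) hc
          obtain ⟨s', -, h4⟩ := h.top_of_transistor (ih _ hlt S rfl) hi'
          rw [h4] at hty
          simp only [WireName.out.injEq] at hty
          refine ⟨S, hlt, hty.1, hty.2.1, hty.2.2 ▸ hi', ?_⟩
          have h5 := h.along y
          rw [h4] at h5
          have h6 := h5.eq_of_fst_trivial
          rw [← h3, Prod.mk.injEq] at h6
          rw [TrivialLabel, ← h6.2]
      obtain ⟨y₀, l₀, hy₀⟩ := List.exists_cons_of_ne_nil (D.above_ne_nil T)
      -- The candidate `S` comes from the first input of `T`; `hall` shows that the other inputs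
      -- leave the same transistor.
      obtain ⟨S, hST, hSm, hSr, hS0, -⟩ := habove 0 y₀ (by simp [hy₀])
      have hall : ∀ (i : ℕ) (y : D.Wire), (D.wiresAbove (some T))[i]? = some y →
          (D.wiresBelow (some S))[i]? = some y := by
        intro i y hy
        obtain ⟨S', hST', hSm', -, hi, -⟩ := habove i y hy
        obtain ⟨z, l, hz⟩ := List.exists_cons_of_ne_nil (D.above_ne_nil S)
        obtain ⟨z', l', hz'⟩ := List.exists_cons_of_ne_nil (D.above_ne_nil S')
        have hzS : z ∈ D.wiresAbove (some S) := by simp [hz]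
        have hzS' : z' ∈ D.wiresAbove (some S') := by simp [hz']
        have hbz : bot z = bot z' := by
          have h3 := hSm.trans hSm'.symm
          simp only [insOf, hz, hz', List.map_cons, List.cons.injEq] at h3
          exact h3.1
        have hzz := hinj z z' (fun S'' hS'' => (hρ S S'' z hzS hS'').trans hST)
          (fun S'' hS'' => (hρ S' S'' z' hzS' hS'').trans hST')
          (by rw [← (h.along z).1, ← (h.along z').1, hbz])
        have hSS := BraidedDiagram.above_unique hzS (hzz ▸ hzS')
        rwa [hSS]
      have hlen : (D.wiresAbove (some T)).length = (D.wiresBelow (some S)).length := by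
        have h1 := congrArg List.length hSr
        simpa [outWord, PictureDiagram.word, hr, insOf] using h1.symm
      refine hD T S ⟨?_, ?_, fun y hy => ?_⟩
      · refine List.ext_getElem hlen fun i h1 h2 => ?_
        have h3 := hall i _ (List.getElem?_eq_getElem h1)
        rw [List.getElem?_eq_getElem h2] at h3
        exact (Option.some_injective _ h3).symm
      · rw [← h.word_bot]
        change WireValue.word (insOf bot S) = _
        rw [hSm, hmw]
        rfl
      · obtain ⟨i, hi⟩ := List.mem_iff_getElem?.1 hy
        obtain ⟨_, _, _, _, _, h1⟩ := habove i y hi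
        exact h1
  exact key _ T rfl

/-- The data of a valuation of a diagram without cancelling transistors. -/
structure IsNaming (D : PictureDiagram P G) (w : List A) (top bot : D.Wire → WireValue A G) :
    Prop extends D.IsValuation top bot where
  frame : (D.wiresBelow none).map top = gens G w
  not_cancels : ∀ T, ¬ Cancels (insOf bot T) (D.outWord T)

namespace IsNaming

theorem injective (h : D.IsNaming w top bot) {x y : D.Wire} (hxy : (top x).1 = (top y).1) :
    x = y :=
  h.toIsValuation.name_injOn h.frame (fun _ => True) (fun _ _ _ _ _ _ => trivial)
    (fun S _ => h.not_cancels S) (fun _ _ => trivial) (fun _ _ => trivial) hxy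

theorem bot_injective (h : D.IsNaming w top bot) {x y : D.Wire} (hxy : (bot x).1 = (bot y).1) :
    x = y :=
  h.injective (by rw [← (h.along x).1, ← (h.along y).1, hxy])

/-- The name of a wire describes where its top endpoint is attached. -/
theorem top_cases (h : D.IsNaming w top bot) (x : D.Wire) :
    (∃ i s, w[i]? = some s ∧ (D.wiresBelow none)[i]? = some x ∧ top x = (.gen i, ⟨s, 1⟩)) ∨
    ∃ T i s, (D.outWord T)[i]? = some s ∧ (D.wiresBelow (some T))[i]? = some x ∧
      top x = (.out (insOf bot T) (D.outWord T) i, ⟨s, 1⟩) := by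
  obtain ⟨_ | T, hc⟩ := BraidedDiagram.exists_mem_below D x <;>
    obtain ⟨i, hi⟩ := List.mem_iff_getElem?.1 hc
  · obtain ⟨s, h1, h2⟩ := top_of_frame h.frame hi
    exact Or.inl ⟨i, s, h1, hi, h2⟩
  · obtain ⟨s, h1, h2⟩ := h.top_of_transistor (h.not_cancels T) hi
    exact Or.inr ⟨T, i, s, h1, hi, h2⟩

theorem bot_eq (h : D.IsNaming w top bot) (x : D.Wire) : bot x = ((top x).1, D.label x) := by
  have h1 := h.along x
  rcases h.top_cases x with ⟨i, s, -, -, h2⟩ | ⟨T, i, s, -, -, h2⟩ <;> rw [h2] at h1 ⊢ <;>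
    exact h1.eq_of_fst_trivial

theorem sort_bot (h : D.IsNaming w top bot) (x : D.Wire) :
    (bot x).1.sort w = some (bot x).2.1 := by
  rw [(h.along x).1, (h.along x).word_eq.1, ← (h.along x).word_eq.2]
  rcases h.top_cases x with ⟨i, s, h1, -, h2⟩ | ⟨T, i, s, h1, -, h2⟩ <;> rw [h2] <;> exact h1

theorem exists_of_out (h : D.IsNaming w top bot) {x : D.Wire} {l : List (WireValue A G)}
    {r : List A} {j : ℕ} (hx : (bot x).1 = .out l r j) :
    ∃ T, l = insOf bot T ∧ r = D.outWord T ∧ (D.wiresBelow (some T))[j]? = some x := by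
  rw [(h.along x).1] at hx
  rcases h.top_cases x with ⟨i, s, -, -, h2⟩ | ⟨T, i, s, h1, h3, h2⟩ <;> rw [h2] at hx
  · cases hx
  · simp only [WireName.out.injEq] at hx
    obtain ⟨rfl, rfl, rfl⟩ := hx
    exact ⟨T, rfl, rfl, h3⟩

theorem transistor_injective (h : D.IsNaming w top bot) {S T : D.Transistor}
    (hST : insOf bot S = insOf bot T) : S = T := by
  obtain ⟨z, l, hz⟩ := List.exists_cons_of_ne_nil (D.above_ne_nil S)
  obtain ⟨z', l', hz'⟩ := List.exists_cons_of_ne_nil (D.above_ne_nil T)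
  have hzS : z ∈ D.wiresAbove (some S) := by simp [hz]
  have hzT : z' ∈ D.wiresAbove (some T) := by simp [hz']
  have hbz : bot z = bot z' := by
    simp only [insOf, hz, hz', List.map_cons, List.cons.injEq] at hST
    exact hST.1
  have := h.bot_injective (congrArg Prod.fst hbz)
  exact Option.some_injective _ (BraidedDiagram.above_unique hzS (this ▸ hzT))

/-- The configuration of a reduced diagram. -/
theorem exists_configuration (h : D.IsNaming w top bot) :
    ∃ C : (wireEvents P G w).Configuration,
      (∀ l r, transistor l r ∈ C.carrier ↔ ∃ T, l = insOf bot T ∧ r = D.outWord T) ∧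
      ∀ v, WireConfig.Live C v ↔ ∃ x, bot x = v := by
  have := D.finite_wire
  have := D.finite_transistor
  set S : Set (WireEvent A G) := Set.range (fun T => transistor (insOf bot T) (D.outWord T)) ∪
    (fun x => label (bot x)) '' {x | (bot x).2.2 ≠ 1} with hS
  have htr : ∀ l r, transistor l r ∈ S ↔ ∃ T, l = insOf bot T ∧ r = D.outWord T := by
    intro l r
    constructor
    · rintro (⟨T, hT⟩ | ⟨x, -, hx⟩)
      · cases hT
        exact ⟨T, rfl, rfl⟩
      · cases hx
    · rintro ⟨T, rfl, rfl⟩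
      exact Or.inl ⟨T, rfl⟩
  have hlab : ∀ v, label v ∈ S ↔ ∃ x, bot x = v ∧ v.2.2 ≠ 1 := by
    intro v
    constructor
    · rintro (⟨T, hT⟩ | ⟨x, hx, hv⟩)
      · cases hT
      · cases hv
        exact ⟨x, rfl, hx⟩
    · rintro ⟨x, rfl, hx⟩
      exact Or.inr ⟨x, hx, rfl⟩
  have hconf : ∀ T x u, u ∈ insOf bot T → u.1 = (bot x).1 → u = bot x := by
    intro T x u hu hux
    obtain ⟨y, -, rfl⟩ := List.mem_map.1 hu
    rw [h.bot_injective hux]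
  let C : (wireEvents P G w).Configuration := ⟨S, ?_, ?_, ?_, ?_⟩
  · have hC : C.carrier = S := rfl
    have hlive : ∀ x, WireConfig.Live C (bot x) := by
      intro x
      refine ⟨h.sort_bot x, fun l r j hj => ?_, ?_⟩
      · obtain ⟨T, hl, hr, -⟩ := h.exists_of_out hj
        exact (htr l r).2 ⟨T, hl, hr⟩
      · rw [hC]
        by_cases h1 : (bot x).2.2 = 1
        · refine Or.inr ⟨h1, fun g hg => ?_⟩
          obtain ⟨y, hy, hg⟩ := (hlab _).1 hg
          have := h.bot_injective (x := y) (y := x) (by rw [hy])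
          rw [this] at hy
          rw [hy] at h1
          exact hg h1
        · exact Or.inl ((hlab _).2 ⟨x, rfl, h1⟩)
    refine ⟨C, htr, fun v => ⟨fun hv => ?_, ?_⟩⟩
    -- The name of a live wire gives a position on the top of the frame or on the bottom side of a
    -- transistor of `D`, and some wire is attached there.
    · have hx : ∃ x, (bot x).1 = v.1 := by
        have hsort := hv.1
        cases hn : v.1 with
        | gen i =>
          rw [hn] at hsort
          have h1 := congrArg (·[i]?) h.frame
          simp only [WireName.sort] at hsort
          simp only [List.getElem?_map, getElem?_gens, hsort, Option.map_some,
            Option.map_eq_some_iff] at h1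
          obtain ⟨x, -, hx⟩ := h1
          exact ⟨x, by rw [(h.along x).1, hx]⟩
        | out l r j =>
          rw [hn] at hsort
          obtain ⟨T, rfl, rfl⟩ := (htr l r).1 (hv.2.1 l r j hn)
          have h1 := congrArg (·[j]?) ((h.act T).trans (act_of_not_cancels (h.not_cancels T)))
          simp only [WireName.sort] at hsort
          simp only [List.getElem?_map, getElem?_outs] at h1
          change _ = Option.map _ (D.outWord T)[j]? at h1
          simp only [hsort, Option.map_some, Option.map_eq_some_iff] at h1
          obtain ⟨x, -, hx⟩ := h1
          exact ⟨x, by rw [(h.along x).1, hx]; rfl⟩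
      obtain ⟨x, hx⟩ := hx
      exact ⟨x, WireConfig.live_unique (hlive x) hv hx⟩
    · rintro ⟨x, rfl⟩
      exact hlive x
  · exact (Set.finite_range _).union ((Set.toFinite _).image _)
  · rintro (⟨l, r⟩ | v) he
    · obtain ⟨T, rfl, rfl⟩ := (htr l r).1 he
      refine ⟨?_, ?_, h.not_cancels T, fun v hv => ?_⟩
      · have h1 := D.transistor_rel T
        simp only [SemigroupPresentation.extend, List.map_map] at h1
        rw [insOf, h.word_bot]
        exact h1
      · rw [insOf, List.map_map]
        exact (D.above_attachment.nodup (some T)).map_on fun x _ y _ hxy => h.bot_injective hxy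
      · obtain ⟨y, -, rfl⟩ := List.mem_map.1 hv
        exact h.sort_bot y
    · obtain ⟨x, rfl, hx⟩ := (hlab v).1 he
      exact ⟨h.sort_bot x, hx⟩
  · have hout : ∀ x l r j, (bot x).1 = .out l r j → transistor l r ∈ S := by
      intro x l r j hj
      obtain ⟨T, hl, hr, -⟩ := h.exists_of_out hj
      exact (htr l r).2 ⟨T, hl, hr⟩
    rintro (⟨l, r⟩ | v) he (⟨l', r'⟩ | v') hd
    · obtain ⟨T, rfl, rfl⟩ := (htr l r).1 he
      obtain ⟨v, hv, j, hj⟩ := hd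
      obtain ⟨y, -, rfl⟩ := List.mem_map.1 hv
      exact hout y l' r' j hj
    · obtain ⟨T, rfl, rfl⟩ := (htr l r).1 he
      obtain ⟨hv, hv'⟩ := hd
      obtain ⟨y, -, rfl⟩ := List.mem_map.1 hv
      exact (hlab _).2 ⟨y, rfl, hv'⟩
    · obtain ⟨x, rfl, hx⟩ := (hlab v).1 he
      obtain ⟨j, hj⟩ := hd
      exact hout x l' r' j hj
    · exact hd.elim
  · rintro (⟨l, r⟩ | v) he (⟨l', r'⟩ | v') hf hc
    · obtain ⟨T, rfl, rfl⟩ := (htr l r).1 he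
      obtain ⟨T', rfl, rfl⟩ := (htr l' r').1 hf
      obtain ⟨hne, u, hu, u', hu', huu⟩ := hc
      obtain ⟨y, hy, rfl⟩ := List.mem_map.1 hu
      obtain ⟨y', hy', rfl⟩ := List.mem_map.1 hu'
      have := h.bot_injective huu
      have hTT := Option.some_injective _ (BraidedDiagram.above_unique hy (this ▸ hy'))
      exact hne (by rw [hTT])
    · obtain ⟨T, rfl, rfl⟩ := (htr l r).1 he
      obtain ⟨x, rfl, hx⟩ := (hlab v').1 hf
      obtain ⟨u, hu, hux, hne⟩ := hc
      exact hne (hconf T x u hu hux)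
    · obtain ⟨T, rfl, rfl⟩ := (htr l' r').1 hf
      obtain ⟨x, rfl, hx⟩ := (hlab v).1 he
      obtain ⟨u, hu, hux, hne⟩ := hc
      exact hne (hconf T x u hu hux)
    · obtain ⟨x, rfl, hx⟩ := (hlab v).1 he
      obtain ⟨x', rfl, hx'⟩ := (hlab v').1 hf
      exact hc.2 (by rw [h.bot_injective hc.1])

/-- The configuration of a reduced diagram, with its free wires. -/
theorem exists_configuration_free (h : D.IsNaming w top bot) :
    ∃ C : (wireEvents P G w).Configuration,
      (∀ l r, transistor l r ∈ C.carrier ↔ ∃ T, l = insOf bot T ∧ r = D.outWord T) ∧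
      (∀ v, WireConfig.Live C v ↔ ∃ x, bot x = v) ∧
      ∀ v, WireConfig.Free C v ↔ v ∈ (D.wiresAbove none).map bot := by
  obtain ⟨C, htr, hlive⟩ := h.exists_configuration
  refine ⟨C, htr, hlive, fun v => ?_⟩
  rw [WireConfig.Free, hlive, List.mem_map]
  constructor
  · rintro ⟨⟨x, rfl⟩, hx⟩
    obtain ⟨_ | T, hc⟩ := BraidedDiagram.exists_mem_above D x
    · exact ⟨x, hc, rfl⟩
    · exact absurd rfl (hx _ _ ((htr _ _).2 ⟨T, rfl, rfl⟩) _ (List.mem_map_of_mem hc))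
  · rintro ⟨x, hx, rfl⟩
    refine ⟨⟨x, rfl⟩, fun l r hlr u hu hux => ?_⟩
    obtain ⟨T, rfl, rfl⟩ := (htr l r).1 hlr
    obtain ⟨y, hy, rfl⟩ := List.mem_map.1 hu
    rw [h.bot_injective hux] at hy
    exact Option.some_ne_none T (BraidedDiagram.above_unique hy hx)

end IsNaming

end PictureDiagram

end Reduced

/-! ### Reduced diagrams determined by values; permutation and unitary diagrams -/

section Diagrams

variable {A : Type u} {P : SemigroupPresentation A} {G : A → Type v}

theorem BraidedDiagram.frame_perm {Q : SemigroupPresentation A} {D : BraidedDiagram Q}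
    (hD : IsEmpty D.Transistor) :
    (D.wiresAbove none).Perm (D.wiresBelow none) := by
  refine (List.perm_ext_iff_of_nodup (D.above_attachment.nodup none)
    (D.below_attachment.nodup none)).2 fun x => ⟨fun _ => ?_, fun _ => ?_⟩
  · obtain ⟨_ | T, hc⟩ := BraidedDiagram.exists_mem_below D x
    · exact hc
    · exact hD.elim T
  · obtain ⟨_ | T, hc⟩ := BraidedDiagram.exists_mem_above D x
    · exact hc
    · exact hD.elim T

variable [∀ s, Group (G s)]

open WireValue PictureDiagram WireEvent

namespace PictureDiagram

/-- A reduced diagram is determined by the values on the bottom side of its frame. -/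
theorem IsNaming.equivalent {w : List A} {D E : PictureDiagram P G}
    {top bot : D.Wire → WireValue A G} {top' bot' : E.Wire → WireValue A G}
    (h : D.IsNaming w top bot) (h' : E.IsNaming w top' bot')
    (he : (D.wiresAbove none).map bot = (E.wiresAbove none).map bot') :
    BraidedDiagram.Equivalent D E := by
  obtain ⟨C, htr, hlive, hfree⟩ := h.exists_configuration_free
  obtain ⟨C', htr', hlive', hfree'⟩ := h'.exists_configuration_free
  -- Equal values on the bottom mean equal free wires, hence equal configurations. The live wires
  -- and the transistors of this common configuration then match the two diagrams.
  obtain rfl : C = C' := WireConfig.eq_of_free fun v => by rw [hfree, hfree', he]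
  have hj : ∀ x, ∃ y, bot' y = bot x := fun x => (hlive' _).1 ((hlive _).2 ⟨x, rfl⟩)
  have hj' : ∀ y, ∃ x, bot x = bot' y := fun y => (hlive _).1 ((hlive' _).2 ⟨y, rfl⟩)
  have ht : ∀ T, ∃ S, insOf bot T = insOf bot' S ∧ D.outWord T = E.outWord S := fun T =>
    (htr' _ _).1 ((htr _ _).2 ⟨T, rfl, rfl⟩)
  have ht' : ∀ S, ∃ T, insOf bot' S = insOf bot T ∧ E.outWord S = D.outWord T := fun S =>
    (htr _ _).1 ((htr' _ _).2 ⟨S, rfl, rfl⟩)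
  choose j hj using hj
  choose t ht using ht
  have hjb : Function.Bijective j := by
    refine ⟨fun x y hxy => h.bot_injective ?_, fun y => ?_⟩
    · rw [← hj x, hxy, hj y]
    · obtain ⟨x, hx⟩ := hj' y
      exact ⟨x, h'.bot_injective (by rw [hj, hx])⟩
  have htb : Function.Bijective t := by
    refine ⟨fun S T hST => h.transistor_injective ?_, fun S => ?_⟩
    · rw [(ht S).1, hST, (ht T).1]
    · obtain ⟨T, hT⟩ := ht' S
      exact ⟨T, h'.transistor_injective ((ht T).1.symm.trans hT.1.symm)⟩
  -- Distinct wires have distinct names, so attachments can be compared through the names alone.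
  have hmap : ∀ (l : List D.Wire) (m : List E.Wire),
      m.map (fun y => (bot' y).1) = l.map (fun x => (bot x).1) → m = l.map j := by
    intro l m hlm
    have hinj : Function.Injective fun y => (bot' y).1 := fun _ _ => h'.bot_injective
    apply List.map_injective_iff.2 hinj
    rw [hlm, List.map_map]
    exact List.map_congr_left fun x _ => by simp [hj]
  have hbot : ∀ x, (bot x).1 = (top x).1 := fun x => (h.along x).1
  have hbot' : ∀ y, (bot' y).1 = (top' y).1 := fun y => (h'.along y).1
  refine ⟨Equiv.ofBijective j hjb, Equiv.ofBijective t htb, fun x => ?_, fun c => ?_, fun c => ?_⟩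
  · have h1 := congrArg Prod.snd (h'.bot_eq (j x))
    have h2 := congrArg Prod.snd (h.bot_eq x)
    simp only [hj x] at h1 h2
    exact h1.symm.trans h2
  · refine hmap _ _ ?_
    simp only [hbot, hbot']
    have hc : (E.wiresBelow (c.map t)).map top' = (D.wiresBelow c).map top := by
      rcases c with _ | T
      · exact h'.frame.trans h.frame.symm
      · refine (h'.act (t T)).trans ((h.act T).trans ?_).symm
        exact congrArg₂ WireValue.act (ht T).1 (ht T).2
    have := congrArg (List.map Prod.fst) hc
    simpa [Function.comp_def] using this
  · refine hmap _ _ ?_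
    have hc : (E.wiresAbove (c.map t)).map bot' = (D.wiresAbove c).map bot := by
      rcases c with _ | T
      · exact he.symm
      · exact (ht T).1.symm
    have := congrArg (List.map Prod.fst) hc
    simpa [Function.comp_def] using this

theorem IsReduced.exists_naming {w : List A} {D : PictureDiagram P G} (hD : D.IsReduced)
    {e : List (WireValue A G)} (he : D.Evaluates (gens G w) e) :
    ∃ top bot, D.IsNaming w top bot ∧ (D.wiresAbove none).map bot = e := by
  obtain ⟨top, bot, h, hs, he⟩ := he
  exact ⟨top, bot, ⟨h, hs, hD.not_cancels h hs⟩, he⟩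

/-! ### Evaluation of permutation diagrams and unitary diagrams -/

/-- The effect of a unitary diagram on the values on the bottom side of a frame. -/
def UnitaryStep (P : SemigroupPresentation A) (e e' : List (WireValue A G)) : Prop :=
  (∃ a b x s g h, e = a ++ (x, ⟨s, g⟩) :: b ∧ e' = a ++ (x, ⟨s, h⟩) :: b) ∨
  ∃ a b l r, (P.rel (WireValue.word l) r ∨ P.rel r (WireValue.word l)) ∧ e = a ++ l ++ b ∧
    e' = a ++ act l r ++ b

theorem IsPermutation.perm {Q : PictureDiagram P G} (hQ : Q.IsPermutation)
    {e e' : List (WireValue A G)} (h : Q.Evaluates e e') : e'.Perm e := by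
  obtain ⟨top, bot, h, rfl, rfl⟩ := h
  have : bot = top := funext fun x => (h.along x).eq_of_trivial (hQ.2 x)
  rw [this]
  exact (BraidedDiagram.frame_perm hQ.1).map top

theorem IsUnitary.unitaryStep {U : PictureDiagram P G} (hU : U.IsUnitary)
    {e e' : List (WireValue A G)} (h : U.Evaluates e e') : UnitaryStep P e e' := by
  obtain ⟨top, bot, h, rfl, rfl⟩ := h
  rcases hU with ⟨htriv, T, -, a, b, hb, ha⟩ | ⟨hempty, hba, x, hx, hx'⟩
  · right
    have hbt : bot = top := funext fun x => (h.along x).eq_of_trivial (htriv x)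
    refine ⟨a.map top, b.map top, (U.wiresAbove (some T)).map bot,
      U.word (U.wiresBelow (some T)), ?_, ?_, ?_⟩
    · have h1 := U.transistor_rel T
      simp only [SemigroupPresentation.extend, List.map_map] at h1
      rw [h.word_bot]
      exact h1
    · rw [hb, hbt, List.map_append, List.map_append]
    · rw [ha, ← h.act, hbt, List.map_append, List.map_append]
  · left
    have hmem : x ∈ U.wiresBelow none := by
      obtain ⟨_ | T, hc⟩ := BraidedDiagram.exists_mem_below U x
      · exact hc
      · exact hempty.elim T
    have hnd : (U.wiresBelow none).Nodup := U.below_attachment.nodup none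
    obtain ⟨a, b, hab⟩ := List.append_of_mem hmem
    rw [hab] at hnd
    have hbt : ∀ y, y ≠ x → bot y = top y := fun y hy => (h.along y).eq_of_trivial (by
      by_contra hcon
      exact hy (hx' y hcon))
    have hxa : ∀ y ∈ a, y ≠ x := by
      rintro y hy rfl
      rw [List.nodup_append] at hnd
      exact hnd.2.2 y hy y (by simp) rfl
    have hxb : ∀ y ∈ b, y ≠ x := by
      rintro y hy rfl
      rw [List.nodup_append, List.nodup_cons] at hnd
      exact hnd.2.1.1 hy
    obtain ⟨h1, s, g, k, h2, -, h3⟩ := h.along x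
    refine ⟨a.map top, b.map top, (top x).1, s, g, g * k, ?_, ?_⟩
    · rw [hab, List.map_append, List.map_cons, ← h2]
    · rw [← hba, hab, List.map_append, List.map_cons, ← h3, ← h1,
        List.map_congr_left fun y hy => hbt y (hxa y hy),
        List.map_congr_left fun y hy => hbt y (hxb y hy)]

/-! ### Construction of permutation diagrams and unitary diagrams -/

theorem along_trivial (v : WireValue A G) : Along v ⟨v.2.1, 1⟩ v :=
  ⟨rfl, v.2.1, v.2.2, 1, rfl, rfl, by rw [mul_one]⟩

variable (P G) in
/-- A diagram without transistors. -/
def wiring (n : ℕ) [NeZero n] (label : Fin n → Sigma G) (σ : List (Fin n))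
    (hσ : σ.Perm (List.finRange n)) : PictureDiagram P G where
  Wire := Fin n
  Transistor := Empty
  finite_wire := inferInstance
  nonempty_wire := ⟨0⟩
  finite_transistor := inferInstance
  label := label
  wiresBelow _ := List.finRange n
  wiresAbove _ := σ
  top_attached := isAttachment_univ_iff.1 ⟨fun _ => List.nodup_finRange n,
    fun x => ⟨fun _ => ⟨none, List.mem_finRange x⟩, fun _ => trivial⟩,
    fun _ _ _ _ _ => Subsingleton.elim _ _⟩
  bottom_attached := isAttachment_univ_iff.1 ⟨fun _ => hσ.nodup_iff.2 (List.nodup_finRange n),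
    fun x => ⟨fun _ => ⟨none, hσ.mem_iff.2 (List.mem_finRange x)⟩, fun _ => trivial⟩,
    fun _ _ _ _ _ => Subsingleton.elim _ _⟩
  transistor_rel T := T.elim
  acyclic T := T.elim

theorem wiring_evaluates (n : ℕ) [NeZero n] (label : Fin n → Sigma G) (σ : List (Fin n))
    (hσ : σ.Perm (List.finRange n)) (top bot : Fin n → WireValue A G)
    (h : ∀ i, Along (top i) (label i) (bot i)) :
    (wiring P G n label σ hσ).Evaluates ((List.finRange n).map top) (σ.map bot) :=
  ⟨top, bot, ⟨h, fun T => T.elim⟩, rfl, rfl⟩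

theorem exists_permutation {e e' : List (WireValue A G)} (he : e ≠ []) (h : e'.Perm e) :
    ∃ Q : PictureDiagram P G, Q.IsPermutation ∧ Q.Evaluates e e' := by
  -- The permutation of values is lifted to positions, which works even if a value is repeated.
  have hF : List.Forall₂ (fun v i => v = e.get i) e (List.finRange e.length) := by
    have h1 : List.Forall₂ (fun v i => v = e.get i) ((List.finRange e.length).map e.get)
        (List.finRange e.length) := by
      rw [List.forall₂_map_left_iff, List.forall₂_same]
      simp
    rwa [List.map_get_finRange] at h1
  obtain ⟨σ, hσ, hσ'⟩ := List.perm_comp_forall₂ h hF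
  have hmap : e' = σ.map e.get := by
    rw [← List.forall₂_eq_eq_eq, List.forall₂_map_right_iff]
    exact hσ
  have : NeZero e.length := ⟨by simpa using he⟩
  refine ⟨wiring P G e.length (fun i => ⟨(e.get i).2.1, 1⟩) σ hσ',
    ⟨inferInstanceAs (IsEmpty Empty), fun _ => rfl⟩, ?_⟩
  have := wiring_evaluates (P := P) e.length (fun i => ⟨(e.get i).2.1, 1⟩) σ hσ' e.get e.get
    fun i => along_trivial _
  rwa [List.map_get_finRange, ← hmap] at this

theorem exists_linear (x : WireName A G) {s : A} {g h : G s} (hgh : g ≠ h)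
    (b : List (WireValue A G)) : ∃ U : PictureDiagram P G, U.IsLinear ∧
      U.Evaluates ((x, ⟨s, g⟩) :: b) ((x, ⟨s, h⟩) :: b) := by
  -- The factor `g⁻¹ * h` turns `g` into `h` and is nontrivial because `g ≠ h`.
  let label : Fin (b.length + 1) → Sigma G := Fin.cases ⟨s, g⁻¹ * h⟩ fun i => ⟨(b.get i).2.1, 1⟩
  refine ⟨wiring P G (b.length + 1) label _ (List.Perm.refl _),
    ⟨inferInstanceAs (IsEmpty Empty), rfl, (0 : Fin (b.length + 1)), ?_, ?_⟩, ?_⟩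
  · change ¬ (g⁻¹ * h = 1)
    rwa [inv_mul_eq_one]
  · intro i
    change ¬ ((label i).2 = 1) → i = (0 : Fin (b.length + 1))
    refine Fin.cases (fun _ => rfl) (fun i hi => ?_) i
    exact absurd rfl hi
  · have := wiring_evaluates (P := P) (b.length + 1) label _ (List.Perm.refl _)
      ((x, ⟨s, g⟩) :: b).get ((x, ⟨s, h⟩) :: b).get fun i => by
        refine Fin.cases ⟨rfl, s, g, g⁻¹ * h, rfl, rfl, ?_⟩ (fun i => ?_) i
        · simp
        · exact along_trivial (b.get i)
    have h1 : ∀ c : WireValue A G, (List.finRange (b.length + 1)).map (c :: b).get = c :: b :=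
      fun c => List.map_get_finRange (c :: b)
    rwa [h1, h1] at this

/-- Cancelling or adding a transistor on the left. -/
theorem exists_transistor {l : List (WireValue A G)} {r : List A}
    (hrel : P.rel (WireValue.word l) r ∨ P.rel r (WireValue.word l)) (b : List (WireValue A G)) :
    ∃ U : PictureDiagram P G, U.IsTransistorDiagram ∧ U.Evaluates (l ++ b) (act l r ++ b) := by
  set m := act l r with hm
  have hl0 : l ≠ [] := by
    rintro rfl
    rcases hrel with h1 | h1
    · exact P.ne_nil_left _ _ h1 rfl
    · exact P.ne_nil_right _ _ h1 rfl
  -- The wires are the inputs, the outputs and the bystanders, each carrying its value. Only the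
  -- word of `act l r` matters for the diagram, so cancellation and creation are treated together.
  let val : (Fin l.length ⊕ Fin m.length ⊕ Fin b.length) → WireValue A G :=
    Sum.elim l.get (Sum.elim m.get b.get)
  let L : List (Fin l.length ⊕ Fin m.length ⊕ Fin b.length) := (List.finRange _).map Sum.inl
  let M : List (Fin l.length ⊕ Fin m.length ⊕ Fin b.length) :=
    (List.finRange _).map fun i => Sum.inr (Sum.inl i)
  let B : List (Fin l.length ⊕ Fin m.length ⊕ Fin b.length) :=
    (List.finRange _).map fun i => Sum.inr (Sum.inr i)
  have hL : L.map val = l := by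
    simp only [L, List.map_map]
    exact List.map_get_finRange l
  have hM : M.map val = m := by
    simp only [M, List.map_map]
    exact List.map_get_finRange m
  have hB : B.map val = b := by
    simp only [B, List.map_map]
    exact List.map_get_finRange b
  have hLn : L.Nodup := (List.nodup_finRange _).map Sum.inl_injective
  have hMn : M.Nodup := (List.nodup_finRange _).map (Sum.inr_injective.comp Sum.inl_injective)
  have hBn : B.Nodup := (List.nodup_finRange _).map (Sum.inr_injective.comp Sum.inr_injective)
  let label : (Fin l.length ⊕ Fin m.length ⊕ Fin b.length) → Sigma G := fun x => ⟨(val x).2.1, 1⟩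
  have hword : ∀ K : List (Fin l.length ⊕ Fin m.length ⊕ Fin b.length),
      K.map (fun x => (label x).1) = WireValue.word (K.map val) := by
    intro K
    simp only [WireValue.word, List.map_map]
    rfl
  let below : Option Unit → List (Fin l.length ⊕ Fin m.length ⊕ Fin b.length) :=
    fun c => c.elim (L ++ B) fun _ => M
  let above : Option Unit → List (Fin l.length ⊕ Fin m.length ⊕ Fin b.length) :=
    fun c => c.elim (M ++ B) fun _ => L
  let D : PictureDiagram P G := {
    Wire := Fin l.length ⊕ Fin m.length ⊕ Fin b.length
    Transistor := Unit
    finite_wire := inferInstance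
    nonempty_wire := ⟨Sum.inl ⟨0, List.length_pos_iff.2 hl0⟩⟩
    finite_transistor := inferInstance
    label := label
    wiresBelow := below
    wiresAbove := above
    top_attached := by
      refine isAttachment_univ_iff.1 ⟨?_, ?_, ?_⟩
      · rintro (_ | _)
        · refine List.Nodup.append hLn hBn ?_
          simp [List.disjoint_left, L, B]
        · exact hMn
      · rintro (x | x | x)
        · exact ⟨fun _ => ⟨none, by simp [below, L]⟩, fun _ => trivial⟩
        · exact ⟨fun _ => ⟨some (), by simp [below, M]⟩, fun _ => trivial⟩
        · exact ⟨fun _ => ⟨none, by simp [below, B]⟩, fun _ => trivial⟩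
      · rintro (_ | _) (_ | _) (x | x | x) h1 h2 <;> first | rfl | simp [below, L, M, B] at h1 h2
    bottom_attached := by
      refine isAttachment_univ_iff.1 ⟨?_, ?_, ?_⟩
      · rintro (_ | _)
        · refine List.Nodup.append hMn hBn ?_
          simp [List.disjoint_left, M, B]
        · exact hLn
      · rintro (x | x | x)
        · exact ⟨fun _ => ⟨some (), by simp [above, L]⟩, fun _ => trivial⟩
        · exact ⟨fun _ => ⟨none, by simp [above, M]⟩, fun _ => trivial⟩
        · exact ⟨fun _ => ⟨none, by simp [above, B]⟩, fun _ => trivial⟩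
      · rintro (_ | _) (_ | _) (x | x | x) h1 h2 <;> first | rfl | simp [above, L, M, B] at h1 h2
    transistor_rel := fun _ => by
      simp only [SemigroupPresentation.extend, List.map_map]
      change P.rel (L.map fun x => (label x).1) (M.map fun x => (label x).1) ∨
        P.rel (M.map fun x => (label x).1) (L.map fun x => (label x).1)
      rw [hword, hword, hL, hM, hm, word_act]
      exact hrel
    acyclic := BraidedDiagram.acyclic_of_height (fun _ => 0) fun T₁ T₂ x h1 h2 => by
      rcases x with x | x | x <;> simp [below, above, L, M] at h1 h2 }
  refine ⟨D, ⟨fun _ => rfl, (), fun _ => rfl, [], B, rfl, rfl⟩, val, val,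
    ⟨fun x => along_trivial _, fun _ => ?_⟩, ?_, ?_⟩
  · change M.map val = act (L.map val) (M.map fun x => (label x).1)
    rw [hword, hL, hM, hm, word_act]
  · change (L ++ B).map val = _
    rw [List.map_append, hL, hB]
  · change (M ++ B).map val = _
    rw [List.map_append, hM, hB]

end PictureDiagram

end Diagrams

/-! ### Unitary moves and changes at one key -/

section Moves

variable {A : Type u} {P : SemigroupPresentation A} {G : A → Type v} [∀ s, Group (G s)]
  {w : List A}

open WireValue PictureDiagram WireEvent EventStructure

namespace WireConfig

variable {C C' : (wireEvents P G w).Configuration}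

theorem val_eq_of_insert {l : List (WireValue A G)} {r : List A}
    (hC : C'.carrier = insert (transistor l r) C.carrier) {k} (hk : k ≠ Sum.inl (l, r)) :
    C.val k = C'.val k := by
  rw [Configuration.val_eq_iff]
  rintro e rfl
  rw [hC, Set.mem_insert_iff]
  refine ⟨Or.inr, fun he => he.resolve_left ?_⟩
  rintro rfl
  exact hk rfl

theorem mem_append_sdiff {α : Type*} {a l b : List α} (h : (a ++ l ++ b).Nodup) {v : α} :
    v ∈ a ++ b ↔ v ∈ a ++ l ++ b ∧ v ∉ l := by
  simp only [List.nodup_append, List.mem_append] at h ⊢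
  constructor
  · rintro (hv | hv)
    · exact ⟨Or.inl (Or.inl hv), fun hl => h.1.2.2 v hv v hl rfl⟩
    · exact ⟨Or.inr hv, fun hl => h.2.2 v (Or.inr hl) v hv rfl⟩
  · tauto

theorem mem_append_middle {α : Type*} {a l b : List α} {v : α} :
    v ∈ a ++ l ++ b ↔ v ∈ a ++ b ∨ v ∈ l := by
  simp only [List.mem_append]
  tauto

/-- A unitary diagram changes a configuration at one key at most. -/
theorem exists_key_of_unitaryStep {e e' : List (WireValue A G)} (he : e.Nodup)
    (hC : ∀ v, v ∈ e ↔ Free C v) (hC' : ∀ v, v ∈ e' ↔ Free C' v) (h : UnitaryStep P e e') :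
    ∃ k, ∀ k', k' ≠ k → C.val k' = C'.val k' := by
  rcases h with ⟨a, b, x, s, g, h, rfl, rfl⟩ | ⟨a, b, l, r, hrel, rfl, rfl⟩
  · obtain ⟨C'', hlive, hval⟩ := exists_relabel ((hC (x, ⟨s, g⟩)).1 (by simp)) h
    have hfree := free_relabel ((hC (x, ⟨s, g⟩)).1 (by simp)) hlive hval
    have : C'' = C' := eq_of_free fun v => by
      rw [hfree, ← hC, ← hC']
      have h1 := @mem_append_sdiff _ a [(x, ⟨s, g⟩)] b (by simpa using he) v
      simp only [List.append_assoc, List.singleton_append, List.mem_singleton] at h1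
      rw [← h1]
      simp only [List.mem_append, List.mem_cons]
      tauto
    exact ⟨_, this ▸ hval⟩
  · have hl : ∀ v ∈ l, Free C v := fun v hv => (hC v).1 (by simp [hv])
    have hab := fun v => @mem_append_sdiff _ a l b he v
    have hnd : l.Nodup := by
      simp only [List.nodup_append] at he
      exact he.1.2.1
    -- Cancellation erases the transistor `(m, word l)` from the configuration; otherwise the
    -- transistor `(l, r)` is inserted.
    by_cases hc : Cancels l r
    · obtain ⟨m, hm, rfl⟩ := hc
      have hl0 : WireValue.word l ≠ [] := by
        rcases hrel with h1 | h1
        · exact P.ne_nil_left _ _ h1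
        · exact P.ne_nil_right _ _ h1
      have hact : act l (WireValue.word m) = m := by
        rw [hm]
        exact act_outs hl0
      obtain ⟨C'', hn, hins⟩ := exists_erase hl0 (hm ▸ hl)
      obtain ⟨h1, h2, h3⟩ := free_insert hn hins
      rw [← hm] at h2 h3
      rw [hact] at hC'
      have : C'' = C' := eq_of_free fun v => by
        rw [← hC', mem_append_middle, hab, hC, h3]
        constructor
        · intro hv
          by_cases hvm : v ∈ m
          · exact Or.inr hvm
          · exact Or.inl ⟨Or.inl ⟨hv, hvm⟩, fun hvl => h2 v hvl hv.1⟩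
        · rintro (⟨⟨h4, -⟩ | h4, h5⟩ | h4)
          · exact h4
          · exact absurd h4 h5
          · exact h1 v h4
      subst this
      exact ⟨_, fun k hk => (val_eq_of_insert hins hk).symm⟩
    · obtain ⟨hn, C'', hins⟩ := exists_insert hrel hnd hc hl
      obtain ⟨h1, h2, h3⟩ := free_insert hn hins
      rw [act_of_not_cancels hc] at hC'
      have : C'' = C' := eq_of_free fun v => by
        rw [← hC', mem_append_middle, hab, hC, h3]
      subst this
      exact ⟨_, fun k hk => val_eq_of_insert hins hk⟩

/-- The moves that are sufficient to change one key of a configuration. -/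
def SimpleStep (P : SemigroupPresentation A) (e e' : List (WireValue A G)) : Prop :=
  (∃ b x s g h, g ≠ h ∧ e = (x, ⟨s, g⟩) :: b ∧ e' = (x, ⟨s, h⟩) :: b) ∨
  ∃ b l r, (P.rel (WireValue.word l) r ∨ P.rel r (WireValue.word l)) ∧ e = l ++ b ∧
    e' = act l r ++ b

theorem exists_perm_append {α : Type*} {e l : List α} (he : e.Nodup) (hl : l.Nodup)
    (h : ∀ v ∈ l, v ∈ e) : ∃ b : List α, (l ++ b).Perm e ∧ ∀ v, v ∈ b ↔ v ∈ e ∧ v ∉ l := by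
  classical
  have hb : ∀ v, v ∈ e.filter (· ∉ l) ↔ v ∈ e ∧ v ∉ l := by simp
  refine ⟨e.filter (· ∉ l), (List.perm_ext_iff_of_nodup ?_ he).2 fun v => ?_, hb⟩
  · exact hl.append (he.filter _) fun v h1 h2 => ((hb v).1 h2).2 h1
  · rw [List.mem_append, hb]
    constructor
    · rintro (h1 | h1)
      · exact h v h1
      · exact h1.1
    · intro h1
      by_cases h2 : v ∈ l
      · exact Or.inl h2
      · exact Or.inr ⟨h1, h2⟩

theorem nodup_outs (l : List (WireValue A G)) (r : List A) : (outs l r).Nodup := by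
  rw [List.nodup_iff_getElem?_ne_getElem?]
  intro i j hij hj he
  rw [length_outs] at hj
  rw [getElem?_outs, getElem?_outs, List.getElem?_eq_getElem hj,
    List.getElem?_eq_getElem (hij.trans hj)] at he
  simp at he
  omega

theorem exists_insert_of_val {l : List (WireValue A G)} {r : List A}
    (hC' : transistor l r ∈ C'.carrier)
    (h : ∀ k, k ≠ Sum.inl (l, r) → C.val k = C'.val k) :
    C'.carrier = insert (transistor l r) C.carrier := by
  ext e
  rw [Set.mem_insert_iff]
  by_cases he : e.key = Sum.inl (l, r)
  · have : e = transistor l r := by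
      rcases e with ⟨l', r'⟩ | v
      · simp only [WireEvent.key, Sum.inl.injEq, Prod.mk.injEq] at he
        rw [he.1, he.2]
      · simp [WireEvent.key] at he
    simp [this, hC']
  · have h1 := Configuration.val_eq_iff.1 (h _ he) e rfl
    rw [h1]
    refine ⟨Or.inr, fun h2 => h2.resolve_left ?_⟩
    rintro rfl
    exact he rfl

/-- Erasing a transistor is acting on its outputs by its inverse, inserting one is acting on its
inputs, and the remaining case is a relabelling. In each case the wires concerned are free, so a
permutation brings them to the left end, where a `SimpleStep` applies. -/
theorem exists_step {e : List (WireValue A G)} (he : e.Nodup) (hC : ∀ v, v ∈ e ↔ Free C v) {k}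
    (hne : C ≠ C') (h : ∀ k', k' ≠ k → C.val k' = C'.val k') :
    ∃ e₁ e', e₁.Perm e ∧ SimpleStep P e₁ e' ∧ ∀ v, v ∈ e' ↔ Free C' v := by
  rcases k with ⟨l, r⟩ | x
  · by_cases h1 : transistor l r ∈ C.carrier
    · have h2 : transistor l r ∉ C'.carrier := by
        intro h2
        refine hne (Configuration.val_injective (funext fun k => ?_))
        by_cases hk : k = Sum.inl (l, r)
        · subst hk
          exact Configuration.val_eq_of_mem h1 h2
        · exact h k hk
      have hins := exists_insert_of_val h1 fun k hk => (h k hk).symm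
      obtain ⟨h3, h4, h5⟩ := free_insert h2 hins
      obtain ⟨b, hb, hb'⟩ := exists_perm_append he (nodup_outs l r) fun v hv =>
        (hC v).2 ((h5 v).2 (Or.inr hv))
      refine ⟨outs l r ++ b, l ++ b, hb, Or.inr ⟨b, outs l r, WireValue.word l, ?_, rfl, ?_⟩,
        fun v => ?_⟩
      · rw [word_outs]
        exact (C.valid _ h1).1.symm
      · rw [act_outs (ne_nil_of_transistor h1).2]
      · rw [List.mem_append, hb', hC, h5]
        constructor
        · rintro (h6 | ⟨h6 | h6, h7⟩)
          · exact h3 v h6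
          · exact h6.1
          · exact absurd h6 h7
        · intro h6
          by_cases h7 : v ∈ l
          · exact Or.inl h7
          · exact Or.inr ⟨Or.inl ⟨h6, h7⟩, fun h8 => h4 v h8 h6.1⟩
    · have h2 : transistor l r ∈ C'.carrier := by
        by_contra h2
        refine hne (Configuration.val_injective (funext fun k => ?_))
        by_cases hk : k = Sum.inl (l, r)
        · subst hk
          refine Configuration.val_eq_iff.2 fun e he => ?_
          rcases e with ⟨l', r'⟩ | v
          · change Sum.inl (l', r') = _ at he
            simp only [Sum.inl.injEq, Prod.mk.injEq] at he
            simp [he.1, he.2, h1, h2]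
          · cases he
        · exact h k hk
      have hins := exists_insert_of_val h2 h
      obtain ⟨h3, h4, h5⟩ := free_insert h1 hins
      have hv := C'.valid _ h2
      obtain ⟨b, hb, hb'⟩ := exists_perm_append he hv.2.1.of_map fun v hv => (hC v).2 (h3 v hv)
      refine ⟨l ++ b, outs l r ++ b, hb, Or.inr ⟨b, l, r, hv.1, rfl, ?_⟩, fun v => ?_⟩
      · rw [act_of_not_cancels hv.2.2.1]
      · rw [List.mem_append, hb', hC, h5]
        tauto
  · have htr : ∀ l r, transistor l r ∈ C.carrier ↔ transistor l r ∈ C'.carrier := fun l r =>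
      Configuration.val_eq_iff.1 (h (Sum.inl (l, r)) (by simp)) _ rfl
    have hval : C.val (Sum.inr x) ≠ C'.val (Sum.inr x) := by
      intro hx
      refine hne (Configuration.val_injective (funext fun k => ?_))
      by_cases hk : k = Sum.inr x
      · rw [hk, hx]
      · exact h k hk
    have hlab : ∃ σ, label (x, σ) ∈ C.carrier ∨ label (x, σ) ∈ C'.carrier := by
      by_contra hcon
      push Not at hcon
      refine hval (Configuration.val_eq_iff.2 fun e he => ?_)
      rcases e with ⟨l, r⟩ | ⟨y, σ⟩
      · cases he
      · obtain rfl : y = x := Sum.inr_injective he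
        simp [hcon σ]
    have hx : ∃ s, x.sort w = some s ∧ ∀ l r j, x = .out l r j → transistor l r ∈ C.carrier := by
      obtain ⟨σ, h1 | h1⟩ := hlab
      · exact ⟨σ.1, (live_of_label h1).1, (live_of_label h1).2.1⟩
      · exact ⟨σ.1, (live_of_label h1).1, fun l r j hj =>
          (htr l r).2 ((live_of_label h1).2.1 l r j hj)⟩
    obtain ⟨s, hs, hx⟩ := hx
    obtain ⟨⟨s₁, g⟩, hg⟩ := exists_live (C := C) hs hx
    obtain ⟨⟨s₂, k⟩, hk⟩ := exists_live (C := C') hs fun l r j hj => (htr l r).1 (hx l r j hj)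
    obtain rfl : s₁ = s₂ := Option.some_injective _ (hg.1.symm.trans hk.1)
    have hgk : g ≠ k := by
      rintro rfl
      refine hval (Configuration.val_eq_iff.2 fun e he => ?_)
      rcases e with ⟨l, r⟩ | ⟨y, σ⟩
      · cases he
      · obtain rfl : y = x := Sum.inr_injective he
        rw [label_mem_iff, label_mem_iff]
        refine and_congr_left fun _ => ⟨fun h1 => ?_, fun h1 => ?_⟩
        · rw [live_unique h1 hg rfl]
          exact hk
        · rw [live_unique h1 hk rfl]
          exact hg
    -- A transistor using `x` would belong to both configurations and impose the same label of `x`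
    -- on them.
    have hfree : Free C (x, ⟨s₁, g⟩) := by
      refine ⟨hg, fun l r hlr u hu hux => hgk ?_⟩
      have h1 := live_unique (live_of_transistor hlr hu) hg hux
      have h2 := live_unique (live_of_transistor ((htr l r).1 hlr) hu) hk hux
      have h3 := h1.symm.trans h2
      simpa using h3
    obtain ⟨b, hb, hb'⟩ := exists_perm_append (l := [(x, ⟨s₁, g⟩)]) he (List.nodup_singleton _)
      fun v hv => (hC v).2 (List.mem_singleton.1 hv ▸ hfree)
    refine ⟨_, _, hb, Or.inl ⟨b, x, s₁, g, k, hgk, rfl, rfl⟩, fun v => ?_⟩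
    rw [List.mem_cons, hb', hC, List.mem_singleton, free_relabel hfree hk h]
    tauto

end WireConfig

namespace PictureDiagram

/-- The configuration `C` describes the class of the diagram `D`. -/
def Represents (C : (wireEvents P G w).Configuration) (D : PictureDiagram P G) : Prop :=
  ∃ e, D.Evaluates (gens G w) e ∧ e.Nodup ∧ ∀ v, v ∈ e ↔ WireConfig.Free C v

variable {C C' : (wireEvents P G w).Configuration} {D D' : PictureDiagram P G}

theorem Represents.topWord_eq (h : Represents C D) : D.topWord = w := by
  obtain ⟨e, he, -⟩ := h
  rw [← he.word_eq.1, word_gens]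

theorem IsReduced.exists_represents (hD : D.IsReduced) {e : List (WireValue A G)}
    (he : D.Evaluates (gens G w) e) :
    e.Nodup ∧ ∃ C : (wireEvents P G w).Configuration, ∀ v, v ∈ e ↔ WireConfig.Free C v := by
  obtain ⟨top, bot, h, rfl⟩ := hD.exists_naming he
  obtain ⟨C, -, -, hfree⟩ := h.exists_configuration_free
  exact ⟨(D.above_attachment.nodup none).map_on fun x _ y _ hxy =>
    h.bot_injective (congrArg Prod.fst hxy), C, fun v => (hfree v).symm⟩

/-- Evaluation survives reduction, so the configuration of any reduction of `D` represents `D`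
itself. -/
theorem exists_represents (hD : D.topWord = w) :
    ∃ C : (wireEvents P G w).Configuration, Represents C D := by
  obtain ⟨e, he⟩ := D.exists_evaluates (s := gens G w) (by rw [word_gens, hD])
  obtain ⟨R, hR⟩ := D.exists_reduction
  obtain ⟨hnd, C, hC⟩ := hR.1.exists_represents (he.of_reduction (normal_gens w) hR)
  exact ⟨C, e, he, hnd, hC⟩

theorem Represents.unique (h : Represents C D) (h' : Represents C' D) : C = C' := by
  obtain ⟨e, he, -, hC⟩ := h
  obtain ⟨e', he', -, hC'⟩ := h'
  obtain rfl := he.unique he'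
  exact WireConfig.eq_of_free fun v => by rw [← hC, ← hC']

theorem IsProduct.botWord_eq {D₁ D₂ D : PictureDiagram P G} (h : IsProduct D₁ D₂ D) :
    D₁.botWord = D₂.topWord := by
  obtain ⟨C, hC, -⟩ := h
  exact hC.1

theorem IsProduct.exists_evaluates {D₁ D₂ D : PictureDiagram P G} (h : IsProduct D₁ D₂ D)
    {s m : List (WireValue A G)} (hs : ∀ v ∈ s, v.1.Normal) (h₁ : D₁.Evaluates s m) :
    ∃ e, D₂.Evaluates m e ∧ D.Evaluates s e := by
  obtain ⟨e, he⟩ := D₂.exists_evaluates (s := m) (by rw [h₁.word_eq.2, h.botWord_eq])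
  exact ⟨e, he, h.evaluates hs h₁ he⟩

theorem IsProduct.topWord_eq {D₁ D₂ D : PictureDiagram P G} (h : IsProduct D₁ D₂ D) :
    D.topWord = D₁.topWord := by
  obtain ⟨m, hm⟩ := D₁.exists_evaluates (s := gens G D₁.topWord) (word_gens _)
  obtain ⟨e, -, he⟩ := h.exists_evaluates (normal_gens _) hm
  rw [← he.word_eq.1, word_gens]

theorem topWord_eq_of_mem_diagramClass {R : PictureDiagram P G} (h : R ∈ D.diagramClass) :
    R.topWord = D.topWord := by
  obtain ⟨Q, -, hQ⟩ := h
  exact hQ.topWord_eq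

theorem Represents.of_mem_diagramClass (h : Represents C D) {R : PictureDiagram P G}
    (hR : R ∈ D.diagramClass) : Represents C R := by
  obtain ⟨e, he, hnd, hC⟩ := h
  obtain ⟨Q, hQ, hR⟩ := hR
  obtain ⟨e', hQe, hRe⟩ := hR.exists_evaluates (normal_gens w) he
  have hperm := hQ.perm hQe
  exact ⟨e', hRe, hperm.nodup_iff.2 hnd, fun v => by rw [hperm.mem_iff, hC]⟩

theorem Evaluates.ne_nil {s e : List (WireValue A G)} (h : D.Evaluates s e) : e ≠ [] := by
  obtain ⟨top, bot, -, -, rfl⟩ := h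
  simpa using D.above_none_ne_nil

/-- The values on the bottom side of the frame can be permuted within the class. -/
theorem Represents.exists_mem_diagramClass (h : Represents C D) {e : List (WireValue A G)}
    (hnd : e.Nodup) (he : ∀ v, v ∈ e ↔ WireConfig.Free C v) :
    ∃ K R, R ∈ D.diagramClass ∧ IsReductionOf R K ∧ R.Evaluates (gens G w) e ∧
      ∀ R', IsReductionOf R' K → R' ∈ D.diagramClass := by
  obtain ⟨e₀, he₀, hnd₀, hC⟩ := h
  have hperm : e.Perm e₀ :=
    (List.perm_ext_iff_of_nodup hnd hnd₀).2 fun v => by rw [he, hC]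
  have hw : WireValue.word e₀ = D.botWord := he₀.word_eq.2
  obtain ⟨Q, hQ, hQe⟩ := exists_permutation (P := P) he₀.ne_nil hperm
  obtain ⟨K, hK⟩ := exists_concat (D₁ := D) (D₂ := Q) (by rw [← hw, hQe.word_eq.1])
  obtain ⟨R, hR⟩ := K.exists_reduction
  exact ⟨K, R, ⟨Q, hQ, K, hK, hR⟩, hR, (hK.evaluates he₀ hQe).of_reduction (normal_gens w) hR,
    fun R' hR' => ⟨Q, hQ, K, hK, hR'⟩⟩

end PictureDiagram

end Moves

/-! ### Classes of diagrams as configurations, and the theorem -/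

section Main

variable {A : Type u} {P : SemigroupPresentation A} {G : A → Type v} [∀ s, Group (G s)]
  {w : List A}

open WireValue PictureDiagram EventStructure WireConfig

theorem EventStructure.Configuration.exists_val_ne {E K : Type*} {S : EventStructure E K}
    {C C' : S.Configuration} : (∃ k, C.val k ≠ C'.val k ∧ ∀ k', k' ≠ k → C.val k' = C'.val k') ↔
      C ≠ C' ∧ ∃ k, ∀ k', k' ≠ k → C.val k' = C'.val k' := by
  constructor
  · rintro ⟨k, hk, h⟩
    exact ⟨fun he => hk (by rw [he]), k, h⟩
  · rintro ⟨hne, k, h⟩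
    refine ⟨k, fun hk => hne (Configuration.val_injective (funext fun k' => ?_)), h⟩
    by_cases hk' : k' = k
    · rw [hk', hk]
    · exact h k' hk'

namespace PictureDiagram

variable {C C' : (wireEvents P G w).Configuration} {D D' : PictureDiagram P G}

theorem IsReduced.equivalent (hD : D.IsReduced) (hD' : D'.IsReduced) {e : List (WireValue A G)}
    (h : D.Evaluates (gens G w) e) (h' : D'.Evaluates (gens G w) e) :
    BraidedDiagram.Equivalent D D' := by
  obtain ⟨top, bot, hn, he⟩ := hD.exists_naming h
  obtain ⟨top', bot', hn', he'⟩ := hD'.exists_naming h'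
  exact hn.equivalent hn' (he.trans he'.symm)

/-- A suitable product of `D` with a permutation has the same bottom values as `R`. Reduced diagrams
with the same values are equivalent, and `IsReductionOf` absorbs equivalences. -/
theorem Represents.mem_diagramClass (h : Represents C D) {R : PictureDiagram P G}
    (hR : R.IsReduced) (hRC : Represents C R) : R ∈ D.diagramClass := by
  obtain ⟨e, he, hnd, hC⟩ := hRC
  obtain ⟨K, R', -, hR', he', hmem⟩ := h.exists_mem_diagramClass hnd hC
  exact hmem R ⟨hR, hR'.2.tail (Or.inr (hR'.1.equivalent hR he' he))⟩

theorem isReduced_of_mem_diagramClass {R : PictureDiagram P G} (h : R ∈ D.diagramClass) :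
    R.IsReduced := by
  obtain ⟨Q, -, K, -, hR⟩ := h
  exact hR.1

/-- Diagrams with the same configuration have the same class. -/
theorem Represents.mk_eq (h : Represents C D) (h' : Represents C D') :
    PictureVertex.mk D = PictureVertex.mk D' :=
  Subtype.ext <| Set.Subset.antisymm
    (fun _ hR => h'.mem_diagramClass (isReduced_of_mem_diagramClass hR) (h.of_mem_diagramClass hR))
    fun _ hR => h.mem_diagramClass (isReduced_of_mem_diagramClass hR) (h'.of_mem_diagramClass hR)

/-- Diagrams with the same class have the same configuration. -/
theorem Represents.eq_of_mk_eq (h : Represents C D) (h' : Represents C' D')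
    (he : PictureVertex.mk D = PictureVertex.mk D') : C = C' := by
  obtain ⟨e, -, hnd, hC⟩ := id h
  obtain ⟨K, R, hR, -⟩ := h.exists_mem_diagramClass hnd hC
  have hR' : R ∈ D'.diagramClass := (congrArg Subtype.val he).subset hR
  exact (h.of_mem_diagramClass hR).unique (h'.of_mem_diagramClass hR')

theorem Represents.exists_key (h : Represents C D) (h' : Represents C' D')
    {D₁ D₂ U : PictureDiagram P G} (h₁ : D₁ ∈ D.diagramClass) (h₂ : D₂ ∈ D'.diagramClass)
    (hU : U.IsUnitary) (hp : IsProduct D₁ U D₂) :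
    ∃ k, ∀ k', k' ≠ k → C.val k' = C'.val k' := by
  obtain ⟨e, he, hnd, hC⟩ := h.of_mem_diagramClass h₁
  obtain ⟨e', he', -, hC'⟩ := h'.of_mem_diagramClass h₂
  obtain ⟨m, hm, hm'⟩ := hp.exists_evaluates (normal_gens w) he
  obtain rfl := he'.unique hm'
  exact WireConfig.exists_key_of_unitaryStep hnd hC hC' (hU.unitaryStep hm)

theorem adj_mk_iff : (bigPictureGraph P G).Adj (PictureVertex.mk D) (PictureVertex.mk D') ↔
    PictureVertex.mk D ≠ PictureVertex.mk D' ∧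
      ((∃ D₁ ∈ D.diagramClass, ∃ D₂ ∈ D'.diagramClass, ∃ U : PictureDiagram P G,
        U.IsUnitary ∧ IsProduct D₁ U D₂) ∨
      ∃ D₁ ∈ D'.diagramClass, ∃ D₂ ∈ D.diagramClass, ∃ U : PictureDiagram P G,
        U.IsUnitary ∧ IsProduct D₁ U D₂) :=
  SimpleGraph.fromRel_adj _ _ _

theorem Represents.exists_key_of_adj (h : Represents C D) (h' : Represents C' D')
    (hadj : (bigPictureGraph P G).Adj (PictureVertex.mk D) (PictureVertex.mk D')) :
    C ≠ C' ∧ ∃ k, ∀ k', k' ≠ k → C.val k' = C'.val k' := by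
  obtain ⟨hne, hadj⟩ := adj_mk_iff.1 hadj
  refine ⟨fun he => hne (h.mk_eq (he ▸ h')), ?_⟩
  rcases hadj with ⟨D₁, h₁, D₂, h₂, U, hU, hp⟩ | ⟨D₁, h₁, D₂, h₂, U, hU, hp⟩
  · exact h.exists_key h' h₁ h₂ hU hp
  · obtain ⟨k, hk⟩ := h'.exists_key h h₁ h₂ hU hp
    exact ⟨k, fun k' hk' => (hk k' hk').symm⟩

theorem exists_unitary_of_simpleStep {e e' : List (WireValue A G)} (h : SimpleStep P e e') :
    ∃ U : PictureDiagram P G, U.IsUnitary ∧ U.Evaluates e e' := by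
  rcases h with ⟨b, x, s, g, k, hgk, rfl, rfl⟩ | ⟨b, l, r, hrel, rfl, rfl⟩
  · obtain ⟨U, hU, he⟩ := exists_linear (P := P) x hgk b
    exact ⟨U, Or.inr hU, he⟩
  · obtain ⟨U, hU, he⟩ := exists_transistor hrel b
    exact ⟨U, Or.inl hU, he⟩

/-- The permutation needed before the simple move stays within the class of `D`, so it costs no
edge. -/
theorem Represents.exists_adj (h : Represents C D) (hne : C ≠ C') {k}
    (hk : ∀ k', k' ≠ k → C.val k' = C'.val k') : ∃ D', Represents C' D' ∧
      (bigPictureGraph P G).Adj (PictureVertex.mk D) (PictureVertex.mk D') := by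
  obtain ⟨e, -, hnd, hC⟩ := id h
  obtain ⟨e₁, e', hperm, hstep, hC'⟩ := WireConfig.exists_step hnd hC hne hk
  obtain ⟨K, R, hR, -, hRe, -⟩ := h.exists_mem_diagramClass (hperm.nodup_iff.2 hnd)
    fun v => by rw [hperm.mem_iff, hC]
  obtain ⟨U, hU, hUe⟩ := exists_unitary_of_simpleStep hstep
  obtain ⟨D', hD'⟩ := exists_product (D₁ := R) (D₂ := U)
    (hRe.word_eq.2.symm.trans hUe.word_eq.1)
  have he' := hD'.evaluates (normal_gens w) hRe hUe
  have hred : D'.IsReduced := by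
    obtain ⟨K', -, hK'⟩ := hD'
    exact hK'.1
  have h' : Represents C' D' := ⟨e', he', (hred.exists_represents he').1, hC'⟩
  exact ⟨D', h', adj_mk_iff.2 ⟨fun he => hne (h.eq_of_mk_eq h' he),
    Or.inl ⟨R, hR, D', h'.mem_diagramClass hred h', U, hU, hD'⟩⟩⟩

theorem Represents.adj_iff (h : Represents C D) (h' : Represents C' D') :
    (bigPictureGraph P G).Adj (PictureVertex.mk D) (PictureVertex.mk D') ↔
      ∃ k, C.val k ≠ C'.val k ∧ ∀ k', k' ≠ k → C.val k' = C'.val k' := by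
  rw [Configuration.exists_val_ne]
  refine ⟨h.exists_key_of_adj h', fun ⟨hne, k, hk⟩ => ?_⟩
  obtain ⟨D'', h'', hadj⟩ := h.exists_adj hne hk
  rwa [h'.mk_eq h'']

end PictureDiagram

variable (P G w) in
/-- Two configurations are adjacent when they differ at exactly one key. -/
def configurationGraph : SimpleGraph (wireEvents P G w).Configuration where
  Adj C C' := ∃ k, C.val k ≠ C'.val k ∧ ∀ k', k' ≠ k → C.val k' = C'.val k'
  symm := ⟨fun _ _ ⟨k, hk, h⟩ => ⟨k, hk.symm, fun k' hk' => (h k' hk').symm⟩⟩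
  loopless := ⟨fun _ ⟨_, hk, _⟩ => hk rfl⟩

/-- The Hamming model makes configurations connected before anything is known about which of them
come from diagrams; a path of configurations then lifts edge by edge through
`Represents.exists_adj`. -/
theorem PictureDiagram.Represents.exists_reachable {C C' : (wireEvents P G w).Configuration}
    {D : PictureDiagram P G} (h : Represents C D) : ∃ D', Represents C' D' ∧
      (bigPictureGraph P G).Reachable (PictureVertex.mk D) (PictureVertex.mk D') := by
  have : Nonempty (wireEvents P G w).Configuration := ⟨C⟩
  have hcon : (configurationGraph P G w).Connected :=
    (EventStructure.isHammingModel _ id Function.bijective_id fun _ _ => Iff.rfl).connected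
  obtain ⟨p⟩ := hcon.preconnected C C'
  induction p generalizing D with
  | nil => exact ⟨D, h, .refl _⟩
  | cons hadj _ ih =>
    obtain ⟨hne, k, hk⟩ := Configuration.exists_val_ne.1 hadj
    obtain ⟨D₁, h₁, hadj⟩ := h.exists_adj hne hk
    obtain ⟨D₂, h₂, hr⟩ := ih h₁
    exact ⟨D₂, h₂, hadj.reachable.trans hr⟩

/-- Right multiplication and reduction leave the top word unchanged, so it is constant on connected
components. -/
theorem exists_topWord_of_adj {X Y : PictureVertex P G} (h : (bigPictureGraph P G).Adj X Y)
    (hX : ∃ D : PictureDiagram P G, D.topWord = w ∧ X = PictureVertex.mk D) :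
    ∃ D : PictureDiagram P G, D.topWord = w ∧ Y = PictureVertex.mk D := by
  obtain ⟨D, hD, rfl⟩ := hX
  obtain ⟨_, D', rfl⟩ := Y
  refine ⟨D', ?_, rfl⟩
  rcases adj_mk_iff.1 h with ⟨-, ⟨D₁, h₁, D₂, h₂, U, -, hp⟩ | ⟨D₁, h₁, D₂, h₂, U, -, hp⟩⟩
  · rw [← topWord_eq_of_mem_diagramClass h₂, hp.topWord_eq, topWord_eq_of_mem_diagramClass h₁, hD]
  · rw [← topWord_eq_of_mem_diagramClass h₁, ← hp.topWord_eq, topWord_eq_of_mem_diagramClass h₂,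
      hD]

/-- The vertices of `X_b(P, G, w)` are the classes of diagrams with top word `w`. -/
theorem mem_baseComponent_iff {hw : w ≠ []} {X : PictureVertex P G} :
    X ∈ (baseComponent P G w hw).supp ↔
      ∃ D : PictureDiagram P G, D.topWord = w ∧ X = PictureVertex.mk D := by
  have hz : (w.map fun s => (⟨s, 1⟩ : Sigma G)) ≠ [] := by simpa using hw
  have hε : (epsilonDiagram P G _ hz).topWord = w := by
    change (List.finRange _).map (fun i => ((w.map fun s => (⟨s, 1⟩ : Sigma G)).get i).1) = w
    rw [← List.ofFn_eq_map, ← Function.comp_def, ← List.map_ofFn, List.ofFn_get]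
    simp [Function.comp_def]
  rw [SimpleGraph.ConnectedComponent.mem_supp_iff, baseComponent, SimpleGraph.ConnectedComponent.eq]
  constructor
  · rintro ⟨p⟩
    have key : ∀ {X Y : PictureVertex P G}, (bigPictureGraph P G).Walk X Y →
        (∃ D : PictureDiagram P G, D.topWord = w ∧ X = PictureVertex.mk D) →
        ∃ D : PictureDiagram P G, D.topWord = w ∧ Y = PictureVertex.mk D := by
      intro X Y p
      induction p with
      | nil => exact id
      | cons h _ ih => exact fun hX => ih (exists_topWord_of_adj h hX)
    exact key p.reverse ⟨_, hε, rfl⟩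
  · rintro ⟨D, hD, rfl⟩
    obtain ⟨C₀, h₀⟩ := exists_represents hε
    obtain ⟨C, h⟩ := exists_represents hD
    obtain ⟨D', h', hr⟩ := h₀.exists_reachable (C' := C)
    rw [h.mk_eq h']
    exact hr.symm

/-- Sending a class to its configuration is injective, as the configuration determines the class,
and surjective, as every configuration is reached from that of a vertex of the component. -/
theorem exists_isHammingModel (hw : w ≠ []) :
    ∃ c : (baseComponent P G w hw).supp → (wireEvents P G w).Configuration,
      (pictureGraph P G w hw).IsHammingModel fun a => (c a).val := by
  have hex : ∀ X : (baseComponent P G w hw).supp, ∃ C : (wireEvents P G w).Configuration,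
      ∃ D, Represents C D ∧ X.1 = PictureVertex.mk D := by
    rintro ⟨X, hX⟩
    obtain ⟨D, hD, rfl⟩ := mem_baseComponent_iff.1 hX
    obtain ⟨C, h⟩ := exists_represents hD
    exact ⟨C, D, h, rfl⟩
  choose c D hcD hD using hex
  refine ⟨c, EventStructure.isHammingModel _ c ⟨fun X Y h => ?_, fun C => ?_⟩ fun X Y => ?_⟩
  · exact Subtype.ext (((hD X).trans ((hcD X).mk_eq (h ▸ hcD Y))).trans (hD Y).symm)
  · obtain ⟨X, hX⟩ := (baseComponent P G w hw).nonempty_supp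
    obtain ⟨D', h', -⟩ := (hcD ⟨X, hX⟩).exists_reachable (C' := C)
    refine ⟨⟨PictureVertex.mk D', mem_baseComponent_iff.2 ⟨D', h'.topWord_eq, rfl⟩⟩, ?_⟩
    exact (hcD _).eq_of_mk_eq h' (hD _).symm
  · rw [← (hcD X).adj_iff (hcD Y), ← hD, ← hD]
    rfl

/-- With trivial groups no label event is valid, and a transistor is its own key. -/
theorem eq_of_valid_of_key_eq (hG : ∀ s, Subsingleton (G s)) (e f : WireEvent A G)
    (he : (wireEvents P G w).valid e) (hf : (wireEvents P G w).valid f)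
    (h : (wireEvents P G w).key e = (wireEvents P G w).key f) : e = f := by
  rcases e with ⟨l, r⟩ | v
  · rcases f with ⟨l', r'⟩ | v'
    · have h' : (l, r) = (l', r') := Sum.inl_injective h
      cases h'
      rfl
    · exact absurd (Subsingleton.elim (h := hG _) _ _) hf.2
  · exact absurd (Subsingleton.elim (h := hG _) _ _) he.2

end Main

/-- The vertices of `X_b(P, G, w)` are exactly the classes of `(w, *)`-diagrams, `X_b(P, G, w)` is
a quasi-median graph, and it is a median graph when all the groups are trivial. -/
theorem mainTheorem8 {A : Type u} (P : SemigroupPresentation A) (G : A → Type v)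
    [∀ s, Group (G s)] (w : List A) (hw : w ≠ []) :
    (∀ C : PictureVertex P G, C ∈ (baseComponent P G w hw).supp ↔
      ∃ D : PictureDiagram P G, D.topWord = w ∧ C = PictureVertex.mk D) ∧
    (pictureGraph P G w hw).IsQuasiMedian ∧
    ((∀ s, Subsingleton (G s)) → (pictureGraph P G w hw).IsMedian) := by
  have : Nonempty (baseComponent P G w hw).supp := (baseComponent P G w hw).nonempty_supp.to_subtype
  obtain ⟨c, hc⟩ := exists_isHammingModel (P := P) (G := G) hw
  exact ⟨fun C => mem_baseComponent_iff, hc.isQuasiMedian, fun hG => hc.isMedian fun a b o k =>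
    EventStructure.Configuration.val_two_values _ (eq_of_valid_of_key_eq hG) (c a) (c b) (c o) k⟩
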